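/- Let $\eta=\mathrm{diag}(1,-1,-1,-1)$ be the Minkowski metric on $\mathbb R^{1,3}$ in the basis $p_0,\dots,p_3$; Greek indices run from $0$ to $3$ and repeated upper and lower indices are summed. Let $E=W^{1,q}_0([0,1],\mathbb R^{1,3})$ with $q=1$ or $q=2$ be the space of absolutely continuous curves $\sigma$ with $\sigma(0)=0$ and $\dot\sigma\in L_q((0,1),\mathbb R^4)$, normed by $\|\dot\sigma\|_{L_q}$, and let $E_0=\{\sigma\in E:\sigma(1)=0\}$. For $\sigma\in E$ and $r\in[0,1]$ put $\sigma^r(t)=\sigma(rt)$. Let $m,l\ge 0$, let $A=A_\mu dx^\mu$ be a $C^\infty$ $su(N)$-valued $1$-form on $\mathbb R^{1,3}$ and $\phi$ a $C^\infty$ $su(N)$-valued function on $\mathbb R^{1,3}$. Put $\nabla_\mu f=\partial_\mu f+[A_\mu,f]$ and $F_{\mu\nu}=\partial_\mu A_\nu-\partial_\nu A_\mu+[A_\mu,A_\nu]$. The Yang–Mills–Higgs equations are $$\nabla^\mu\nabla_\mu\phi-(m^2-l\,\mathrm{tr}(\phi^*\phi))\phi=0,\qquad \nabla^\mu F_{\mu\nu}-[\phi,\nabla_\nu\phi]=0.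 \tag{1}$$ For $\sigma\in E$ and $0\le s\le t\le 1$ let $U^A_{t,s}(\sigma)$ be the solution of $\frac{d}{dt}U_{t,s}=-A_\mu(\sigma(t))\dot\sigma^\mu(t)U_{t,s}$, $\frac{d}{ds}U_{t,s}=U_{t,s}A_\mu(\sigma(s))\dot\sigma^\mu(s)$, $U_{s,s}=I_N$ (in the Carathéodory sense), let $U^A_{0,1}=(U^A_{1,0})^{-1}$ and $\Phi(\sigma)=\Phi^{A,\phi}(\sigma)=U^A_{0,1}(\sigma)\phi(\sigma(1))U^A_{1,0}(\sigma)$. *Lévy d'Alembertian.* Let $V$ be a finite-dimensional real vector space. $T^2_E$ is the space of continuous $V$-valued bilinear maps $Q$ on $E\times E$ which for $u,v\in E_0$ have the form $$Q(u,v)=\int_0^1\!\!\int_0^1 Q^V_{\mu\nu}(t,s)u^\mu(t)v^\nu(s)\,dt\,ds+\int_0^1Q^L_{\mu\nu}(t)u^\mu(t)v^\nu(t)\,dt+\tfrac12\int_0^1Q^S_{\mu\nu}(t)(\dot u^\mu(t)v^\nu(t)+\dot v^\mu(t)u^\nu(t))\,dt$$ with $Q^V_{\mu\nu}\in L_1([0,1]^2,V)$,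 $Q^L_{\mu\nu}=Q^L_{\nu\mu}\in L_1([0,1],V)$, $Q^S_{\mu\nu}=-Q^S_{\nu\mu}\in L_\infty([0,1],V)$. The Lévy trace of such a $Q$ is $\mathrm{tr}_L Q=\int_0^1\eta^{\mu\nu}Q^L_{\mu\nu}(t)\,dt$. The domain of $\Box_L$ consists of all $f\in C^2(E,V)$ with $f''(\sigma)\in T^2_E$ for all $\sigma\in E$, and $\Box_Lf(\sigma)=\mathrm{tr}_L f''(\sigma)$. *Endpoint derivative.* The domain of $D_\mu$ consists of all $f\in C^1(E,V)$ such that for every $\sigma\in E$ there is a Borel measure $\rho_\sigma$ on $[0,1]$ with values in $V\times\mathbb R^4$ such that $f'(\sigma)u=\int_0^1(u(t),\rho_\sigma(dt))_{\mathbb R^4}$ for all $u\in E$; then $D_\mu f(\sigma)=(p_\mu,\rho_\sigma(\{1\}))_{\mathbb R^4}$. **Theorem.** The function $\Phi$ takes values in $su(N)$, $U^A_{1,0}$ is in the domain of $\Box_L$, $\Phi$ and all $D_\nu\Phi$ are in the domain of the $D_\mu$, and $r\mapsto[\Phi(\sigma^r),D_\nu\Phi(\sigma^r)]\dot\sigma^\nu(r)$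 is integrable on $[0,1]$ for each $\sigma\in E$. The pair $(A,\phi)$ is a solution of (1) if and only if for all $\sigma\in E$ $$\eta^{\mu\nu}D_\mu D_\nu\Phi(\sigma)-(m^2-l\,\mathrm{tr}(\Phi(\sigma)^*\Phi(\sigma)))\Phi(\sigma)=0$$ and $$\Box_LU^A_{1,0}(\sigma)+U^A_{1,0}(\sigma)\int_0^1[\Phi(\sigma^r),D_\nu\Phi(\sigma^r)]\dot\sigma^\nu(r)\,dr=0 .$$ -/

import Mathlib

open MeasureTheory
open scoped ContDiff ENNReal Matrix Matrix.Norms.L2Operator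

noncomputable section

namespace YMH

/-- The underlying real vector space `ℝ⁴` of the Minkowski space `ℝ^{1,3}`, with coordinates
indexed by `0, 1, 2, 3`. Its Euclidean norm only serves to fix the topology and the norms of the
spaces of curves. -/
abbrev Spacetime : Type := EuclideanSpace ℝ (Fin 4)

/-- The basis vectors `p_0, p_1, p_2, p_3`. -/
def p (μ : Fin 4) : Spacetime := EuclideanSpace.single μ 1

/-- The Minkowski metric `η = diag(1, -1, -1, -1)`; it equals its own inverse, so that the same
matrix gives `η_{μν}` and `η^{μν}`. -/
def η : Matrix (Fin 4) (Fin 4) ℝ := Matrix.diagonal ![1, -1, -1, -1]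

/-- The algebra `M_N(ℂ)`. -/
abbrev Mat (N : ℕ) : Type := Matrix (Fin N) (Fin N) ℂ

/-- The Lie algebra `su(N)`: anti-Hermitian matrices of trace zero. -/
def su (N : ℕ) : Set (Mat N) := {M | Mᴴ = -M ∧ M.trace = 0}

/-! ### The spaces of curves `W^{1,q}_0([0,1], ℝ^{1,3})` -/

/-- The extension of a curve on `[0,1]` to `ℝ` which is constant outside `[0,1]`. -/
def ext (σ : unitInterval → Spacetime) : ℝ → Spacetime := Set.IccExtend zero_le_one σ

/-- `σ` is absolutely continuous, `σ(0) = 0` and `σ̇ ∈ L_q((0,1), ℝ^{1,3})`. -/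
def IsSobolevCurve (q : ℝ≥0∞) (σ : unitInterval → Spacetime) : Prop :=
  AbsolutelyContinuousOnInterval (ext σ) 0 1 ∧ σ 0 = 0 ∧
    MemLp (deriv (ext σ)) q (volume.restrict (Set.Ioo 0 1))

theorem ext_add (σ τ : unitInterval → Spacetime) : ext (σ + τ) = ext σ + ext τ := rfl

theorem ext_smul (c : ℝ) (σ : unitInterval → Spacetime) : ext (c • σ) = c • ext σ := rfl

theorem ae_differentiableAt_ext {σ : unitInterval → Spacetime}
    (h : AbsolutelyContinuousOnInterval (ext σ) 0 1) :
    ∀ᵐ t ∂(volume.restrict (Set.Ioo (0 : ℝ) 1)), DifferentiableAt ℝ (ext σ) t := by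
  rw [ae_restrict_iff' measurableSet_Ioo]
  filter_upwards [h.boundedVariationOn.ae_differentiableAt_of_mem_uIcc] with t ht hmem
  exact ht (by rw [Set.uIcc_of_le zero_le_one]; exact Set.Ioo_subset_Icc_self hmem)

theorem deriv_ext_add {σ τ : unitInterval → Spacetime}
    (hσ : AbsolutelyContinuousOnInterval (ext σ) 0 1)
    (hτ : AbsolutelyContinuousOnInterval (ext τ) 0 1) :
    deriv (ext (σ + τ)) =ᵐ[volume.restrict (Set.Ioo 0 1)] deriv (ext σ) + deriv (ext τ) := by
  filter_upwards [ae_differentiableAt_ext hσ, ae_differentiableAt_ext hτ] with t h1 h2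
  rw [ext_add]
  exact deriv_add h1 h2

theorem deriv_ext_smul (c : ℝ) {σ : unitInterval → Spacetime}
    (hσ : AbsolutelyContinuousOnInterval (ext σ) 0 1) :
    deriv (ext (c • σ)) =ᵐ[volume.restrict (Set.Ioo 0 1)] c • deriv (ext σ) := by
  filter_upwards [ae_differentiableAt_ext hσ] with t h1
  rw [ext_smul]
  exact deriv_const_smul c h1

/-- The Sobolev curves as a linear subspace of all functions `[0,1] → ℝ^{1,3}`. -/
def sobolevSubmodule (q : ℝ≥0∞) : Submodule ℝ (unitInterval → Spacetime) where
  carrier := {σ | IsSobolevCurve q σ}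
  zero_mem' := by
    have h : ext 0 = fun _ => 0 := rfl
    refine ⟨?_, rfl, ?_⟩
    · rw [h]; exact (absolutelyContinuousOnInterval_iff _ _ _).2 fun ε hε => ⟨1, one_pos, fun _ _ _ => by simpa⟩
    · rw [h]; simp
  add_mem' := by
    rintro σ τ ⟨h1, h2, h3⟩ ⟨k1, k2, k3⟩
    refine ⟨?_, ?_, (memLp_congr_ae (deriv_ext_add h1 k1)).2 (h3.add k3)⟩
    · rw [ext_add]; exact h1.add k1
    · simp [h2, k2]
  smul_mem' := by
    rintro c σ ⟨h1, h2, h3⟩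
    refine ⟨?_, ?_, (memLp_congr_ae (deriv_ext_smul c h1)).2 (h3.const_smul c)⟩
    · exact h1.const_smul c
    · simp [h2]

/-- The space `E = W^{1,q}_0([0,1], ℝ^{1,3})`. -/
def Curve (q : ℝ≥0∞) : Type := sobolevSubmodule q

instance (q : ℝ≥0∞) : AddCommGroup (Curve q) := inferInstanceAs (AddCommGroup (sobolevSubmodule q))

instance (q : ℝ≥0∞) : Module ℝ (Curve q) := inferInstanceAs (Module ℝ (sobolevSubmodule q))

instance (q : ℝ≥0∞) : CoeFun (Curve q) (fun _ => unitInterval → Spacetime) := ⟨fun σ => σ.1⟩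

/-- The velocity `σ̇`, as a function on `ℝ` of which only the values on `(0,1)` matter. -/
def velocity {q : ℝ≥0∞} (σ : Curve q) : ℝ → Spacetime := deriv (ext σ)

theorem memLp_velocity {q : ℝ≥0∞} (σ : Curve q) :
    MemLp (velocity σ) q (volume.restrict (Set.Ioo 0 1)) := σ.2.2.2

/-- The map `σ ↦ σ̇` from `W^{1,q}_0` to `L_q`. -/
def velocityLp (q : ℝ≥0∞) :
    Curve q →ₗ[ℝ] Lp Spacetime q (volume.restrict (Set.Ioo (0 : ℝ) 1)) where
  toFun σ := (memLp_velocity σ).toLp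
  map_add' σ τ := by
    rw [← MemLp.toLp_add]
    exact MemLp.toLp_congr _ _ (deriv_ext_add σ.2.1 τ.2.1)
  map_smul' c σ := by
    rw [RingHom.id_apply, ← MemLp.toLp_const_smul]
    exact MemLp.toLp_congr _ _ (deriv_ext_smul c σ.2.1)

theorem velocityLp_injective (q : ℝ≥0∞) : Function.Injective (velocityLp q) := by
  refine (injective_iff_map_eq_zero _).2 fun σ hσ => ?_
  have h0 : deriv (ext σ) =ᵐ[volume.restrict (Set.Ioo 0 1)] 0 :=
    (MemLp.toLp_eq_toLp_iff (memLp_velocity σ) MemLp.zero).1 (hσ.trans (MemLp.toLp_zero _).symm)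
  have h1 : ∀ᵐ t ∂(volume.restrict (Set.Ioo (0 : ℝ) 1)), HasDerivAt (ext σ) 0 t := by
    filter_upwards [h0, ae_differentiableAt_ext σ.2.1] with t ht hd
    have := hd.hasDerivAt
    rwa [ht] at this
  rw [restrict_Ioo_eq_restrict_Icc, ae_restrict_iff' measurableSet_Icc] at h1
  obtain ⟨C, hC⟩ := σ.2.1.const_of_ae_hasDerivAt_zero
    (by rwa [Set.uIcc_of_le zero_le_one])
  rw [Set.uIcc_of_le zero_le_one] at hC
  have hval : ∀ t : unitInterval, σ t = C := fun t => by
    have := hC t t.2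
    rwa [ext, Set.IccExtend_val] at this
  have hC0 : C = 0 := by rw [← hval 0]; exact σ.2.2.1
  exact Subtype.ext (funext fun t => (hval t).trans hC0)

/-- The norm `‖σ‖ = ‖σ̇‖_{L_q}` of `W^{1,q}_0`. -/
instance (q : ℝ≥0∞) [Fact (1 ≤ q)] : NormedAddCommGroup (Curve q) :=
  NormedAddCommGroup.induced _ _ (velocityLp q) (velocityLp_injective q)

instance (q : ℝ≥0∞) [Fact (1 ≤ q)] : NormedSpace ℝ (Curve q) :=
  NormedSpace.induced ℝ _ _ (velocityLp q)

/-- The subspace `E_0` of the curves with `σ(1) = 0`, as a set. -/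
def closedCurves (q : ℝ≥0∞) : Set (Curve q) := {σ | σ 1 = 0}

theorem isSobolevCurve_rescale {q : ℝ≥0∞} {σ : unitInterval → Spacetime}
    (h : IsSobolevCurve q σ) (r : unitInterval) :
    IsSobolevCurve q (fun t => σ (r * t)) := by
  obtain ⟨h1, h2, h3⟩ := h
  have key : ∀ t ∈ Set.Icc (0 : ℝ) 1, ext (fun t => σ (r * t)) t = ext σ (r * t) := by
    intro t ht
    have hrt : (r : ℝ) * t ∈ Set.Icc (0 : ℝ) 1 := (r * ⟨t, ht⟩ : unitInterval).2
    rw [ext, ext, Set.IccExtend_of_mem _ _ ht, Set.IccExtend_of_mem _ _ hrt]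
    rfl
  rcases eq_or_lt_of_le r.2.1 with h0 | hr
  · have hr0 : r = 0 := Subtype.ext h0.symm
    subst hr0
    have he : ext (fun t => σ (0 * t)) = fun _ => 0 := by
      funext t; simp [ext, Set.IccExtend, h2]
    refine ⟨?_, by simpa using h2, ?_⟩
    · rw [he]; exact (absolutelyContinuousOnInterval_iff _ _ _).2 fun ε hε => ⟨1, one_pos, fun _ _ _ => by simpa⟩
    · rw [he]; simp
  refine ⟨?_, by simpa using h2, ?_⟩
  · rw [absolutelyContinuousOnInterval_iff] at h1 ⊢
    intro ε hε
    obtain ⟨δ, hδ, H⟩ := h1 ε hε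
    refine ⟨δ, hδ, fun I hI hlen => ?_⟩
    rw [AbsolutelyContinuousOnInterval.disjWithin, Set.mem_ofPred_eq,
      Set.uIcc_of_le zero_le_one] at hI
    obtain ⟨hmem, hdisj⟩ := hI
    have hsc : ∀ x ∈ Set.Icc (0 : ℝ) 1, (r : ℝ) * x ∈ Set.Icc (0 : ℝ) 1 :=
      fun x hx => (r * ⟨x, hx⟩ : unitInterval).2
    have := H (I.1, fun i => ((r : ℝ) * (I.2 i).1, (r : ℝ) * (I.2 i).2)) ?_ ?_
    · refine lt_of_eq_of_lt (Finset.sum_congr rfl fun i hi => ?_) this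
      rw [key _ (hmem i hi).1, key _ (hmem i hi).2]
    · rw [AbsolutelyContinuousOnInterval.disjWithin, Set.mem_ofPred_eq,
        Set.uIcc_of_le zero_le_one]
      refine ⟨fun i hi => ⟨hsc _ (hmem i hi).1, hsc _ (hmem i hi).2⟩, ?_⟩
      intro i hi j hj hij
      have := hdisj hi hj hij
      rw [Function.onFun, Set.disjoint_left] at this ⊢
      intro x hx hx'
      refine this (a := x / r) ?_ ?_
      · rw [Set.mem_uIoc] at hx ⊢
        simpa [lt_div_iff₀ hr, div_le_iff₀ hr, mul_comm] using hx
      · rw [Set.mem_uIoc] at hx' ⊢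
        simpa [lt_div_iff₀ hr, div_le_iff₀ hr, mul_comm] using hx'
    · refine lt_of_le_of_lt (Finset.sum_le_sum fun i _ => ?_) hlen
      simp only [Real.dist_eq, ← mul_sub, abs_mul, abs_of_pos hr]
      exact mul_le_of_le_one_left (abs_nonneg _) r.2.2
  · have hd : deriv (ext fun t => σ (r * t)) =ᵐ[volume.restrict (Set.Ioo 0 1)]
        fun t => (r : ℝ) • deriv (ext σ) (r * t) := by
      filter_upwards [ae_restrict_mem measurableSet_Ioo] with t ht
      have : ext (fun t => σ (r * t)) =ᶠ[nhds t] fun t => ext σ (r * t) := by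
        filter_upwards [Ioo_mem_nhds ht.1 ht.2] with s hs
        exact key s (Set.Ioo_subset_Icc_self hs)
      rw [this.deriv_eq]
      exact deriv_comp_mul_left (r : ℝ) (ext σ) t
    rw [memLp_congr_ae hd]
    refine MemLp.const_smul ?_ (r : ℝ)
    have hemb : MeasurableEmbedding (fun t : ℝ => (r : ℝ) * t) :=
      (Homeomorph.mulLeft₀ (r : ℝ) hr.ne').measurableEmbedding
    have hmap : (volume.restrict (Set.Ioo (0 : ℝ) 1)).map (fun t : ℝ => (r : ℝ) * t) =
        ENNReal.ofReal |(r : ℝ)⁻¹| • volume.restrict (Set.Ioo (0 : ℝ) r) := by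
      have hpre : (fun t : ℝ => (r : ℝ) * t) ⁻¹' Set.Ioo (0 : ℝ) r = Set.Ioo 0 1 := by
        ext t
        simp only [Set.mem_preimage, Set.mem_Ioo]
        constructor
        · rintro ⟨a, b⟩; exact ⟨by nlinarith, by nlinarith⟩
        · rintro ⟨a, b⟩; exact ⟨by positivity, by nlinarith⟩
      rw [← hpre, ← hemb.restrict_map, Real.map_volume_mul_left hr.ne', Measure.restrict_smul]
    have : MemLp (deriv (ext σ)) q
        ((volume.restrict (Set.Ioo (0 : ℝ) 1)).map (fun t : ℝ => (r : ℝ) * t)) := by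
      rw [hmap]
      refine MemLp.smul_measure (h3.mono_measure ?_) ENNReal.ofReal_ne_top
      exact Measure.restrict_mono (Set.Ioo_subset_Ioo_right r.2.2) le_rfl
    exact hemb.memLp_map_measure_iff.1 this

/-- The curve `σ^r(t) = σ(rt)`. -/
def rescale {q : ℝ≥0∞} (σ : Curve q) (r : unitInterval) : Curve q :=
  ⟨fun t => σ (r * t), isSobolevCurve_rescale σ.2 r⟩

/-! ### Connections and the Yang–Mills–Higgs equations -/

/-- The partial derivative `∂_μ f`. -/
def partialDeriv {N : ℕ} (μ : Fin 4) (f : Spacetime → Mat N) (x : Spacetime) : Mat N :=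
  fderiv ℝ f x (p μ)

/-- The covariant derivative `∇_μ f = ∂_μ f + [A_μ, f]`. -/
def nabla {N : ℕ} (A : Fin 4 → Spacetime → Mat N) (μ : Fin 4) (f : Spacetime → Mat N)
    (x : Spacetime) : Mat N :=
  partialDeriv μ f x + ⁅A μ x, f x⁆

/-- The curvature `F_{μν} = ∂_μ A_ν - ∂_ν A_μ + [A_μ, A_ν]`. -/
def curvature {N : ℕ} (A : Fin 4 → Spacetime → Mat N) (μ ν : Fin 4) (x : Spacetime) : Mat N :=
  partialDeriv μ (A ν) x - partialDeriv ν (A μ) x + ⁅A μ x, A ν x⁆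

/-- A smooth `su(N)`-valued field. -/
def IsSmoothSuField {N : ℕ} (f : Spacetime → Mat N) : Prop :=
  ContDiff ℝ ∞ f ∧ ∀ x, f x ∈ su N

/-- The Yang–Mills–Higgs equations
`∇^μ ∇_μ φ - (m² - l tr(φ* φ)) φ = 0` and `∇^μ F_{μν} - [φ, ∇_ν φ] = 0`. -/
def SolvesYangMillsHiggs {N : ℕ} (m l : ℝ) (A : Fin 4 → Spacetime → Mat N)
    (φ : Spacetime → Mat N) : Prop :=
  (∀ x, ∑ μ, ∑ ν, η μ ν • nabla A μ (nabla A ν φ) x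
      - ((m : ℂ) ^ 2 - (l : ℂ) * ((φ x)ᴴ * φ x).trace) • φ x = 0) ∧
  (∀ ν x, ∑ lam, ∑ μ, η lam μ • nabla A lam (curvature A μ ν) x - ⁅φ x, nabla A ν φ x⁆ = 0)

/-! ### Parallel transport -/

/-- The matrix `A_μ(σ(t)) σ̇^μ(t)`. -/
def connectionAlong {q : ℝ≥0∞} {N : ℕ} (A : Fin 4 → Spacetime → Mat N) (σ : Curve q) (t : ℝ) :
    Mat N :=
  ∑ μ, velocity σ t μ • A μ (ext σ t)

/-- `U t s`, `0 ≤ s ≤ t ≤ 1`, solves the system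
`d/dt U_{t,s} = - A_μ(σ(t)) σ̇^μ(t) U_{t,s}`, `d/ds U_{t,s} = U_{t,s} A_μ(σ(s)) σ̇^μ(s)`,
`U_{s,s} = I`. As `σ̇` is only integrable, solutions are understood in the sense of Carathéodory,
that is, as continuous solutions of the integrated equations. -/
structure IsParallelTransport {q : ℝ≥0∞} {N : ℕ} (A : Fin 4 → Spacetime → Mat N) (σ : Curve q)
    (U : ℝ → ℝ → Mat N) : Prop where
  continuousOn_left : ∀ s ∈ Set.Icc (0 : ℝ) 1, ContinuousOn (fun t => U t s) (Set.Icc s 1)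
  continuousOn_right : ∀ t ∈ Set.Icc (0 : ℝ) 1, ContinuousOn (fun s => U t s) (Set.Icc 0 t)
  left_eq : ∀ s t : ℝ, 0 ≤ s → s ≤ t → t ≤ 1 →
    U t s = 1 - ∫ τ in s..t, connectionAlong A σ τ * U τ s
  right_eq : ∀ s t : ℝ, 0 ≤ s → s ≤ t → t ≤ 1 →
    U t s = 1 - ∫ τ in s..t, U t τ * connectionAlong A σ τ

open Classical in
/-- The solution `U^A_{t,s}(σ)`, `0 ≤ s ≤ t ≤ 1`, of the system of parallel transport. -/
def transport {q : ℝ≥0∞} {N : ℕ} (A : Fin 4 → Spacetime → Mat N) (σ : Curve q) :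
    ℝ → ℝ → Mat N :=
  if h : ∃ U, IsParallelTransport A σ U then h.choose else 1

/-- The parallel transport `U^A_{1,0}` along the whole curve. -/
def U10 {q : ℝ≥0∞} {N : ℕ} (A : Fin 4 → Spacetime → Mat N) (σ : Curve q) : Mat N :=
  transport A σ 1 0

/-- `U^A_{0,1} = (U^A_{1,0})⁻¹`. -/
def U01 {q : ℝ≥0∞} {N : ℕ} (A : Fin 4 → Spacetime → Mat N) (σ : Curve q) : Mat N :=
  (U10 A σ)⁻¹

/-- `Φ^{A,φ}(σ) = U^A_{0,1}(σ) φ(σ(1)) U^A_{1,0}(σ)`. -/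
def Φ {q : ℝ≥0∞} {N : ℕ} (A : Fin 4 → Spacetime → Mat N) (φ : Spacetime → Mat N)
    (σ : Curve q) : Mat N :=
  U01 A σ * φ (σ 1) * U10 A σ

/-! ### The Lévy trace and the Lévy d'Alembertian -/

/-- On `E_0 × E_0` the bilinear map `Q` is the sum of a Volterra part with kernel `QV`, a Lévy part
with kernel `QL` and a singular part with kernel `QS`. -/
structure HasLevyKernels {q : ℝ≥0∞} [Fact (1 ≤ q)] {V : Type} [NormedAddCommGroup V]
    [NormedSpace ℝ V] (Q : Curve q →L[ℝ] Curve q →L[ℝ] V)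
    (QV : Fin 4 → Fin 4 → ℝ × ℝ → V) (QL QS : Fin 4 → Fin 4 → ℝ → V) : Prop where
  integrable_volterra : ∀ μ ν,
    IntegrableOn (QV μ ν) (Set.Icc (0 : ℝ) 1 ×ˢ Set.Icc (0 : ℝ) 1)
  integrable_levy : ∀ μ ν, IntegrableOn (QL μ ν) (Set.Icc (0 : ℝ) 1)
  memLp_singular : ∀ μ ν, MemLp (QS μ ν) ∞ (volume.restrict (Set.Icc (0 : ℝ) 1))
  levy_symm : ∀ μ ν t, QL μ ν t = QL ν μ t
  singular_antisymm : ∀ μ ν t, QS μ ν t = -QS ν μ t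
  eq_on : ∀ u ∈ closedCurves q, ∀ v ∈ closedCurves q,
    Q u v =
      (∫ t in (0 : ℝ)..1, ∫ s in (0 : ℝ)..1,
        ∑ μ, ∑ ν, (ext u t μ * ext v s ν) • QV μ ν (t, s))
      + (∫ t in (0 : ℝ)..1, ∑ μ, ∑ ν, (ext u t μ * ext v t ν) • QL μ ν t)
      + (1 / 2 : ℝ) • ∫ t in (0 : ℝ)..1, ∑ μ, ∑ ν,
          (velocity u t μ * ext v t ν + velocity v t μ * ext u t ν) • QS μ ν t

/-- The space `T²_E` of (`V`-valued) continuous bilinear maps with such a representation. -/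
def MemLevySpace {q : ℝ≥0∞} [Fact (1 ≤ q)] {V : Type} [NormedAddCommGroup V] [NormedSpace ℝ V]
    (Q : Curve q →L[ℝ] Curve q →L[ℝ] V) : Prop :=
  ∃ QL QV QS, HasLevyKernels Q QV QL QS

open Classical in
/-- The Lévy trace `∫_0^1 η^{μν} Q^L_{μν}(t) dt` of an element `Q` of `T²_E` generated by the
Minkowski metric; it does not depend on the representation of `Q`. -/
def levyTrace {q : ℝ≥0∞} [Fact (1 ≤ q)] {V : Type} [NormedAddCommGroup V] [NormedSpace ℝ V]
    (Q : Curve q →L[ℝ] Curve q →L[ℝ] V) : V :=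
  if h : MemLevySpace Q then ∫ t in (0 : ℝ)..1, ∑ μ, ∑ ν, η μ ν • h.choose μ ν t else 0

/-- The domain of the Lévy d'Alembertian: `f ∈ C²(E, V)` with `f''(σ) ∈ T²_E` for all `σ`. -/
def MemDomBox {q : ℝ≥0∞} [Fact (1 ≤ q)] {V : Type} [NormedAddCommGroup V] [NormedSpace ℝ V]
    (f : Curve q → V) : Prop :=
  ContDiff ℝ 2 f ∧ ∀ σ, MemLevySpace (fderiv ℝ (fderiv ℝ f) σ)

/-- The Lévy d'Alembertian `□_L f(σ)`, the Lévy trace of `f''(σ)`. -/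
def levyBox {q : ℝ≥0∞} [Fact (1 ≤ q)] {V : Type} [NormedAddCommGroup V] [NormedSpace ℝ V]
    (f : Curve q → V) (σ : Curve q) : V :=
  levyTrace (fderiv ℝ (fderiv ℝ f) σ)

/-! ### Endpoint derivatives -/

/-- `T(u) = ∫_0^1 (u(t), ρ(dt))` for all `u ∈ E`, where `ρ` is a Borel measure on `[0,1]` with values
in `V × ℝ⁴`, given by its components `ρ μ`. -/
def IsRepresentedBy {q : ℝ≥0∞} [Fact (1 ≤ q)] {V : Type} [NormedAddCommGroup V] [NormedSpace ℝ V]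
    (T : Curve q →L[ℝ] V) (ρ : Fin 4 → VectorMeasure unitInterval V) : Prop :=
  (∀ μ, IsFiniteMeasure (ρ μ).variation) ∧
    ∀ u : Curve q, T u = ∑ μ, (ρ μ).integral (fun t => u t μ) (ContinuousLinearMap.lsmul ℝ ℝ)

open Classical in
/-- The functional `S_h(T) = (h, ρ({1}))`, where `ρ` represents `T`; `ρ({1})` is determined
by `T`. -/
def endpointFunctional {q : ℝ≥0∞} [Fact (1 ≤ q)] {V : Type} [NormedAddCommGroup V]
    [NormedSpace ℝ V] (h : Spacetime) (T : Curve q →L[ℝ] V) : V :=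
  if hT : ∃ ρ, IsRepresentedBy T ρ then ∑ μ, h μ • hT.choose μ {1} else 0

/-- The domain of the endpoint derivations: `f ∈ C¹(E, V)` such that every `f'(σ)` is represented
by a measure. -/
def MemDomEndpoint {q : ℝ≥0∞} [Fact (1 ≤ q)] {V : Type} [NormedAddCommGroup V] [NormedSpace ℝ V]
    (f : Curve q → V) : Prop :=
  ContDiff ℝ 1 f ∧ ∀ σ, ∃ ρ, IsRepresentedBy (fderiv ℝ f σ) ρ

/-- The endpoint derivative `D_μ f(σ) = S_{p_μ}(f'(σ))`. -/
def D {q : ℝ≥0∞} [Fact (1 ≤ q)] {V : Type} [NormedAddCommGroup V] [NormedSpace ℝ V]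
    (μ : Fin 4) (f : Curve q → V) (σ : Curve q) : V :=
  endpointFunctional (p μ) (fderiv ℝ f σ)

/-- The integrand `[Φ(σ^r), D_ν Φ(σ^r)] σ̇^ν(r)`. -/
def currentIntegrand {q : ℝ≥0∞} [Fact (1 ≤ q)] {N : ℕ} (Ψ : Curve q → Mat N) (σ : Curve q)
    (r : ℝ) : Mat N :=
  ∑ ν, velocity σ r ν •
    ⁅Ψ (rescale σ (Set.projIcc 0 1 zero_le_one r)),
      D ν Ψ (rescale σ (Set.projIcc 0 1 zero_le_one r))⁆

end YMH

end

open YMH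

noncomputable section

namespace YMH

/-! ### Absolutely continuous functions and their primitives -/

section AbsolutelyContinuous

variable {X Y : Type*} [PseudoMetricSpace X] [PseudoMetricSpace Y]

/-! The parallel transport `U_t` along `σ` solves a linear Volterra equation `(1 + K_σ) U = 1` in
`C([0,1], M_N)`. The powers of `K_σ` are bounded by `cⁿ/n!`, so `1 + K_σ` is invertible; since `σ`
enters `K_σ` smoothly, `U` is a smooth function of the curve. Linearising the equation and using
uniqueness of its solutions gives the non-abelian Stokes formula `dU_t(u) = -A_μ(σ(t)) u^μ(t) U_t -
U_t W_u(t)`, `W_u(t) = ∫_0^t U_s⁻¹ F_{μν}(σ(s)) U_s u^μ(s) σ̇^ν(s) ds` (`fderiv_transportMap`), on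
which both equations rest.

Endpoint equation. By this formula the derivative of `U_t⁻¹ f(σ(t)) U_t` is `U_t⁻¹ (∇_μ f) U_t
u^μ(t)` plus the commutator of `W_u(t)` with `U_t⁻¹ f U_t`. At `t = 1` the first term is an atom at
`1` and the second has a density in `t`, so `D_μ` replaces `f` by `∇_μ f` (`D_translate`). The first
functional equation at `σ` is therefore the Higgs equation at `σ(1)` conjugated by a unitary matrix,
and every point is the end of some curve (`endpoint_equation_iff`).

Lévy equation. On `E_0` the boundary term of `dU_1` vanishes, and one more differentiation produces
products of two curvature densities (Volterra part), a term in `F_{μν} u^μ v̇^ν` and a term in `∇_λ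
F_{μν} v^λ u^μ σ̇^ν`. Symmetrising in `u, v` separates the last two into singular and Lévy parts
(`hasLevyKernels_holonomy`). The Lévy trace is then `-U_{1,0} ∫ U⁻¹ (∇^μ F_{μν}) U σ̇^ν`, so the
left-hand side of the second equation equals `-U_{1,0} ∫ U⁻¹ j_ν U σ̇^ν`, where `j_ν` is the
left-hand side of the Yang–Mills equation (`levyBox_add_mul_integral`). If this vanishes for every
curve, it vanishes for all `σ^r`; differentiating in `r` and letting `r` tend to `1` gives
`j_ν(σ(1)) σ̇^ν(1) = 0` for curves with arbitrary endpoint and final velocity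
(`eq_zero_of_sum_J_eq_zero`).

The Lévy trace and the endpoint derivative are defined through a chosen representation. The choice
is immaterial: rapidly oscillating sine curves recover the diagonal Lévy integrals, and the curves
`t^(n+1) p_μ` recover the atom at `1`. -/

theorem absolutelyContinuousOnInterval_of_dist_le {f : ℝ → X} {g : ℝ → Y} {a b K : ℝ}
    (hg : AbsolutelyContinuousOnInterval g a b)
    (h : ∀ x ∈ Set.uIcc a b, ∀ y ∈ Set.uIcc a b, dist (f x) (f y) ≤ K * dist (g x) (g y)) :
    AbsolutelyContinuousOnInterval f a b := by
  rw [absolutelyContinuousOnInterval_iff] at hg ⊢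
  intro ε hε
  -- `K` may be zero or negative; `|K| + 1` is a positive upper bound for it.
  obtain ⟨δ, hδ, H⟩ := hg (ε / (|K| + 1)) (by positivity)
  refine ⟨δ, hδ, fun I hI hlen => ?_⟩
  have h1 := H I hI hlen
  rw [lt_div_iff₀ (by positivity), Finset.sum_mul] at h1
  refine lt_of_le_of_lt (Finset.sum_le_sum fun i hi => ?_) h1
  refine (h _ (hI.1 i hi).1 _ (hI.1 i hi).2).trans ?_
  rw [mul_comm]
  gcongr
  exact (le_abs_self K).trans (by linarith)

variable {V : Type*} [NormedAddCommGroup V] [NormedSpace ℝ V]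

/-- The increments are dominated by those of the scalar primitive of `‖a‖`, which is absolutely
continuous. -/
theorem absolutelyContinuousOnInterval_primitive {a : ℝ → V}
    (ha : IntervalIntegrable a volume 0 1) :
    AbsolutelyContinuousOnInterval (fun t => ∫ s in (0 : ℝ)..t, a s) 0 1 := by
  have h0 : (0 : ℝ) ∈ Set.uIcc (0 : ℝ) 1 := Set.left_mem_uIcc
  have hn := ha.norm.absolutelyContinuousOnInterval_intervalIntegral h0
  refine absolutelyContinuousOnInterval_of_dist_le (K := 1) hn fun x hx y hy => ?_
  have hi : ∀ x ∈ Set.uIcc (0 : ℝ) 1, IntervalIntegrable a volume 0 x := fun x hx =>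
    ha.mono_set (Set.uIcc_subset_uIcc h0 hx)
  rw [dist_eq_norm, dist_eq_norm, one_mul,
    intervalIntegral.integral_interval_sub_left (hi x hx) (hi y hy),
    intervalIntegral.integral_interval_sub_left (hi x hx).norm (hi y hy).norm]
  exact intervalIntegral.norm_integral_le_abs_integral_norm

variable [CompleteSpace V]

/-- The fundamental theorem of calculus for absolutely continuous functions. -/
theorem eq_add_integral_of_ae_hasDerivAt {f a : ℝ → V}
    (hf : AbsolutelyContinuousOnInterval f 0 1) (ha : IntervalIntegrable a volume 0 1)
    (h : ∀ᵐ t, t ∈ Set.Ioo (0 : ℝ) 1 → HasDerivAt f (a t) t) {t : ℝ} (ht : t ∈ Set.Icc (0 : ℝ) 1) :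
    f t = f 0 + ∫ s in (0 : ℝ)..t, a s := by
  have hsub := hf.sub (absolutelyContinuousOnInterval_primitive ha)
  obtain ⟨C, hC⟩ := hsub.const_of_ae_hasDerivAt_zero (by
    have hne : ∀ c : ℝ, ∀ᵐ x : ℝ, x ≠ c := fun c => by simp [ae_iff, measure_singleton]
    filter_upwards [h, ha.ae_hasDerivAt_integral, hne 0, hne 1] with x h1 h2 h3 h4 hx
    have hx' := hx
    rw [Set.uIcc_of_le zero_le_one] at hx'
    have := (h1 ⟨lt_of_le_of_ne hx'.1 h3.symm, lt_of_le_of_ne hx'.2 h4⟩).sub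
      (h2 hx 0 Set.left_mem_uIcc)
    rwa [sub_self] at this)
  rw [Set.uIcc_of_le zero_le_one] at hC
  have h0 := hC 0 ⟨le_rfl, zero_le_one⟩
  have h1 := hC t ht
  simp only [Pi.sub_apply, intervalIntegral.integral_same, sub_zero] at h0 h1
  rw [h0, ← h1, sub_add_cancel]

end AbsolutelyContinuous

/-- The continuous function `f` on `[0,1]` is a primitive of the integrable function `a`. -/
structure IsPrimitive {V : Type*} [NormedAddCommGroup V] [NormedSpace ℝ V]
    (f : C(unitInterval, V)) (a : ℝ → V) : Prop where
  intervalIntegrable : IntervalIntegrable a volume 0 1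
  eq_add : ∀ t : unitInterval, f t = f 0 + ∫ s in (0 : ℝ)..t, a s

/-- The extension of a continuous function on `[0,1]` which is constant outside `[0,1]`. -/
def extend {V : Type*} [TopologicalSpace V] (f : C(unitInterval, V)) : C(ℝ, V) :=
  f.comp ⟨Set.projIcc 0 1 zero_le_one, continuous_projIcc⟩

section Extend

variable {V : Type*} [TopologicalSpace V]

theorem extend_apply (f : C(unitInterval, V)) (t : ℝ) :
    extend f t = f (Set.projIcc 0 1 zero_le_one t) := rfl

@[simp] theorem extend_coe (f : C(unitInterval, V)) (t : unitInterval) : extend f t = f t := by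
  simp [extend_apply]

theorem extend_of_mem (f : C(unitInterval, V)) {t : ℝ} (ht : t ∈ Set.Icc (0 : ℝ) 1) :
    extend f t = f ⟨t, ht⟩ := by
  rw [extend_apply, Set.projIcc_of_mem]

end Extend

namespace IsPrimitive

variable {V W : Type*} [NormedAddCommGroup V] [NormedSpace ℝ V] [NormedAddCommGroup W]
  [NormedSpace ℝ W]

/-- The pattern for identities between curve functionals: show that the densities cancel pointwise
and that the value at `0` vanishes. -/
theorem eq_zero_of_zero {f : C(unitInterval, V)} (h : IsPrimitive f 0) (h0 : f 0 = 0) : f = 0 := by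
  ext t
  rw [h.eq_add, h0]
  simp

theorem const (c : V) : IsPrimitive (ContinuousMap.const unitInterval c) 0 where
  intervalIntegrable := by simp [Pi.zero_def]
  eq_add t := by simp

theorem add {f g : C(unitInterval, V)} {a b : ℝ → V} (hf : IsPrimitive f a)
    (hg : IsPrimitive g b) : IsPrimitive (f + g) (a + b) where
  intervalIntegrable := hf.1.add hg.1
  eq_add t := by
    have hs : Set.uIcc (0 : ℝ) t ⊆ Set.uIcc 0 1 := Set.uIcc_subset_uIcc Set.left_mem_uIcc
      (by rw [Set.uIcc_of_le zero_le_one]; exact t.2)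
    simp only [Pi.add_apply]
    rw [intervalIntegral.integral_add (hf.1.mono_set hs) (hg.1.mono_set hs),
      ContinuousMap.add_apply, hf.2 t, hg.2 t, ContinuousMap.add_apply]
    abel

theorem neg {f : C(unitInterval, V)} {a : ℝ → V} (hf : IsPrimitive f a) :
    IsPrimitive (-f) (-a) where
  intervalIntegrable := hf.1.neg
  eq_add t := by
    simp only [Pi.neg_apply, intervalIntegral.integral_neg]
    rw [ContinuousMap.neg_apply, hf.2 t, ContinuousMap.neg_apply]
    abel

theorem sum {ι : Type*} (s : Finset ι) {f : ι → C(unitInterval, V)} {a : ι → ℝ → V}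
    (h : ∀ i ∈ s, IsPrimitive (f i) (a i)) : IsPrimitive (∑ i ∈ s, f i) (∑ i ∈ s, a i) := by
  induction s using Finset.cons_induction with
  | empty => exact const 0
  | cons i s hi ih =>
    rw [Finset.sum_cons, Finset.sum_cons]
    exact (h i (Finset.mem_cons_self _ _)).add
      (ih fun j hj => h j (Finset.mem_cons_of_mem hj))

theorem congr {f : C(unitInterval, V)} {a b : ℝ → V} (hf : IsPrimitive f a)
    (hab : ∀ t ∈ Set.Ioo (0 : ℝ) 1, a t = b t) : IsPrimitive f b := by
  have hae : ∀ᵐ t, t ∈ Set.Ioc (0 : ℝ) 1 → a t = b t := by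
    have hne : ∀ᵐ x : ℝ, x ≠ 1 := by simp [ae_iff, measure_singleton]
    filter_upwards [hne] with t h1 ht
    exact hab t ⟨ht.1, lt_of_le_of_ne ht.2 h1⟩
  refine ⟨hf.1.congr_ae ?_, fun t => ?_⟩
  · rw [Set.uIoc_of_le zero_le_one]
    exact (ae_restrict_iff' measurableSet_Ioc).2 hae
  · rw [hf.2 t]
    congr 1
    refine intervalIntegral.integral_congr_ae ?_
    filter_upwards [hae] with s hs hst
    rw [Set.uIoc_of_le t.2.1] at hst
    exact hs ⟨hst.1, hst.2.trans t.2.2⟩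

theorem map [CompleteSpace V] [CompleteSpace W] (L : V →L[ℝ] W) {f : C(unitInterval, V)} {g : C(unitInterval, W)}
    {a : ℝ → V} (hf : IsPrimitive f a) (hg : ∀ t, g t = L (f t)) :
    IsPrimitive g (fun t => L (a t)) where
  intervalIntegrable := ⟨L.integrable_comp hf.1.1, L.integrable_comp hf.1.2⟩
  eq_add t := by
    have hs : Set.uIcc (0 : ℝ) t ⊆ Set.uIcc 0 1 := Set.uIcc_subset_uIcc Set.left_mem_uIcc
      (by rw [Set.uIcc_of_le zero_le_one]; exact t.2)
    rw [hg, hg, hf.2 t, map_add, L.intervalIntegral_comp_comm (hf.1.mono_set hs)]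

theorem ae_hasDerivAt [CompleteSpace V] {f : C(unitInterval, V)} {a : ℝ → V}
    (hf : IsPrimitive f a) :
    ∀ᵐ t, t ∈ Set.Ioo (0 : ℝ) 1 → HasDerivAt (extend f) (a t) t := by
  filter_upwards [hf.1.ae_hasDerivAt_integral] with t h ht
  rw [Set.uIcc_of_le zero_le_one] at h
  have h1 := (h (Set.Ioo_subset_Icc_self ht) 0 ⟨le_rfl, zero_le_one⟩).const_add (f 0)
  refine h1.congr_of_eventuallyEq ?_
  filter_upwards [Ioo_mem_nhds ht.1 ht.2] with s hs
  rw [extend_of_mem f (Set.Ioo_subset_Icc_self hs), hf.2]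

theorem of_ae_hasDerivAt [CompleteSpace V] {f : C(unitInterval, V)} {a : ℝ → V}
    (hf : AbsolutelyContinuousOnInterval (extend f) 0 1) (ha : IntervalIntegrable a volume 0 1)
    (h : ∀ᵐ t, t ∈ Set.Ioo (0 : ℝ) 1 → HasDerivAt (extend f) (a t) t) : IsPrimitive f a where
  intervalIntegrable := ha
  eq_add t := by
    have h1 := eq_add_integral_of_ae_hasDerivAt hf ha h t.2
    have h0 : extend f 0 = f 0 := extend_coe f 0
    rwa [extend_coe, h0] at h1

/-- The Leibniz rule holds almost everywhere. The product is absolutely continuous because its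
increments are at most `‖f‖ + ‖g‖` times those of the primitive of `‖a‖ + ‖b‖`. -/
theorem mul {R : Type*} [NormedRing R] [NormedAlgebra ℝ R] [CompleteSpace R]
    {f g : C(unitInterval, R)} {a b : ℝ → R} (hf : IsPrimitive f a) (hg : IsPrimitive g b) :
    IsPrimitive (f * g) (fun t => a t * extend g t + extend f t * b t) := by
  refine of_ae_hasDerivAt ?_ ?_ ?_
  · have hn := (hf.1.norm.add hg.1.norm).absolutelyContinuousOnInterval_intervalIntegral
      (c := 0) Set.left_mem_uIcc
    refine absolutelyContinuousOnInterval_of_dist_le (K := ‖f‖ + ‖g‖) hn fun x hx y hy => ?_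
    have key : ∀ {h : C(unitInterval, R)} {c : ℝ → R}, IsPrimitive h c → ∀ x ∈ Set.uIcc (0 : ℝ) 1,
        ∀ y ∈ Set.uIcc (0 : ℝ) 1, ‖extend h x - extend h y‖ ≤ |∫ s in y..x, ‖c s‖| := by
      intro h c hc x hx y hy
      have hi : ∀ x ∈ Set.uIcc (0 : ℝ) 1, IntervalIntegrable c volume 0 x := fun x hx =>
        hc.1.mono_set (Set.uIcc_subset_uIcc Set.left_mem_uIcc hx)
      have hx' := hx
      have hy' := hy
      rw [Set.uIcc_of_le zero_le_one] at hx' hy'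
      rw [extend_of_mem h hx', extend_of_mem h hy', hc.2, hc.2 ⟨y, hy'⟩, add_sub_add_left_eq_sub,
        intervalIntegral.integral_interval_sub_left (hi x hx) (hi y hy)]
      exact intervalIntegral.norm_integral_le_abs_integral_norm
    have hyx : Set.uIcc y x ⊆ Set.uIcc 0 1 := Set.uIcc_subset_uIcc hy hx
    have hfi := hf.1.norm.mono_set hyx
    have hgi := hg.1.norm.mono_set hyx
    have h0i : ∀ x ∈ Set.uIcc (0 : ℝ) 1,
        IntervalIntegrable (fun s => ‖a s‖ + ‖b s‖) volume 0 x := fun x hx =>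
      (hf.1.norm.add hg.1.norm).mono_set (Set.uIcc_subset_uIcc Set.left_mem_uIcc hx)
    rw [dist_eq_norm, Real.dist_eq,
      intervalIntegral.integral_interval_sub_left (h0i x hx) (h0i y hy),
      intervalIntegral.integral_add hfi hgi]
    have e : extend (f * g) x - extend (f * g) y
        = (extend f x - extend f y) * extend g x + extend f y * (extend g x - extend g y) := by
      simp only [extend_apply, ContinuousMap.mul_apply]
      noncomm_ring
    -- Both integrals have the same sign, fixed by the order of `x` and `y`.
    have hsum : |(∫ s in y..x, ‖a s‖) + ∫ s in y..x, ‖b s‖|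
        = |∫ s in y..x, ‖a s‖| + |∫ s in y..x, ‖b s‖| := by
      rcases le_total y x with hle | hle
      · have h1 := intervalIntegral.integral_nonneg (f := fun s => ‖a s‖) (μ := volume) hle
          fun _ _ => norm_nonneg _
        have h2 := intervalIntegral.integral_nonneg (f := fun s => ‖b s‖) (μ := volume) hle
          fun _ _ => norm_nonneg _
        rw [abs_of_nonneg h1, abs_of_nonneg h2, abs_of_nonneg (add_nonneg h1 h2)]
      · have h1 := intervalIntegral.integral_nonneg (f := fun s => ‖a s‖) (μ := volume) hle
          fun _ _ => norm_nonneg _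
        have h2 := intervalIntegral.integral_nonneg (f := fun s => ‖b s‖) (μ := volume) hle
          fun _ _ => norm_nonneg _
        rw [intervalIntegral.integral_symm x y (f := fun s => ‖a s‖),
          intervalIntegral.integral_symm x y (f := fun s => ‖b s‖), ← neg_add, abs_neg, abs_neg,
          abs_neg, abs_of_nonneg h1, abs_of_nonneg h2, abs_of_nonneg (add_nonneg h1 h2)]
    rw [e, hsum]
    have n1 : ‖extend g x‖ ≤ ‖g‖ := g.norm_coe_le_norm _
    have n2 : ‖extend f y‖ ≤ ‖f‖ := f.norm_coe_le_norm _
    calc _ ≤ |∫ s in y..x, ‖a s‖| * ‖g‖ + ‖f‖ * |∫ s in y..x, ‖b s‖| := by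
          refine (norm_add_le _ _).trans (add_le_add ?_ ?_)
          · refine (norm_mul_le _ _).trans ?_
            gcongr
            exact key hf x hx y hy
          · refine (norm_mul_le _ _).trans ?_
            gcongr
            exact key hg x hx y hy
      _ ≤ _ := by
          nlinarith [abs_nonneg (∫ s in y..x, ‖a s‖), abs_nonneg (∫ s in y..x, ‖b s‖),
            norm_nonneg f, norm_nonneg g]
  · exact (hf.1.mul_continuousOn (extend g).continuous.continuousOn).add
      (hg.1.continuousOn_mul (extend f).continuous.continuousOn)
  · filter_upwards [hf.ae_hasDerivAt, hg.ae_hasDerivAt] with t h1 h2 ht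
    exact (h1 ht).mul (h2 ht)

end IsPrimitive

/-! ### Velocities -/

section Velocity

variable {q : ℝ≥0∞} [hq : Fact (1 ≤ q)]

theorem isProbabilityMeasure_Ioo : IsProbabilityMeasure (volume.restrict (Set.Ioo (0 : ℝ) 1)) :=
  ⟨by simp⟩

theorem integrable_velocity (σ : Curve q) :
    Integrable (velocity σ) (volume.restrict (Set.Ioo (0 : ℝ) 1)) :=
  have := isProbabilityMeasure_Ioo
  memLp_one_iff_integrable.1 ((memLp_velocity σ).mono_exponent hq.out)

theorem intervalIntegrable_velocity (σ : Curve q) : IntervalIntegrable (velocity σ) volume 0 1 := by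
  rw [intervalIntegrable_iff_integrableOn_Ioo_of_le zero_le_one]
  exact integrable_velocity σ

theorem intervalIntegrable_velocity_apply (σ : Curve q) (μ : Fin 4) :
    IntervalIntegrable (fun t => velocity σ t μ) volume 0 1 := by
  have h := intervalIntegrable_velocity σ
  exact ⟨(EuclideanSpace.proj (𝕜 := ℝ) μ).integrable_comp h.1,
    (EuclideanSpace.proj (𝕜 := ℝ) μ).integrable_comp h.2⟩

/-- On a probability space the `L_1` norm is at most the `L_q` norm. Every later estimate needs only
the `L_1` norm of the velocity, which makes the argument uniform in `q`. -/
theorem integral_norm_velocity_le (σ : Curve q) :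
    ∫ t in (0 : ℝ)..1, ‖velocity σ t‖ ≤ ‖σ‖ := by
  have := isProbabilityMeasure_Ioo
  have h1 : ‖σ‖ = (eLpNorm (velocity σ) q (volume.restrict (Set.Ioo (0 : ℝ) 1))).toReal :=
    Lp.norm_toLp _ (memLp_velocity σ)
  rw [h1, intervalIntegral.integral_of_le zero_le_one, integral_Ioc_eq_integral_Ioo,
    integral_norm_eq_lintegral_enorm (integrable_velocity σ).1, ← eLpNorm_one_eq_lintegral_enorm]
  exact ENNReal.toReal_mono (memLp_velocity σ).2.ne
    (eLpNorm_le_eLpNorm_of_exponent_le hq.out (integrable_velocity σ).1)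

theorem velocity_add_ae (σ τ : Curve q) : ∀ᵐ t, t ∈ Set.Ioo (0 : ℝ) 1 →
    velocity (σ + τ) t = velocity σ t + velocity τ t :=
  (ae_restrict_iff' measurableSet_Ioo).1 (deriv_ext_add σ.2.1 τ.2.1)

theorem velocity_smul_ae (c : ℝ) (σ : Curve q) : ∀ᵐ t, t ∈ Set.Ioo (0 : ℝ) 1 →
    velocity (c • σ) t = c • velocity σ t :=
  (ae_restrict_iff' measurableSet_Ioo).1 (deriv_ext_smul c σ.2.1)

theorem hasDerivAt_ext_ae (σ : Curve q) : ∀ᵐ t, t ∈ Set.Ioo (0 : ℝ) 1 →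
    HasDerivAt (ext σ) (velocity σ t) t := by
  filter_upwards [(ae_restrict_iff' measurableSet_Ioo).1 (ae_differentiableAt_ext σ.2.1)]
    with t h ht
  exact (h ht).hasDerivAt

theorem continuous_curve (σ : Curve q) : Continuous (σ : unitInterval → Spacetime) := by
  have h := σ.2.1.continuousOn
  rw [Set.uIcc_of_le zero_le_one] at h
  rw [continuousOn_iff_continuous_domRestrict] at h
  refine h.congr fun t => ?_
  simp [ext]

/-- A Sobolev curve as a continuous curve. -/
def toContinuousMap (σ : Curve q) : C(unitInterval, Spacetime) := ⟨σ, continuous_curve σ⟩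

theorem isPrimitive_toContinuousMap (σ : Curve q) :
    IsPrimitive (toContinuousMap σ) (velocity σ) :=
  .of_ae_hasDerivAt σ.2.1 (intervalIntegrable_velocity σ) (hasDerivAt_ext_ae σ)

theorem toContinuousMap_zero_apply (σ : Curve q) : toContinuousMap σ 0 = 0 := σ.2.2.1

theorem intervalIntegral_congr_Ioo {V : Type*} [NormedAddCommGroup V] [NormedSpace ℝ V]
    {f g : ℝ → V} (h : ∀ᵐ t, t ∈ Set.Ioo (0 : ℝ) 1 → f t = g t) {t : ℝ}
    (ht : t ∈ Set.Icc (0 : ℝ) 1) :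
    ∫ s in (0 : ℝ)..t, f s = ∫ s in (0 : ℝ)..t, g s := by
  refine intervalIntegral.integral_congr_ae ?_
  have hne : ∀ᵐ x : ℝ, x ≠ 1 := by simp [ae_iff, measure_singleton]
  filter_upwards [h, hne] with s hs h1 hst
  rw [Set.uIoc_of_le ht.1] at hst
  exact hs ⟨hst.1, lt_of_le_of_ne (hst.2.trans ht.2) h1⟩

end Velocity

/-! ### Integration along a curve -/

section Integration

variable {q : ℝ≥0∞} [hq : Fact (1 ≤ q)] {V : Type*} [NormedAddCommGroup V] [NormedSpace ℝ V]

theorem intervalIntegrable_velocity_smul (σ : Curve q) (μ : Fin 4) (g : C(ℝ, V)) :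
    IntervalIntegrable (fun t => velocity σ t μ • g t) volume 0 1 :=
  (intervalIntegrable_velocity_apply σ μ).smul_continuousOn g.continuous.continuousOn

/-- The continuous function `t ↦ ∫_0^t σ̇^μ(s) g(s) ds`. -/
def integralAlong (μ : Fin 4) (σ : Curve q) (g : C(unitInterval, V)) : C(unitInterval, V) where
  toFun t := ∫ s in (0 : ℝ)..t, velocity σ s μ • extend g s
  continuous_toFun := by
    have h := (absolutelyContinuousOnInterval_primitive
      (intervalIntegrable_velocity_smul σ μ (extend g))).continuousOn
    rw [Set.uIcc_of_le zero_le_one, continuousOn_iff_continuous_domRestrict] at h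
    exact h

theorem integralAlong_apply (μ : Fin 4) (σ : Curve q) (g : C(unitInterval, V)) (t : unitInterval) :
    integralAlong μ σ g t = ∫ s in (0 : ℝ)..t, velocity σ s μ • extend g s := rfl

theorem isPrimitive_integralAlong (μ : Fin 4) (σ : Curve q) (g : C(unitInterval, V)) :
    IsPrimitive (integralAlong μ σ g) (fun s => velocity σ s μ • extend g s) where
  intervalIntegrable := intervalIntegrable_velocity_smul σ μ (extend g)
  eq_add t := by simp [integralAlong_apply]

theorem integralAlong_apply_zero (μ : Fin 4) (σ : Curve q) (g : C(unitInterval, V)) :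
    integralAlong μ σ g 0 = 0 := by
  simp [integralAlong_apply]

theorem norm_integral_velocity_smul_le (μ : Fin 4) (σ : Curve q) (g : C(unitInterval, V))
    (t : unitInterval) :
    ‖∫ s in (0 : ℝ)..t, velocity σ s μ • extend g s‖
      ≤ ‖g‖ * ∫ s in (0 : ℝ)..t, ‖velocity σ s‖ := by
  have hs : Set.uIcc (0 : ℝ) t ⊆ Set.uIcc 0 1 := Set.uIcc_subset_uIcc Set.left_mem_uIcc
      (by rw [Set.uIcc_of_le zero_le_one]; exact t.2)
  rw [← intervalIntegral.integral_const_mul]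
  refine intervalIntegral.norm_integral_le_of_norm_le t.2.1 (.of_forall fun s _ => ?_)
    (((intervalIntegrable_velocity σ).norm.const_mul _).mono_set hs)
  rw [norm_smul, mul_comm]
  gcongr
  · exact g.norm_coe_le_norm _
  · exact PiLp.norm_apply_le _ _

theorem norm_integralAlong_le (μ : Fin 4) (σ : Curve q) (g : C(unitInterval, V)) :
    ‖integralAlong μ σ g‖ ≤ ‖σ‖ * ‖g‖ := by
  refine (ContinuousMap.norm_le _ (by positivity)).2 fun t => ?_
  refine (norm_integral_velocity_smul_le μ σ g t).trans ?_
  rw [mul_comm]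
  gcongr
  refine le_trans ?_ (integral_norm_velocity_le σ)
  exact intervalIntegral.integral_mono_interval le_rfl t.2.1 t.2.2
    (.of_forall fun _ => norm_nonneg _) (intervalIntegrable_velocity σ).norm

/-- `integralAlong` as a bounded bilinear map. -/
def J (μ : Fin 4) : Curve q →L[ℝ] C(unitInterval, V) →L[ℝ] C(unitInterval, V) :=
  LinearMap.mkContinuous₂
    (LinearMap.mk₂ ℝ (integralAlong μ)
      (fun σ τ g => by
        ext t
        have hs : Set.uIcc (0 : ℝ) t ⊆ Set.uIcc 0 1 := Set.uIcc_subset_uIcc Set.left_mem_uIcc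
          (by rw [Set.uIcc_of_le zero_le_one]; exact t.2)
        rw [ContinuousMap.add_apply]
        simp only [integralAlong_apply]
        rw [← intervalIntegral.integral_add
          ((intervalIntegrable_velocity_smul σ μ _).mono_set hs)
          ((intervalIntegrable_velocity_smul τ μ _).mono_set hs)]
        refine intervalIntegral_congr_Ioo ?_ t.2
        filter_upwards [velocity_add_ae σ τ] with s hs hst
        rw [hs hst, PiLp.add_apply, add_smul])
      (fun c σ g => by
        ext t
        rw [ContinuousMap.smul_apply]
        simp only [integralAlong_apply]
        rw [← intervalIntegral.integral_smul]
        refine intervalIntegral_congr_Ioo ?_ t.2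
        filter_upwards [velocity_smul_ae c σ] with s hs hst
        rw [hs hst, PiLp.smul_apply, smul_assoc])
      (fun σ g h => by
        ext t
        have hs : Set.uIcc (0 : ℝ) t ⊆ Set.uIcc 0 1 := Set.uIcc_subset_uIcc Set.left_mem_uIcc
          (by rw [Set.uIcc_of_le zero_le_one]; exact t.2)
        rw [ContinuousMap.add_apply]
        simp only [integralAlong_apply]
        rw [← intervalIntegral.integral_add
          ((intervalIntegrable_velocity_smul σ μ _).mono_set hs)
          ((intervalIntegrable_velocity_smul σ μ _).mono_set hs)]
        simp only [extend_apply, ContinuousMap.add_apply, smul_add])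
      (fun c σ g => by
        ext t
        rw [ContinuousMap.smul_apply]
        simp only [integralAlong_apply]
        rw [← intervalIntegral.integral_smul]
        simp only [extend_apply, ContinuousMap.smul_apply, smul_comm c]))
    1 (fun σ g => by simpa using norm_integralAlong_le μ σ g)

theorem J_apply_apply (μ : Fin 4) (σ : Curve q) (g : C(unitInterval, V)) (t : unitInterval) :
    J μ σ g t = ∫ s in (0 : ℝ)..t, velocity σ s μ • extend g s := rfl

theorem isPrimitive_J (μ : Fin 4) (σ : Curve q) (g : C(unitInterval, V)) :
    IsPrimitive (J μ σ g) (fun s => velocity σ s μ • extend g s) :=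
  isPrimitive_integralAlong μ σ g

theorem J_apply_zero (μ : Fin 4) (σ : Curve q) (g : C(unitInterval, V)) : J μ σ g 0 = 0 :=
  integralAlong_apply_zero μ σ g

end Integration

/-! ### Composition of a smooth function with a curve -/

section Pull

variable {q : ℝ≥0∞} [hq : Fact (1 ≤ q)] {R : Type} [NormedRing R] [NormedAlgebra ℝ R]

/-- The embedding into continuous curves has constant `1` because curves start at `0`. -/
theorem norm_curve_apply_le (σ : Curve q) (t : unitInterval) : ‖σ t‖ ≤ ‖σ‖ := by
  have h := (isPrimitive_toContinuousMap σ).eq_add t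
  rw [toContinuousMap_zero_apply, zero_add] at h
  change ‖toContinuousMap σ t‖ ≤ _
  rw [h]
  refine (intervalIntegral.norm_integral_le_integral_norm t.2.1).trans ?_
  refine le_trans ?_ (integral_norm_velocity_le σ)
  exact intervalIntegral.integral_mono_interval le_rfl t.2.1 t.2.2
    (.of_forall fun _ => norm_nonneg _) (intervalIntegrable_velocity σ).norm

/-- The derivative `∂_μ f`. -/
def pd (μ : Fin 4) (f : Spacetime → R) (x : Spacetime) : R := fderiv ℝ f x (p μ)

theorem contDiff_pd {f : Spacetime → R} (hf : ContDiff ℝ ∞ f) (μ : Fin 4) :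
    ContDiff ℝ ∞ (pd μ f) :=
  (hf.fderiv_right (m := ∞) (by simp)).clm_apply contDiff_const

theorem fderiv_eq_sum_pd (f : Spacetime → R) (x v : Spacetime) :
    fderiv ℝ f x v = ∑ μ, v μ • pd μ f x := by
  have hv : v = ∑ μ, v μ • p μ := by
    ext i
    simp [p, Pi.single_apply]
  conv_lhs => rw [hv]
  simp [pd, map_sum]

/-- The composition `f ∘ σ` as a continuous function on `[0,1]`. -/
def pull (f : Spacetime → R) (σ : Curve q) : C(unitInterval, R) :=
  ContinuousMap.mkD (fun t => f (toContinuousMap σ t)) 0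

theorem pull_apply {f : Spacetime → R} (hf : Continuous f) (σ : Curve q) (t : unitInterval) :
    pull f σ t = f (σ t) := by
  have h : Continuous fun t => f (toContinuousMap σ t) := hf.comp (toContinuousMap σ).continuous
  rw [pull, ContinuousMap.mkD_of_continuous h]
  rfl

theorem extend_pull {f : Spacetime → R} (hf : Continuous f) (σ : Curve q) (t : ℝ) :
    extend (pull f σ) t = f (ext σ t) :=
  pull_apply hf σ _

/-- The coordinate `v^μ` of a curve `v`, as a function with values in the scalars of `R`. -/
def coord (μ : Fin 4) : Curve q →L[ℝ] C(unitInterval, R) := (J μ).flip 1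

theorem isPrimitive_coord (μ : Fin 4) (v : Curve q) :
    IsPrimitive (coord (R := R) μ v) (fun s => velocity v s μ • 1) :=
  isPrimitive_J μ v 1

theorem coord_apply_zero (μ : Fin 4) (v : Curve q) : coord (R := R) μ v 0 = 0 :=
  J_apply_zero μ v 1

variable [CompleteSpace R]

theorem coord_apply (μ : Fin 4) (v : Curve q) (t : unitInterval) :
    coord (R := R) μ v t = v t μ • (1 : R) := by
  let L : Spacetime →L[ℝ] R := (EuclideanSpace.proj (𝕜 := ℝ) μ).smulRight 1
  have h := (isPrimitive_toContinuousMap v).map L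
    (g := (L : C(Spacetime, R)).comp (toContinuousMap v)) fun _ => rfl
  have h1 := h.eq_add t
  have h2 := (isPrimitive_coord (R := R) μ v).eq_add t
  rw [coord_apply_zero, zero_add] at h2
  rw [h2]
  simp only [ContinuousMap.comp_apply, toContinuousMap_zero_apply] at h1
  simpa [L, toContinuousMap] using h1.symm

theorem extend_coord (μ : Fin 4) (v : Curve q) (t : ℝ) :
    extend (coord (R := R) μ v) t = ext v t μ • (1 : R) :=
  coord_apply μ v _

/-- The derivative of `pull f`. -/
def pullDeriv (f : Spacetime → R) (σ : Curve q) : Curve q →L[ℝ] C(unitInterval, R) :=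
  ∑ μ, (ContinuousLinearMap.mul ℝ C(unitInterval, R) (pull (pd μ f) σ)).comp (coord μ)

theorem pullDeriv_apply (f : Spacetime → R) (σ v : Curve q) :
    pullDeriv f σ v = ∑ μ, pull (pd μ f) σ * coord μ v := by
  simp [pullDeriv]

theorem pullDeriv_apply_apply {f : Spacetime → R} (hf : ContDiff ℝ ∞ f) (σ v : Curve q)
    (t : unitInterval) : pullDeriv f σ v t = fderiv ℝ f (σ t) (v t) := by
  rw [pullDeriv_apply, fderiv_eq_sum_pd, ContinuousMap.sum_apply]
  refine Finset.sum_congr rfl fun μ _ => ?_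
  rw [ContinuousMap.mul_apply, pull_apply (contDiff_pd hf μ).continuous, coord_apply,
    mul_smul_comm, mul_one]

/-- The mean value inequality is applied around each `σ(t)`. Uniform continuity of `Df` on a compact
ball containing all these neighbourhoods makes the error uniform in `t`. -/
theorem hasFDerivAt_pull {f : Spacetime → R} (hf : ContDiff ℝ ∞ f) (σ : Curve q) :
    HasFDerivAt (pull f) (pullDeriv f σ) σ := by
  refine .of_isLittleO (Asymptotics.IsLittleO.of_bound fun c hc => ?_)
  -- The curve stays within radius `‖σ‖`; the extra `1` leaves room for perturbations of norm less
  -- than `1`.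
  have hK : IsCompact (Metric.closedBall (0 : Spacetime) (‖σ‖ + 1)) := isCompact_closedBall _ _
  have hd : Continuous (fderiv ℝ f) := hf.continuous_fderiv (by simp)
  obtain ⟨δ, hδ, H⟩ := Metric.uniformContinuousOn_iff_le.1
    (hK.uniformContinuousOn_of_continuous hd.continuousOn) c hc
  filter_upwards [Metric.ball_mem_nhds σ (lt_min hδ one_pos)] with τ hτ
  rw [Metric.mem_ball, dist_eq_norm] at hτ
  refine (ContinuousMap.norm_le _ (by positivity)).2 fun t => ?_
  rw [ContinuousMap.sub_apply, ContinuousMap.sub_apply, pull_apply hf.continuous,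
    pull_apply hf.continuous, pullDeriv_apply_apply hf]
  have hsub : ∀ t, (τ - σ) t = τ t - σ t := fun t => rfl
  have ht : ‖τ t - σ t‖ ≤ ‖τ - σ‖ := norm_curve_apply_le (τ - σ) t
  have key := (convex_ball (σ t) (min δ 1)).norm_image_sub_le_of_norm_hasFDerivWithin_le'
    (f := f) (f' := fderiv ℝ f) (φ := fderiv ℝ f (σ t)) (C := c) (x := σ t) (y := τ t)
    (fun x _ => ((hf.differentiable (by simp)) x).hasFDerivAt.hasFDerivWithinAt)
    (fun x hx => by
      rw [Metric.mem_ball, dist_eq_norm] at hx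
      rw [← dist_eq_norm]
      refine H x ?_ (σ t) ?_ ?_
      · rw [mem_closedBall_zero_iff]
        have h1 := norm_curve_apply_le σ t
        have h2 := norm_add_le (x - σ t) (σ t)
        rw [sub_add_cancel] at h2
        linarith [hx.trans_le (min_le_right _ _)]
      · rw [mem_closedBall_zero_iff]
        linarith [norm_curve_apply_le σ t]
      · rw [dist_eq_norm]
        exact (hx.trans_le (min_le_left _ _)).le)
    (Metric.mem_ball_self (lt_min hδ one_pos))
    (by rw [Metric.mem_ball, dist_eq_norm]; exact ht.trans_lt hτ)
  rw [hsub]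
  exact key.trans (by gcongr)

/-- The derivative is assembled from the maps `pull (pd μ f)` by fixed bounded linear operations,
and `pd μ f` is again smooth, so induction on the order applies to all smooth `f` at once. -/
theorem contDiff_pull {f : Spacetime → R} (hf : ContDiff ℝ ∞ f) (n : ℕ) :
    ContDiff ℝ n (pull (q := q) f) := by
  induction n generalizing f with
  | zero =>
    exact contDiff_zero.2 (continuous_iff_continuousAt.2 fun σ => (hasFDerivAt_pull hf σ).continuousAt)
  | succ n ih =>
    rw [Nat.cast_succ, contDiff_succ_iff_hasFDerivAt]
    refine ⟨pullDeriv f, ?_, hasFDerivAt_pull hf⟩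
    unfold pullDeriv
    refine ContDiff.sum fun μ _ => ContDiff.clm_comp ?_ contDiff_const
    have h : ContDiff ℝ n fun g : C(unitInterval, R) =>
        ContinuousLinearMap.mul ℝ C(unitInterval, R) g := ContinuousLinearMap.contDiff _
    exact h.comp (ih (contDiff_pd hf μ))

/-- The chain rule `f(σ(t)) = f(σ(0)) + ∫_0^t ∂_μ f(σ(s)) σ̇^μ(s) ds`. -/
theorem isPrimitive_pull {f : Spacetime → R} (hf : ContDiff ℝ ∞ f) (σ : Curve q) :
    IsPrimitive (pull f σ) (fun s => ∑ μ, velocity σ s μ • extend (pull (pd μ f) σ) s) := by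
  have hx : ⇑(extend (pull f σ)) = fun t => f (ext σ t) :=
    funext fun t => extend_pull hf.continuous σ t
  refine .of_ae_hasDerivAt ?_ ?_ ?_
  -- On a closed ball containing the curve `f` is Lipschitz, so `f ∘ σ` inherits absolute continuity
  -- from `σ`.
  · obtain ⟨K, hK⟩ := (hf.of_le (m := 1) (by simp)).contDiffOn.exists_lipschitzOnWith
      (s := Metric.closedBall (0 : Spacetime) ‖σ‖) (by simp) (convex_closedBall _ _)
      (isCompact_closedBall _ _)
    rw [hx]
    have hmem : ∀ t, ext σ t ∈ Metric.closedBall (0 : Spacetime) ‖σ‖ := fun t => by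
      rw [mem_closedBall_zero_iff]
      exact norm_curve_apply_le σ _
    exact absolutelyContinuousOnInterval_of_dist_le σ.2.1 fun x _ y _ =>
      hK.dist_le_mul _ (hmem x) _ (hmem y)
  · have h := IntervalIntegrable.sum (f := fun μ s => velocity σ s μ • extend (pull (pd μ f) σ) s)
      Finset.univ fun μ _ => intervalIntegrable_velocity_smul σ μ (extend (pull (pd μ f) σ))
    simpa [Finset.sum_fn] using h
  · filter_upwards [hasDerivAt_ext_ae σ] with t h ht
    rw [hx]
    have h1 := ((hf.differentiable (by simp)) (ext σ t)).hasFDerivAt.comp_hasDerivAt t (h ht)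
    rw [fderiv_eq_sum_pd] at h1
    simpa only [extend_pull (contDiff_pd hf _).continuous, Function.comp_def] using h1

end Pull

/-! ### Linear Volterra equations along a curve -/

section ExtendAlgebra

variable {R : Type*} [NormedRing R]

theorem extend_mul (f g : C(unitInterval, R)) (t : ℝ) :
    extend (f * g) t = extend f t * extend g t := rfl

theorem extend_add (f g : C(unitInterval, R)) (t : ℝ) :
    extend (f + g) t = extend f t + extend g t := rfl

theorem extend_sub (f g : C(unitInterval, R)) (t : ℝ) :
    extend (f - g) t = extend f t - extend g t := rfl

theorem extend_neg (f : C(unitInterval, R)) (t : ℝ) : extend (-f) t = -extend f t := rfl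

theorem extend_sum {ι : Type*} (s : Finset ι) (f : ι → C(unitInterval, R)) (t : ℝ) :
    extend (∑ i ∈ s, f i) t = ∑ i ∈ s, extend (f i) t := by
  rw [extend_apply, ContinuousMap.sum_apply]
  rfl

end ExtendAlgebra

/-- This evaluates `∫ Hⁿ H'`, the source of the factorials in the iterated Volterra estimate. -/
theorem IsPrimitive.pow_succ {f : C(unitInterval, ℝ)} {a : ℝ → ℝ} (hf : IsPrimitive f a) (n : ℕ) :
    IsPrimitive (f ^ (n + 1)) (fun t => (n + 1) * extend f t ^ n * a t) := by
  induction n with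
  | zero => simpa using hf
  | succ n ih =>
    rw [_root_.pow_succ]
    refine (ih.mul hf).congr fun t _ => ?_
    have : extend (f ^ (n + 1)) t = extend f t ^ (n + 1) := rfl
    rw [this]
    push_cast
    ring

section Operators

variable {E F : Type*} [NormedAddCommGroup E] [NormedSpace ℝ E] [CompleteSpace E]
  [NormedAddCommGroup F] [NormedSpace ℝ F]

/-- Some power of `-T` has norm below `1`, so `1 - (-T)ⁿ` is invertible. It factors as `1 + T` times
a geometric sum commuting with it, and a commuting factor of a unit is a unit. -/
theorem isUnit_one_add_of_norm_pow_le {T : E →L[ℝ] E} {c : ℝ}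
    (h : ∀ n : ℕ, ‖T ^ n‖ ≤ c ^ n / n.factorial) : IsUnit (1 + T) := by
  have hlim := FloorSemiring.tendsto_pow_div_factorial_atTop c
  obtain ⟨n, hn⟩ := (hlim.eventually (gt_mem_nhds one_pos)).exists
  have h1 : ‖(-T) ^ n‖ < 1 := by
    rw [neg_pow]
    rcases neg_one_pow_eq_or (E →L[ℝ] E) n with h' | h' <;>
    · rw [h']
      simpa using (h n).trans_lt hn
  have h2 : IsUnit (1 - (-T) ^ n) := isUnit_one_sub_of_norm_lt_one h1
  rw [← mul_neg_geom_sum] at h2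
  have hc : Commute (1 - -T) (∑ i ∈ Finset.range n, (-T) ^ i) :=
    Commute.sum_right _ _ _ fun i _ =>
      ((Commute.one_left _).sub_left (Commute.refl _)).pow_right i
  have h3 := (hc.isUnit_mul_iff.1 h2).1
  rwa [sub_neg_eq_add] at h3

theorem contDiff_inverse_apply {T : F → E →L[ℝ] E} {n : ℕ∞ω} (hT : ContDiff ℝ n T)
    (hu : ∀ x, IsUnit (T x)) (e : E) : ContDiff ℝ n fun x => Ring.inverse (T x) e := by
  have h : ContDiff ℝ n fun x => Ring.inverse (T x) := by
    refine contDiff_iff_contDiffAt.2 fun x => ?_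
    obtain ⟨u, hu⟩ := hu x
    refine ContDiffAt.comp x (g := Ring.inverse) ?_ hT.contDiffAt
    rw [← hu]
    exact contDiffAt_ringInverse ℝ u
  exact h.clm_apply contDiff_const

end Operators

section Volterra

variable {q : ℝ≥0∞} [hq : Fact (1 ≤ q)] {R : Type} [NormedRing R] [NormedAlgebra ℝ R]

/-- The operator `g ↦ ∫_0^t B_ν(s) g(s) σ̇^ν(s) ds`. -/
def volterra (B : Fin 4 → C(unitInterval, R)) (σ : Curve q) :
    C(unitInterval, R) →L[ℝ] C(unitInterval, R) :=
  ∑ ν, (J ν σ).comp (ContinuousLinearMap.mul ℝ C(unitInterval, R) (B ν))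

theorem volterra_apply (B : Fin 4 → C(unitInterval, R)) (σ : Curve q) (g : C(unitInterval, R)) :
    volterra B σ g = ∑ ν, J ν σ (B ν * g) := by
  simp [volterra]

theorem isPrimitive_volterra (B : Fin 4 → C(unitInterval, R)) (σ : Curve q)
    (g : C(unitInterval, R)) :
    IsPrimitive (volterra B σ g) (fun s => ∑ ν, velocity σ s ν • (extend (B ν) s * extend g s)) := by
  rw [volterra_apply]
  refine (IsPrimitive.sum Finset.univ fun ν _ => isPrimitive_J ν σ (B ν * g)).congr fun t _ => ?_
  rw [Finset.sum_apply]
  rfl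

theorem volterra_apply_zero (B : Fin 4 → C(unitInterval, R)) (σ : Curve q)
    (g : C(unitInterval, R)) : volterra B σ g 0 = 0 := by
  rw [volterra_apply, ContinuousMap.sum_apply]
  exact Finset.sum_eq_zero fun ν _ => J_apply_zero ν σ _

theorem norm_volterra_apply_le (B : Fin 4 → C(unitInterval, R)) (σ : Curve q)
    (g : C(unitInterval, R)) (h : C(ℝ, ℝ)) (hg : ∀ s ∈ Set.Icc (0 : ℝ) 1, ‖extend g s‖ ≤ h s)
    (t : unitInterval) :
    ‖volterra B σ g t‖ ≤ ∫ s in (0 : ℝ)..t, (∑ ν, ‖B ν‖) * ‖velocity σ s‖ * h s := by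
  have hs : Set.uIcc (0 : ℝ) t ⊆ Set.uIcc 0 1 := Set.uIcc_subset_uIcc Set.left_mem_uIcc
      (by rw [Set.uIcc_of_le zero_le_one]; exact t.2)
  rw [(isPrimitive_volterra B σ g).2 t, volterra_apply_zero, zero_add]
  refine intervalIntegral.norm_integral_le_of_norm_le t.2.1 (.of_forall fun s hst => ?_)
    ((((intervalIntegrable_velocity σ).norm.const_mul _).mul_continuousOn
      h.continuous.continuousOn).mono_set hs)
  have h1 := hg s ⟨hst.1.le, hst.2.trans t.2.2⟩
  have h0 : 0 ≤ h s := (norm_nonneg _).trans h1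
  refine (norm_sum_le _ _).trans ?_
  rw [mul_assoc, Finset.sum_mul]
  refine Finset.sum_le_sum fun ν _ => ?_
  rw [norm_smul]
  calc _ ≤ ‖velocity σ s‖ * (‖B ν‖ * h s) := by
        gcongr
        · exact PiLp.norm_apply_le _ _
        · refine (norm_mul_le _ _).trans ?_
          gcongr
          exact (B ν).norm_coe_le_norm _
    _ = _ := by ring

/-- With `H(t) = (∑ ‖B_ν‖) ∫_0^t ‖σ̇‖`, each application of the operator integrates against `dH`, so
the `n`-th iterate at time `t` is bounded by `H(t)ⁿ/n!`. -/
theorem norm_volterra_pow_le (B : Fin 4 → C(unitInterval, R)) (σ : Curve q) (n : ℕ) :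
    ‖volterra B σ ^ n‖ ≤ ((∑ ν, ‖B ν‖) * ‖σ‖) ^ n / n.factorial := by
  have hv : IntervalIntegrable (fun s => (∑ ν, ‖B ν‖) * ‖velocity σ s‖) volume 0 1 :=
    (intervalIntegrable_velocity σ).norm.const_mul _
  have hcont : Continuous fun t : unitInterval =>
      ∫ s in (0 : ℝ)..t, (∑ ν, ‖B ν‖) * ‖velocity σ s‖ := by
    have h := (absolutelyContinuousOnInterval_primitive hv).continuousOn
    rw [Set.uIcc_of_le zero_le_one, continuousOn_iff_continuous_domRestrict] at h
    exact h
  set H : C(unitInterval, ℝ) := ⟨_, hcont⟩ with hH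
  have hHap : ∀ t : unitInterval, H t = ∫ s in (0 : ℝ)..t, (∑ ν, ‖B ν‖) * ‖velocity σ s‖ :=
    fun _ => rfl
  have hprim : IsPrimitive H (fun s => (∑ ν, ‖B ν‖) * ‖velocity σ s‖) :=
    ⟨hv, fun t => by rw [hHap, hHap]; simp⟩
  have hB : 0 ≤ ∑ ν, ‖B ν‖ := Finset.sum_nonneg fun _ _ => norm_nonneg _
  have hH0 : H 0 = 0 := by rw [hHap]; simp
  have hnn : ∀ t, 0 ≤ H t := fun t => by
    rw [hHap]
    exact intervalIntegral.integral_nonneg t.2.1 fun s _ => by positivity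
  have hle : ∀ t, H t ≤ (∑ ν, ‖B ν‖) * ‖σ‖ := fun t => by
    rw [hHap, intervalIntegral.integral_const_mul]
    gcongr
    refine le_trans ?_ (integral_norm_velocity_le σ)
    exact intervalIntegral.integral_mono_interval le_rfl t.2.1 t.2.2
      (.of_forall fun _ => norm_nonneg _) (intervalIntegrable_velocity σ).norm
  have key : ∀ (n : ℕ) (g : C(unitInterval, R)) (t : unitInterval),
      ‖(volterra B σ ^ n) g t‖ ≤ H t ^ n / n.factorial * ‖g‖ := by
    intro n
    induction n with
    | zero => intro g t; simpa using g.norm_coe_le_norm t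
    | succ n ih =>
      intro g t
      have h1 : (volterra B σ ^ (n + 1)) g = volterra B σ ((volterra B σ ^ n) g) := by
        rw [_root_.pow_succ']
        rfl
      rw [h1]
      refine (norm_volterra_apply_le B σ _
        ⟨fun s => extend H s ^ n / n.factorial * ‖g‖, by fun_prop⟩ (fun s hs => ?_) t).trans ?_
      · exact ih g _
      · have h2 := (hprim.pow_succ n).eq_add t
        have h3 : (H ^ (n + 1)) t = H t ^ (n + 1) := rfl
        have h4 : (H ^ (n + 1)) 0 = 0 := by
          change H 0 ^ (n + 1) = 0
          rw [hH0, zero_pow (Nat.succ_ne_zero n)]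
        rw [h3, h4, zero_add] at h2
        rw [h2, Nat.factorial_succ, div_mul_eq_mul_div, ← intervalIntegral.integral_mul_const,
          ← intervalIntegral.integral_div]
        refine le_of_eq (intervalIntegral.integral_congr fun s _ => ?_)
        have : (n.factorial : ℝ) ≠ 0 := by positivity
        simp only [ContinuousMap.coe_mk]
        push_cast
        field_simp
  refine ContinuousLinearMap.opNorm_le_bound _ (by positivity) fun g => ?_
  refine (ContinuousMap.norm_le _ (by positivity)).2 fun t => (key n g t).trans ?_
  gcongr
  · exact hnn t
  · exact hle t

variable [CompleteSpace R]

theorem isUnit_one_add_volterra (B : Fin 4 → C(unitInterval, R)) (σ : Curve q) :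
    IsUnit (1 + volterra B σ) :=
  isUnit_one_add_of_norm_pow_le (norm_volterra_pow_le B σ)

/-- Uniqueness for the inhomogeneous linear equation; it identifies the derivative of the transport,
the rescaled transport and any given solution of the transport system. -/
theorem eq_of_add_volterra_eq {B : Fin 4 → C(unitInterval, R)} {σ : Curve q}
    {f g : C(unitInterval, R)} (h : f + volterra B σ f = g + volterra B σ g) : f = g := by
  obtain ⟨u, hu⟩ := isUnit_one_add_volterra B σ
  have key : ∀ f, (↑u⁻¹ : C(unitInterval, R) →L[ℝ] C(unitInterval, R)) (f + volterra B σ f) = f := by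
    intro f
    have h1 : (↑u⁻¹ * ↑u : C(unitInterval, R) →L[ℝ] C(unitInterval, R)) f = f := by
      rw [u.inv_mul]; rfl
    rwa [hu] at h1
  rw [← key f, h, key g]

/-! ### Parallel transport as a smooth function of the curve -/

/-- The solution of `U' = -A_ν(σ) σ̇^ν U`, `U(0) = 1`. -/
def transportMap (A : Fin 4 → Spacetime → R) (σ : Curve q) : C(unitInterval, R) :=
  Ring.inverse (1 + volterra (fun ν => pull (A ν) σ) σ) 1

theorem transportMap_add_volterra (A : Fin 4 → Spacetime → R) (σ : Curve q) :
    transportMap A σ + volterra (fun ν => pull (A ν) σ) σ (transportMap A σ) = 1 := by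
  have h := Ring.mul_inverse_cancel _ (isUnit_one_add_volterra (fun ν => pull (A ν) σ) σ)
  exact congrArg (fun L : C(unitInterval, R) →L[ℝ] C(unitInterval, R) => L 1) h

theorem isPrimitive_transportMap (A : Fin 4 → Spacetime → R) (σ : Curve q) :
    IsPrimitive (transportMap A σ) (fun s => -∑ ν, velocity σ s ν •
      (extend (pull (A ν) σ) s * extend (transportMap A σ) s)) := by
  have h := (IsPrimitive.const (1 : R)).add (isPrimitive_volterra (fun ν => pull (A ν) σ) σ
    (transportMap A σ)).neg
  have e : transportMap A σ = ContinuousMap.const unitInterval 1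
      + -volterra (fun ν => pull (A ν) σ) σ (transportMap A σ) := by
    rw [← sub_eq_add_neg, eq_sub_iff_add_eq, transportMap_add_volterra]
    rfl
  rw [← e] at h
  exact h.congr fun t _ => by simp

theorem transportMap_apply_zero (A : Fin 4 → Spacetime → R) (σ : Curve q) :
    transportMap A σ 0 = 1 := by
  have h := congrArg (fun f : C(unitInterval, R) => f 0) (transportMap_add_volterra A σ)
  simpa [volterra_apply_zero] using h

theorem contDiff_transportMap {A : Fin 4 → Spacetime → R} (hA : ∀ μ, ContDiff ℝ ∞ (A μ)) (n : ℕ) :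
    ContDiff ℝ n (transportMap (q := q) A) := by
  have h1 : ContDiff ℝ n fun σ : Curve q => 1 + volterra (fun ν => pull (A ν) σ) σ := by
    refine contDiff_const.add ?_
    unfold volterra
    have hJ : ∀ ν, ContDiff ℝ n fun σ : Curve q => J (V := R) ν σ :=
      fun ν => ContinuousLinearMap.contDiff _
    refine ContDiff.sum fun ν _ => ContDiff.clm_comp (hJ ν) ?_
    have h : ContDiff ℝ n fun g : C(unitInterval, R) =>
        ContinuousLinearMap.mul ℝ C(unitInterval, R) g := ContinuousLinearMap.contDiff _
    exact h.comp (contDiff_pull (hA ν) n)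
  exact contDiff_inverse_apply h1 (fun σ => isUnit_one_add_volterra _ σ) 1

theorem hasFDerivAt_transportMap {A : Fin 4 → Spacetime → R} (hA : ∀ μ, ContDiff ℝ ∞ (A μ))
    (σ : Curve q) :
    HasFDerivAt (transportMap A) (fderiv ℝ (transportMap A) σ) σ :=
  (((contDiff_transportMap hA 1).differentiable (by simp)) σ).hasFDerivAt

/-- Differentiating the integral equation of the transport shows that `dU(u)` solves an
inhomogeneous equation with the same Volterra operator. The sources come from the variation of the
velocity and of `A` along the curve. -/
theorem fderiv_transportMap_add_volterra {A : Fin 4 → Spacetime → R}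
    (hA : ∀ μ, ContDiff ℝ ∞ (A μ)) (σ u : Curve q) :
    fderiv ℝ (transportMap A) σ u
      + volterra (fun ν => pull (A ν) σ) σ (fderiv ℝ (transportMap A) σ u)
      + (∑ ν, J ν u (pull (A ν) σ * transportMap A σ)
        + ∑ ν, J ν σ (pullDeriv (A ν) σ u * transportMap A σ)) = 0 := by
  have hU := hasFDerivAt_transportMap hA σ
  have h1 : ∀ ν, HasFDerivAt (fun σ : Curve q => J ν σ (pull (A ν) σ * transportMap A σ)) _ σ :=
    fun ν => (J ν).hasFDerivAt.clm_apply ((hasFDerivAt_pull (hA ν) σ).mul' hU)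
  have h2 := hU.add (HasFDerivAt.fun_sum (u := Finset.univ) fun ν _ => h1 ν)
  have e : (transportMap A + fun σ : Curve q => ∑ ν, J ν σ (pull (A ν) σ * transportMap A σ))
      = fun _ => 1 := by
    funext σ
    rw [← transportMap_add_volterra A σ, volterra_apply]
    rfl
  rw [e] at h2
  have h3 := congrArg (fun L : Curve q →L[ℝ] C(unitInterval, R) => L u)
    (h2.unique (hasFDerivAt_const (1 : C(unitInterval, R)) σ))
  simp only [_root_.add_apply, _root_.sum_apply,
    ContinuousLinearMap.comp_apply, ContinuousLinearMap.flip_apply,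
    _root_.smul_apply, _root_.zero_apply, smul_eq_mul, map_add,
    Finset.sum_add_distrib] at h3
  rw [volterra_apply, ← h3]
  simp only [op_smul_eq_mul, Pi.mul_apply]
  abel

end Volterra

/-! ### Covariant derivatives along curves -/

section Covariant

variable {R : Type} [NormedRing R] [NormedAlgebra ℝ R]

/-- The covariant derivative `∂_μ f + [A_μ, f]`. -/
def covDeriv (A : Fin 4 → Spacetime → R) (μ : Fin 4) (f : Spacetime → R) (x : Spacetime) : R :=
  pd μ f x + ⁅A μ x, f x⁆

/-- The field strength `∂_μ A_ν - ∂_ν A_μ + [A_μ, A_ν]`. -/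
def fieldStrength (A : Fin 4 → Spacetime → R) (μ ν : Fin 4) (x : Spacetime) : R :=
  pd μ (A ν) x - pd ν (A μ) x + ⁅A μ x, A ν x⁆

theorem contDiff_lie {f g : Spacetime → R} {n : ℕ∞ω} (hf : ContDiff ℝ n f) (hg : ContDiff ℝ n g) :
    ContDiff ℝ n fun x => ⁅f x, g x⁆ := by
  simp only [Ring.lie_def]
  exact (hf.mul hg).sub (hg.mul hf)

theorem contDiff_covDeriv {A : Fin 4 → Spacetime → R} (hA : ∀ μ, ContDiff ℝ ∞ (A μ))
    {f : Spacetime → R} (hf : ContDiff ℝ ∞ f) (μ : Fin 4) : ContDiff ℝ ∞ (covDeriv A μ f) :=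
  (contDiff_pd hf μ).add (contDiff_lie (hA μ) hf)

theorem contDiff_fieldStrength {A : Fin 4 → Spacetime → R} (hA : ∀ μ, ContDiff ℝ ∞ (A μ))
    (μ ν : Fin 4) : ContDiff ℝ ∞ (fieldStrength A μ ν) :=
  ((contDiff_pd (hA ν) μ).sub (contDiff_pd (hA μ) ν)).add (contDiff_lie (hA μ) (hA ν))

theorem fieldStrength_antisymm (A : Fin 4 → Spacetime → R) (μ ν : Fin 4) :
    fieldStrength A μ ν = -fieldStrength A ν μ := by
  funext x
  simp only [fieldStrength, Pi.neg_apply, Ring.lie_def]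
  abel

/-- The pointwise algebra behind the Stokes formula, with `w = σ̇(t)`, `u' = u̇(t)`, `dA μ ν = ∂_μ
A_ν`, `V = U⁻¹` and `W` the curvature integral at time `t`. The terms in `u'` cancel, and the
derivatives and products of `A` that remain are those of the field strength. -/
theorem transport_density_identity {ι : Type*} [Fintype ι] (w u u' : ι → ℝ) (A : ι → R)
    (dA : ι → ι → R) {U V W : R} (hUV : U * V = 1) :
    -(∑ μ, (((∑ ν, w ν • dA ν μ) * (u μ • 1) + A μ * (u' μ • 1)) * U
        + A μ * (u μ • 1) * -∑ ν, w ν • (A ν * U)))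
      + -((-∑ ν, w ν • (A ν * U)) * W
        + U * ∑ μ, ∑ ν, w ν • (V * (dA μ ν - dA ν μ + ⁅A μ, A ν⁆) * U * (u μ • 1)))
      + ∑ ν, w ν • (A ν * (-(∑ μ, A μ * (u μ • 1) * U) + -(U * W)))
      + (∑ ν, u' ν • (A ν * U) + ∑ ν, w ν • ((∑ μ, dA μ ν * (u μ • 1)) * U)) = 0 := by
  have h1 : ∑ μ, (((∑ ν, w ν • dA ν μ) * (u μ • 1) + A μ * (u' μ • 1)) * U
        + A μ * (u μ • 1) * -∑ ν, w ν • (A ν * U))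
      = (∑ μ, ∑ ν, (w ν * u μ) • dA ν μ) * U + (∑ μ, u' μ • A μ) * U
        - (∑ μ, u μ • A μ) * (∑ ν, w ν • A ν) * U := by
    simp only [Finset.sum_add_distrib, add_mul, Finset.sum_mul, mul_neg, Finset.sum_neg_distrib,
      sub_eq_add_neg, mul_smul_comm, smul_mul_assoc, mul_one, Finset.smul_sum, smul_smul,
      Finset.mul_sum, mul_assoc, mul_comm (w _)]
    congr 2
    rw [Finset.sum_comm]
  have h2 : ∑ ν, w ν • (A ν * U) = (∑ ν, w ν • A ν) * U := by
    simp only [Finset.sum_mul, smul_mul_assoc]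
  have h3 : U * ∑ μ, ∑ ν, w ν • (V * (dA μ ν - dA ν μ + ⁅A μ, A ν⁆) * U * (u μ • 1))
      = ((∑ μ, ∑ ν, (w ν * u μ) • dA μ ν) - (∑ μ, ∑ ν, (w ν * u μ) • dA ν μ)
        + ((∑ μ, u μ • A μ) * (∑ ν, w ν • A ν) - (∑ ν, w ν • A ν) * (∑ μ, u μ • A μ))) * U := by
    have e : ∀ X : R, U * (V * X * U) = X * U := fun X => by
      rw [mul_assoc V, ← mul_assoc, hUV, one_mul]
    have e1 : (∑ μ, u μ • A μ) * (∑ ν, w ν • A ν) = ∑ μ, ∑ ν, (w ν * u μ) • (A μ * A ν) := by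
      simp only [Finset.sum_mul, Finset.mul_sum, smul_mul_smul_comm, mul_comm (w _)]
      exact Finset.sum_comm
    have e2 : (∑ ν, w ν • A ν) * (∑ μ, u μ • A μ) = ∑ μ, ∑ ν, (w ν * u μ) • (A ν * A μ) := by
      simp only [Finset.sum_mul, Finset.mul_sum, smul_mul_smul_comm]
    rw [e1, e2]
    simp only [← Finset.sum_sub_distrib, ← Finset.sum_add_distrib, Finset.sum_mul, Finset.mul_sum,
      mul_smul_comm, mul_one, smul_smul, e, Ring.lie_def]
    refine Finset.sum_congr rfl fun μ _ => Finset.sum_congr rfl fun ν _ => ?_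
    rw [← smul_mul_assoc, smul_add, smul_sub, smul_sub]
  have h4 : ∑ μ, A μ * (u μ • 1) * U = (∑ μ, u μ • A μ) * U := by
    simp only [Finset.sum_mul, smul_mul_assoc, mul_smul_comm, mul_one]
  have h5 : ∀ X : R, ∑ ν, w ν • (A ν * X) = (∑ ν, w ν • A ν) * X := fun X => by
    simp only [Finset.sum_mul, smul_mul_assoc]
  have h6 : ∑ ν, w ν • ((∑ μ, dA μ ν * (u μ • 1)) * U)
      = (∑ μ, ∑ ν, (w ν * u μ) • dA μ ν) * U := by
    simp only [Finset.sum_mul, Finset.smul_sum, smul_mul_assoc, mul_smul_comm, mul_one, smul_smul]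
    exact Finset.sum_comm
  have h7 : ∑ ν, u' ν • (A ν * U) = (∑ μ, u' μ • A μ) * U := by
    simp only [Finset.sum_mul, smul_mul_assoc]
  rw [h1, h2, h3, h4, h5, h6, h7]
  noncomm_ring

variable {q : ℝ≥0∞} [hq : Fact (1 ≤ q)]

/-- The inverse of the parallel transport. -/
def invTransport (A : Fin 4 → Spacetime → R) (σ : Curve q) : C(unitInterval, R) :=
  Ring.inverse (transportMap A σ)

/-- The parallel translate `U_{0,t} f(σ(t)) U_{t,0}` of `f` along `σ`. -/
def translate (A : Fin 4 → Spacetime → R) (f : Spacetime → R) (σ : Curve q) :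
    C(unitInterval, R) :=
  invTransport A σ * pull f σ * transportMap A σ

/-- The function `t ↦ ∫_0^t U_{0,s} F_{μν}(σ(s)) U_{s,0} u^μ(s) σ̇^ν(s) ds`. -/
def curvatureIntegral (A : Fin 4 → Spacetime → R) (σ u : Curve q) : C(unitInterval, R) :=
  ∑ μ, ∑ ν, J ν σ (translate A (fieldStrength A μ ν) σ * coord μ u)

variable [CompleteSpace R]

/-- Coordinates are real multiples of the identity, hence central. -/
theorem coord_mul_comm (μ : Fin 4) (u : Curve q) (f : C(unitInterval, R)) :
    coord μ u * f = f * coord μ u := by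
  ext t
  simp [coord_apply]

theorem isPrimitive_curvatureIntegral (A : Fin 4 → Spacetime → R) (σ u : Curve q) :
    IsPrimitive (curvatureIntegral A σ u) (fun s => ∑ μ, ∑ ν, velocity σ s ν •
      (extend (translate A (fieldStrength A μ ν) σ) s * extend (coord μ u) s)) := by
  refine (IsPrimitive.sum Finset.univ fun μ _ => IsPrimitive.sum Finset.univ fun ν _ =>
    isPrimitive_J ν σ _).congr fun t _ => ?_
  simp only [Finset.sum_apply, extend_mul]

theorem curvatureIntegral_apply_zero (A : Fin 4 → Spacetime → R) (σ u : Curve q) :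
    curvatureIntegral A σ u 0 = 0 := by
  simp [curvatureIntegral, ContinuousMap.sum_apply, J_apply_zero]

/-- The non-abelian Stokes formula: varying the curve changes the transport by a boundary term in
`A` and by the curvature swept out. The right-hand side satisfies the linearised equation, whose
solution is unique. -/
theorem fderiv_transportMap {A : Fin 4 → Spacetime → R} (hA : ∀ μ, ContDiff ℝ ∞ (A μ))
    {σ : Curve q} (hU : IsUnit (transportMap A σ)) (u : Curve q) :
    fderiv ℝ (transportMap A) σ u = -(∑ μ, pull (A μ) σ * coord μ u * transportMap A σ)
      + -(transportMap A σ * curvatureIntegral A σ u) := by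
  refine eq_of_add_volterra_eq (B := fun ν => pull (A ν) σ) (σ := σ) ?_
  -- Adding the source terms to both sides turns the left one into `0`, so the candidate has only to
  -- solve the linearised equation.
  rw [← add_left_inj (∑ ν, J ν u (pull (A ν) σ * transportMap A σ)
        + ∑ ν, J ν σ (pullDeriv (A ν) σ u * transportMap A σ)),
    fderiv_transportMap_add_volterra hA]
  have hUp := isPrimitive_transportMap A σ
  have h1 := (IsPrimitive.sum Finset.univ fun μ _ =>
    ((isPrimitive_pull (hA μ) σ).mul (isPrimitive_coord μ u)).mul hUp).neg
  have h2 := (hUp.mul (isPrimitive_curvatureIntegral A σ u)).neg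
  have h3 := isPrimitive_volterra (fun ν => pull (A ν) σ) σ
    (-(∑ μ, pull (A μ) σ * coord μ u * transportMap A σ)
      + -(transportMap A σ * curvatureIntegral A σ u))
  have h4 := IsPrimitive.sum Finset.univ fun ν _ =>
    isPrimitive_J ν u (pull (A ν) σ * transportMap A σ)
  have h5 := IsPrimitive.sum Finset.univ fun ν _ =>
    isPrimitive_J ν σ (pullDeriv (A ν) σ u * transportMap A σ)
  refine (IsPrimitive.eq_zero_of_zero ((((h1.add h2).add h3).add (h4.add h5)).congr
    fun t _ => ?_) ?_).symm
  · have hUV : extend (transportMap A σ) t * extend (invTransport A σ) t = 1 := by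
      rw [← extend_mul, invTransport, Ring.mul_inverse_cancel _ hU]
      rfl
    have key := transport_density_identity (velocity σ t) (ext u t) (velocity u t)
      (fun μ => extend (pull (A μ) σ) t) (fun μ ν => extend (pull (pd μ (A ν)) σ) t)
      (W := extend (curvatureIntegral A σ u) t) hUV
    have hF : ∀ μ ν, extend (pull (fieldStrength A μ ν) σ) t
        = extend (pull (pd μ (A ν)) σ) t - extend (pull (pd ν (A μ)) σ) t
          + ⁅extend (pull (A μ) σ) t, extend (pull (A ν) σ) t⁆ := fun μ ν => by
      rw [extend_pull (contDiff_fieldStrength hA μ ν).continuous,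
        extend_pull (contDiff_pd (hA ν) μ).continuous,
        extend_pull (contDiff_pd (hA μ) ν).continuous, extend_pull (hA μ).continuous,
        extend_pull (hA ν).continuous, fieldStrength]
    rw [Pi.zero_apply, ← key]
    simp only [Pi.add_apply, Pi.neg_apply, Finset.sum_apply, pullDeriv_apply, extend_mul,
      extend_add, extend_neg, extend_sum, extend_coord, translate, hF]
  · simp [ContinuousMap.sum_apply, coord_apply_zero, curvatureIntegral_apply_zero,
      volterra_apply_zero, J_apply_zero]

end Covariant

/-! ### Derivatives of the inverse transport and of parallel translates -/

section Translate

variable {q : ℝ≥0∞} [hq : Fact (1 ≤ q)] {R : Type} [NormedRing R] [NormedAlgebra ℝ R]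
  [CompleteSpace R]

omit hq [NormedAlgebra ℝ R] [CompleteSpace R] in
theorem continuousMap_mul_neg (f g : C(unitInterval, R)) : f * -g = -(f * g) := mul_neg f g

theorem contDiff_ringInverse_comp {E S : Type*} [NormedAddCommGroup E] [NormedSpace ℝ E]
    [NormedRing S] [NormedAlgebra ℝ S] [CompleteSpace S] {f : E → S} {n : ℕ∞ω}
    (hf : ContDiff ℝ n f) (hu : ∀ x, IsUnit (f x)) : ContDiff ℝ n fun x => Ring.inverse (f x) := by
  refine contDiff_iff_contDiffAt.2 fun x => ?_
  obtain ⟨u, hu⟩ := hu x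
  refine ContDiffAt.comp x (g := Ring.inverse) ?_ hf.contDiffAt
  rw [← hu]
  exact contDiffAt_ringInverse ℝ u

variable {A : Fin 4 → Spacetime → R} (hA : ∀ μ, ContDiff ℝ ∞ (A μ))
  (hU : ∀ σ : Curve q, IsUnit (transportMap A σ))
include hA hU

theorem contDiff_invTransport (n : ℕ) : ContDiff ℝ n (invTransport (q := q) A) :=
  contDiff_ringInverse_comp (contDiff_transportMap hA n) hU

theorem contDiff_translate {f : Spacetime → R} (hf : ContDiff ℝ ∞ f) (n : ℕ) :
    ContDiff ℝ n (translate (q := q) A f) :=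
  ((contDiff_invTransport hA hU n).mul (contDiff_pull hf n)).mul (contDiff_transportMap hA n)

/-- Obtained by differentiating `U⁻¹ U = 1`. -/
theorem fderiv_invTransport (σ u : Curve q) :
    fderiv ℝ (invTransport A) σ u = (∑ μ, invTransport A σ * pull (A μ) σ * coord μ u)
      + curvatureIntegral A σ u * invTransport A σ := by
  have hV : HasFDerivAt (invTransport A) (fderiv ℝ (invTransport A) σ) σ :=
    (((contDiff_invTransport hA hU 1).differentiable (by simp)) σ).hasFDerivAt
  have h1 := hV.mul' (hasFDerivAt_transportMap hA σ)
  have e : (invTransport A * transportMap A : Curve q → C(unitInterval, R)) = fun _ => 1 :=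
    funext fun σ => Ring.inverse_mul_cancel _ (hU σ)
  rw [e] at h1
  have h2 := congrArg (fun L : Curve q →L[ℝ] C(unitInterval, R) => L u)
    (h1.unique (hasFDerivAt_const (1 : C(unitInterval, R)) σ))
  simp only [_root_.add_apply, _root_.smul_apply, _root_.zero_apply, smul_eq_mul,
    op_smul_eq_mul] at h2
  rw [fderiv_transportMap hA (hU σ)] at h2
  have h3 := congrArg (· * invTransport A σ) (eq_neg_of_add_eq_zero_right h2)
  have hUV : transportMap A σ * invTransport A σ = 1 := Ring.mul_inverse_cancel _ (hU σ)
  have hVU : invTransport A σ * transportMap A σ = 1 := Ring.inverse_mul_cancel _ (hU σ)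
  simp only [mul_assoc, hUV, mul_one] at h3
  rw [h3]
  simp only [mul_add, continuousMap_mul_neg, neg_add, neg_neg, add_mul, Finset.mul_sum,
    Finset.sum_mul, mul_assoc,
    hUV, mul_one]
  rw [← mul_assoc (invTransport A σ) (transportMap A σ), hVU, one_mul]

/-- The boundary terms of `dU` and `dU⁻¹` complete `∂_μ f` to the covariant derivative, while the
curvature integrals on the two sides of `f` form a commutator. -/
theorem fderiv_translate {f : Spacetime → R} (hf : ContDiff ℝ ∞ f) (σ u : Curve q) :
    fderiv ℝ (translate A f) σ u = (∑ μ, translate A (covDeriv A μ f) σ * coord μ u)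
      + ⁅curvatureIntegral A σ u, translate A f σ⁆ := by
  have hV : HasFDerivAt (invTransport A) (fderiv ℝ (invTransport A) σ) σ :=
    (((contDiff_invTransport hA hU 1).differentiable (by simp)) σ).hasFDerivAt
  have h1 := (hV.mul' (hasFDerivAt_pull hf σ)).mul' (hasFDerivAt_transportMap hA σ)
  have h2 : fderiv ℝ (translate A f) σ = _ := h1.fderiv
  have hc : ∀ μ, pull (covDeriv A μ f) σ = pull (pd μ f) σ + pull (A μ) σ * pull f σ
      - pull f σ * pull (A μ) σ := fun μ => by
    ext t
    rw [ContinuousMap.sub_apply, ContinuousMap.add_apply, ContinuousMap.mul_apply,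
      ContinuousMap.mul_apply, pull_apply (contDiff_covDeriv hA hf μ).continuous,
      pull_apply (contDiff_pd hf μ).continuous, pull_apply (hA μ).continuous,
      pull_apply hf.continuous, covDeriv, Ring.lie_def]
    abel
  rw [h2]
  simp only [_root_.add_apply, _root_.smul_apply, smul_eq_mul, op_smul_eq_mul, Pi.mul_apply]
  rw [fderiv_transportMap hA (hU σ), fderiv_invTransport hA hU, pullDeriv_apply, Ring.lie_def]
  simp only [translate, hc, mul_add, add_mul, mul_sub, sub_mul, Finset.mul_sum, Finset.sum_mul,
    mul_assoc, coord_mul_comm, Finset.sum_add_distrib, Finset.sum_sub_distrib,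
    continuousMap_mul_neg]
  abel

end Translate

/-! ### The second derivative of the parallel transport -/

section ApplyOne

variable {E V : Type*} [NormedAddCommGroup E] [NormedSpace ℝ E] [NormedAddCommGroup V]
  [NormedSpace ℝ V]

/-- Evaluation at `1` as a continuous linear map. -/
def evalOne : C(unitInterval, V) →L[ℝ] V := ContinuousMap.evalCLM ℝ 1

theorem evalOne_apply (f : C(unitInterval, V)) : evalOne f = f 1 := rfl

theorem hasFDerivAt_apply_one {F : E → C(unitInterval, V)} {F' : E →L[ℝ] C(unitInterval, V)} {x : E}
    (h : HasFDerivAt F F' x) : HasFDerivAt (fun y => F y 1) (evalOne.comp F') x :=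
  HasFDerivAt.comp x (g := fun f : C(unitInterval, V) => f 1) (evalOne (V := V)).hasFDerivAt h

theorem contDiff_apply_one {F : E → C(unitInterval, V)} {n : ℕ∞ω} (h : ContDiff ℝ n F) :
    ContDiff ℝ n fun y => F y 1 :=
  ContDiff.comp (g := fun f : C(unitInterval, V) => f 1) (evalOne (V := V)).contDiff h

end ApplyOne

section SecondDerivative

variable {q : ℝ≥0∞} [hq : Fact (1 ≤ q)] {R : Type} [NormedRing R] [NormedAlgebra ℝ R]
  [CompleteSpace R]

/-- The density of `curvatureIntegral`: `U_{0,t} F_{μν}(σ(t)) U_{t,0} σ̇^ν(t)`. -/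
def curvatureDensity (A : Fin 4 → Spacetime → R) (σ : Curve q) (μ : Fin 4) (t : ℝ) : R :=
  ∑ ν, velocity σ t ν • extend (translate A (fieldStrength A μ ν) σ) t

theorem intervalIntegrable_curvatureDensity (A : Fin 4 → Spacetime → R) (σ : Curve q) (μ : Fin 4) :
    IntervalIntegrable (curvatureDensity A σ μ) volume 0 1 := by
  have h := IntervalIntegrable.sum
    (f := fun ν s => velocity σ s ν • extend (translate A (fieldStrength A μ ν) σ) s)
    Finset.univ fun ν _ => intervalIntegrable_velocity_smul σ ν _
  have e : curvatureDensity A σ μ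
      = ∑ ν, fun s => velocity σ s ν • extend (translate A (fieldStrength A μ ν) σ) s := by
    funext t
    rw [curvatureDensity, Finset.sum_apply]
  rw [e]
  exact h

theorem isPrimitive_curvatureIntegral' (A : Fin 4 → Spacetime → R) (σ u : Curve q) :
    IsPrimitive (curvatureIntegral A σ u) (fun t => ∑ μ, ext u t μ • curvatureDensity A σ μ t) := by
  refine (isPrimitive_curvatureIntegral A σ u).congr fun t _ => ?_
  simp only [curvatureDensity, extend_coord, mul_smul_comm, mul_one, Finset.smul_sum, smul_smul,
    mul_comm]

theorem coord_apply_one_of_mem_closedCurves {u : Curve q} (hu : u ∈ closedCurves q) (μ : Fin 4) :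
    coord (R := R) μ u 1 = 0 := by
  have h : u 1 = 0 := hu
  rw [coord_apply, h]
  simp

theorem IsPrimitive.apply_one {V : Type*} [NormedAddCommGroup V] [NormedSpace ℝ V]
    {f : C(unitInterval, V)} {a : ℝ → V} (h : IsPrimitive f a) (h0 : f 0 = 0) :
    f 1 = ∫ t in (0 : ℝ)..1, a t := by
  rw [h.eq_add, h0, zero_add]
  rfl

/-- The parallel transport along the whole curve. -/
def holonomy (A : Fin 4 → Spacetime → R) (σ : Curve q) : R := transportMap A σ 1

/-- The terms of the second derivative of the parallel transport on `E_0`, apart from the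
Volterra part. -/
def levyForm (A : Fin 4 → Spacetime → R) (σ v u : Curve q) : C(unitInterval, R) :=
  ∑ μ, ∑ ν, J ν v (translate A (fieldStrength A μ ν) σ * coord μ u)
    + ∑ μ, ∑ ν, J ν σ ((∑ lam, translate A (covDeriv A lam (fieldStrength A μ ν)) σ * coord lam v)
      * coord μ u)

theorem isPrimitive_levyForm (A : Fin 4 → Spacetime → R) (σ v u : Curve q) :
    IsPrimitive (levyForm A σ v u) (fun t =>
      ∑ μ, ∑ ν, (velocity v t ν * ext u t μ) • extend (translate A (fieldStrength A μ ν) σ) t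
        + ∑ lam, ∑ μ, (ext v t lam * ext u t μ) • ∑ ν, velocity σ t ν •
            extend (translate A (covDeriv A lam (fieldStrength A μ ν)) σ) t) := by
  refine ((IsPrimitive.sum Finset.univ fun μ _ => IsPrimitive.sum Finset.univ fun ν _ =>
    isPrimitive_J ν v _).add (IsPrimitive.sum Finset.univ fun μ _ =>
    IsPrimitive.sum Finset.univ fun ν _ => isPrimitive_J ν σ _)).congr fun t _ => ?_
  simp only [Pi.add_apply, Finset.sum_apply, extend_mul, extend_sum, extend_coord, mul_smul_comm,
    mul_one, Finset.smul_sum, smul_smul]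
  congr 1
  rw [Finset.sum_comm (γ := Fin 4) (s := Finset.univ (α := Fin 4)) (t := Finset.univ)
    (f := fun lam μ => ∑ ν, (ext v t lam * ext u t μ * velocity σ t ν) •
          extend (translate A (covDeriv A lam (fieldStrength A μ ν)) σ) t)]
  refine Finset.sum_congr rfl fun μ _ => ?_
  rw [Finset.sum_comm]
  refine Finset.sum_congr rfl fun lam _ => Finset.sum_congr rfl fun ν _ => ?_
  congr 1
  ring

theorem levyForm_apply_zero (A : Fin 4 → Spacetime → R) (σ v u : Curve q) :
    levyForm A σ v u 0 = 0 := by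
  simp [levyForm, ContinuousMap.sum_apply, J_apply_zero]

variable {A : Fin 4 → Spacetime → R} (hA : ∀ μ, ContDiff ℝ ∞ (A μ))
  (hU : ∀ σ : Curve q, IsUnit (transportMap A σ))
include hA

theorem contDiff_holonomy (n : ℕ) : ContDiff ℝ n (holonomy (q := q) A) :=
  contDiff_apply_one (contDiff_transportMap hA n)

include hU

theorem fderiv_holonomy_of_mem_closedCurves (σ : Curve q) {u : Curve q}
    (hu : u ∈ closedCurves q) :
    fderiv ℝ (holonomy A) σ u = -(transportMap A σ * curvatureIntegral A σ u) 1 := by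
  have h : fderiv ℝ (holonomy A) σ = _ :=
    (hasFDerivAt_apply_one (hasFDerivAt_transportMap hA σ)).fderiv
  rw [h, ContinuousLinearMap.comp_apply, fderiv_transportMap hA (hU σ), evalOne_apply]
  simp [ContinuousMap.sum_apply, coord_apply_one_of_mem_closedCurves hu]

theorem hasFDerivAt_translate {f : Spacetime → R} (hf : ContDiff ℝ ∞ f) (σ : Curve q) :
    HasFDerivAt (translate A f) (fderiv ℝ (translate A f) σ) σ :=
  (((contDiff_translate hA hU hf 1).differentiable (by simp)) σ).hasFDerivAt

/-- The product rule: the variation `v` acts either on the velocity, giving `v̇^ν`, or on the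
translated field strength, giving `∇F` and a commutator. -/
theorem exists_hasFDerivAt_curvatureIntegral (σ u : Curve q) :
    ∃ L : Curve q →L[ℝ] C(unitInterval, R),
      HasFDerivAt (fun τ => curvatureIntegral A τ u) L σ ∧
      ∀ v, L v = levyForm A σ v u + ∑ μ, ∑ ν, J ν σ
        (⁅curvatureIntegral A σ v, translate A (fieldStrength A μ ν) σ⁆ * coord μ u) := by
  have h : ∀ μ ν, HasFDerivAt
      (fun τ : Curve q => J ν τ (translate A (fieldStrength A μ ν) τ * coord μ u)) _ σ :=
    fun μ ν => (J ν).hasFDerivAt.clm_apply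
      ((hasFDerivAt_translate hA hU (contDiff_fieldStrength hA μ ν) σ).mul_const' (coord μ u))
  refine ⟨_, HasFDerivAt.fun_sum (u := Finset.univ) fun μ _ =>
    HasFDerivAt.fun_sum (u := Finset.univ) fun ν _ => h μ ν, fun v => ?_⟩
  simp only [_root_.add_apply, _root_.sum_apply, ContinuousLinearMap.comp_apply,
    ContinuousLinearMap.flip_apply, _root_.smul_apply, op_smul_eq_mul,
    fderiv_translate hA hU (contDiff_fieldStrength hA _ _), add_mul, map_add,
    Finset.sum_add_distrib, levyForm]
  abel

/-- The condition `u ∈ E_0` does not involve `σ`, so the first-order formula without boundary term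
holds at every curve and can be differentiated again. -/
theorem fderiv_fderiv_holonomy (σ : Curve q) {u v : Curve q} (hu : u ∈ closedCurves q)
    (hv : v ∈ closedCurves q) :
    fderiv ℝ (fderiv ℝ (holonomy A)) σ v u = holonomy A σ * (
      curvatureIntegral A σ v * curvatureIntegral A σ u - levyForm A σ v u
        - ∑ μ, ∑ ν, J ν σ
        (⁅curvatureIntegral A σ v, translate A (fieldStrength A μ ν) σ⁆ * coord μ u) :
          C(unitInterval, R)) 1 := by
  obtain ⟨L, hL, hLv⟩ := exists_hasFDerivAt_curvatureIntegral hA hU σ u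
  have hd : DifferentiableAt ℝ (fderiv ℝ (holonomy (q := q) A)) σ :=
    (((contDiff_holonomy hA 2).fderiv_right (m := 1) (by norm_num)).differentiable (by simp)) σ
  have h1 : HasFDerivAt (fun τ => fderiv ℝ (holonomy A) τ u) _ σ :=
    hd.hasFDerivAt.clm_apply (hasFDerivAt_const u σ)
  have h2 := (hasFDerivAt_apply_one ((hasFDerivAt_transportMap hA σ).mul' hL)).neg
  have e : (fun τ => fderiv ℝ (holonomy A) τ u)
      = -fun τ => (transportMap A τ * curvatureIntegral A τ u) 1 :=
    funext fun τ => fderiv_holonomy_of_mem_closedCurves hA hU τ hu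
  rw [e] at h1
  have h3 := congrArg (fun L : Curve q →L[ℝ] R => L v) (h1.unique h2)
  -- Here `v(1) = 0` removes the boundary term of `dU(v)`.
  have h4 : ((fderiv ℝ (transportMap A) σ v * curvatureIntegral A σ u) 1 : R)
      = -(holonomy A σ * (curvatureIntegral A σ v * curvatureIntegral A σ u) 1) := by
    rw [fderiv_transportMap hA (hU σ)]
    simp [ContinuousMap.sum_apply, coord_apply_one_of_mem_closedCurves hv, holonomy, mul_assoc]
  simp only [_root_.add_apply, ContinuousLinearMap.comp_apply, _root_.neg_apply,
    ContinuousLinearMap.flip_apply, _root_.zero_apply, map_zero, zero_add, map_add,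
    _root_.smul_apply, op_smul_eq_mul, smul_eq_mul, evalOne_apply, h4, hLv] at h3
  rw [h3]
  simp only [ContinuousMap.mul_apply, ContinuousMap.add_apply, ContinuousMap.sub_apply, holonomy]
  noncomm_ring

end SecondDerivative

/-! ### Integrability of the three kernels and evaluation of the Volterra part -/

section LevyKernels

variable {q : ℝ≥0∞} [hq : Fact (1 ≤ q)] {R : Type} [NormedRing R] [NormedAlgebra ℝ R]

/-- The Volterra kernel of the second derivative of the parallel transport. -/
def volterraKernel (A : Fin 4 → Spacetime → R) (σ : Curve q) (μ ν : Fin 4) (x : ℝ × ℝ) : R :=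
  holonomy A σ * if x.2 ≤ x.1 then curvatureDensity A σ μ x.1 * curvatureDensity A σ ν x.2
    else curvatureDensity A σ ν x.2 * curvatureDensity A σ μ x.1

/-- The Lévy kernel of the second derivative of the parallel transport. -/
def levyKernel (A : Fin 4 → Spacetime → R) (σ : Curve q) (μ ν : Fin 4) (t : ℝ) : R :=
  (-(1 / 2) : ℝ) • (holonomy A σ * ∑ κ, velocity σ t κ •
    (extend (translate A (covDeriv A μ (fieldStrength A ν κ)) σ) t
      + extend (translate A (covDeriv A ν (fieldStrength A μ κ)) σ) t))

/-- The singular kernel of the second derivative of the parallel transport. -/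
def singularKernel (A : Fin 4 → Spacetime → R) (σ : Curve q) (μ ν : Fin 4) (t : ℝ) : R :=
  holonomy A σ * extend (translate A (fieldStrength A μ ν) σ) t

theorem levyKernel_symm (A : Fin 4 → Spacetime → R) (σ : Curve q) (μ ν : Fin 4) (t : ℝ) :
    levyKernel A σ μ ν t = levyKernel A σ ν μ t := by
  simp only [levyKernel, add_comm]

variable [CompleteSpace R]

theorem integrableOn_curvatureDensity (A : Fin 4 → Spacetime → R) (σ : Curve q) (μ : Fin 4) :
    IntegrableOn (curvatureDensity A σ μ) (Set.Icc 0 1) :=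
  (intervalIntegrable_iff_integrableOn_Icc_of_le zero_le_one).1
    (intervalIntegrable_curvatureDensity A σ μ)

theorem integrableOn_volterraKernel (A : Fin 4 → Spacetime → R) (σ : Curve q) (μ ν : Fin 4) :
    IntegrableOn (volterraKernel A σ μ ν) (Set.Icc (0 : ℝ) 1 ×ˢ Set.Icc (0 : ℝ) 1) := by
  rw [IntegrableOn, Measure.volume_eq_prod, ← Measure.prod_restrict]
  have h1 := (integrableOn_curvatureDensity A σ μ).mul_prod (integrableOn_curvatureDensity A σ ν)
  have h2 := ((integrableOn_curvatureDensity A σ ν).mul_prod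
    (integrableOn_curvatureDensity A σ μ)).swap
  have hs : MeasurableSet {x : ℝ × ℝ | x.2 ≤ x.1} := measurableSet_le measurable_snd measurable_fst
  refine (Integrable.piecewise hs h1.integrableOn h2.integrableOn).const_mul' (holonomy A σ) |>.congr
    (.of_forall fun x => ?_)
  by_cases hx : x.2 ≤ x.1
  · simp [volterraKernel, Set.piecewise, hx]
  · simp [volterraKernel, Set.piecewise, hx]

theorem integrableOn_levyKernel (A : Fin 4 → Spacetime → R) (σ : Curve q) (μ ν : Fin 4) :
    IntegrableOn (levyKernel A σ μ ν) (Set.Icc (0 : ℝ) 1) := by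
  have h := integrable_finsetSum (Finset.univ (α := Fin 4)) fun κ _ =>
    (intervalIntegrable_iff_integrableOn_Icc_of_le zero_le_one).1
      (intervalIntegrable_velocity_smul σ κ
        (extend (translate A (covDeriv A μ (fieldStrength A ν κ)) σ
          + translate A (covDeriv A ν (fieldStrength A μ κ)) σ)))
  exact (h.const_mul' (holonomy A σ)).smul (-(1 / 2) : ℝ)

theorem memLp_singularKernel (A : Fin 4 → Spacetime → R) (σ : Curve q) (μ ν : Fin 4) :
    MemLp (singularKernel A σ μ ν) ∞ (volume.restrict (Set.Icc (0 : ℝ) 1)) := by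
  have hc : Continuous (singularKernel A σ μ ν) :=
    continuous_const.mul (extend (translate A (fieldStrength A μ ν) σ)).continuous
  refine memLp_top_of_bound hc.aestronglyMeasurable
    (‖holonomy A σ‖ * ‖translate A (fieldStrength A μ ν) σ‖) (.of_forall fun t => ?_)
  refine (norm_mul_le _ _).trans ?_
  gcongr
  exact (translate A (fieldStrength A μ ν) σ).norm_coe_le_norm _

omit [CompleteSpace R] in
theorem mul_sum_smul_mul_sum_smul {ι : Type*} [Fintype ι] (h : R) (a b : ι → ℝ) (k l : ι → R) :
    h * ((∑ i, a i • k i) * ∑ j, b j • l j) = ∑ i, ∑ j, (a i * b j) • (h * (k i * l j)) := by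
  rw [Finset.sum_mul_sum, Finset.mul_sum]
  refine Finset.sum_congr rfl fun i _ => ?_
  rw [Finset.mul_sum]
  refine Finset.sum_congr rfl fun j _ => ?_
  rw [smul_mul_smul_comm, mul_smul_comm]

/-- The kernel places the density with the later time on the left. Splitting the inner integral at
`t` yields `W_v(t)` on the right for `s ≤ t` and `W_v(1) - W_v(t)` on the left for `s > t`. -/
theorem integral_volterraKernel_inner (A : Fin 4 → Spacetime → R) (σ u v : Curve q) {t : ℝ}
    (ht : t ∈ Set.Icc (0 : ℝ) 1) :
    ∫ s in (0 : ℝ)..1, ∑ μ, ∑ ν, (ext u t μ * ext v s ν) • volterraKernel A σ μ ν (t, s)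
      = holonomy A σ * ((∑ μ, ext u t μ • curvatureDensity A σ μ t)
          * extend (curvatureIntegral A σ v) t
        + (curvatureIntegral A σ v 1 - extend (curvatureIntegral A σ v) t)
          * ∑ μ, ext u t μ • curvatureDensity A σ μ t) := by
  set a := ∑ μ, ext u t μ • curvatureDensity A σ μ t with ha
  set b : ℝ → R := fun s => ∑ ν, ext v s ν • curvatureDensity A σ ν s with hb
  have hv : IsPrimitive (curvatureIntegral A σ v) b := isPrimitive_curvatureIntegral' A σ v
  have hW1 : curvatureIntegral A σ v 1 = ∫ s in (0 : ℝ)..1, b s :=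
    hv.apply_one (curvatureIntegral_apply_zero A σ v)
  have hWt : extend (curvatureIntegral A σ v) t = ∫ s in (0 : ℝ)..t, b s := by
    rw [extend_of_mem _ ht, hv.eq_add, curvatureIntegral_apply_zero, zero_add]
  have hmem : t ∈ Set.uIcc (0 : ℝ) 1 := by rwa [Set.uIcc_of_le zero_le_one]
  have hb0 : IntervalIntegrable b volume 0 t :=
    hv.1.mono_set (Set.uIcc_subset_uIcc Set.left_mem_uIcc hmem)
  have hb1 : IntervalIntegrable b volume t 1 :=
    hv.1.mono_set (Set.uIcc_subset_uIcc hmem Set.right_mem_uIcc)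
  let L1 : R →L[ℝ] R := (ContinuousLinearMap.mul ℝ R (holonomy A σ)).comp
    (ContinuousLinearMap.mul ℝ R a)
  let L2 : R →L[ℝ] R := (ContinuousLinearMap.mul ℝ R (holonomy A σ)).comp
    ((ContinuousLinearMap.mul ℝ R).flip a)
  have e1 : ∀ s ∈ Set.uIoc 0 t,
      ∑ μ, ∑ ν, (ext u t μ * ext v s ν) • volterraKernel A σ μ ν (t, s) = L1 (b s) := by
    intro s hs
    rw [Set.uIoc_of_le ht.1] at hs
    simp only [volterraKernel, if_pos hs.2, L1, ContinuousLinearMap.comp_apply,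
      ContinuousLinearMap.mul_apply', ha, hb, mul_sum_smul_mul_sum_smul]
  have e2 : ∀ s ∈ Set.uIoc t 1,
      ∑ μ, ∑ ν, (ext u t μ * ext v s ν) • volterraKernel A σ μ ν (t, s) = L2 (b s) := by
    intro s hs
    rw [Set.uIoc_of_le ht.2] at hs
    simp only [volterraKernel, if_neg (not_le.2 hs.1), L2, ContinuousLinearMap.comp_apply,
      ContinuousLinearMap.mul_apply', ContinuousLinearMap.flip_apply, ha, hb,
      mul_sum_smul_mul_sum_smul, mul_comm (ext u t _)]
    exact Finset.sum_comm
  have i1 : IntervalIntegrable (fun s => L1 (b s)) volume 0 t :=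
    ⟨L1.integrable_comp hb0.1, L1.integrable_comp hb0.2⟩
  have i2 : IntervalIntegrable (fun s => L2 (b s)) volume t 1 :=
    ⟨L2.integrable_comp hb1.1, L2.integrable_comp hb1.2⟩
  rw [← intervalIntegral.integral_add_adjacent_intervals
      (i1.congr fun s hs => (e1 s hs).symm) (i2.congr fun s hs => (e2 s hs).symm),
    intervalIntegral.integral_congr_ae (.of_forall e1),
    intervalIntegral.integral_congr_ae (.of_forall e2),
    L1.intervalIntegral_comp_comm hb0, L2.intervalIntegral_comp_comm hb1, hW1, hWt,
    intervalIntegral.integral_interval_sub_left hv.1 hb0, mul_add]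
  rfl

/-- Let `a` be the density of `W_u`. Integrating the inner formula leaves `∫ a W_v + W_v(1) W_u(1) -
∫ W_v a`; the product rule for `W_v W_u` replaces the last two terms by `∫ W_v' W_u`. -/
theorem integral_volterraKernel (A : Fin 4 → Spacetime → R) (σ u v : Curve q) :
    ∫ t in (0 : ℝ)..1, ∫ s in (0 : ℝ)..1,
        ∑ μ, ∑ ν, (ext u t μ * ext v s ν) • volterraKernel A σ μ ν (t, s)
      = holonomy A σ * ∫ t in (0 : ℝ)..1,
        ((∑ μ, ext u t μ • curvatureDensity A σ μ t) * extend (curvatureIntegral A σ v) t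
          + (∑ μ, ext v t μ • curvatureDensity A σ μ t) * extend (curvatureIntegral A σ u) t) := by
  have hu := isPrimitive_curvatureIntegral' A σ u
  have hv := isPrimitive_curvatureIntegral' A σ v
  have hc : ∀ w, Continuous (extend (curvatureIntegral A σ w)) := fun w =>
    (extend (curvatureIntegral A σ w)).continuous
  have hvu := (hv.mul hu).apply_one (by
    rw [ContinuousMap.mul_apply, curvatureIntegral_apply_zero, zero_mul])
  have hu1 := hu.apply_one (curvatureIntegral_apply_zero A σ u)
  have i1 := hu.1.mul_continuousOn (hc v).continuousOn
  have i2 := hv.1.mul_continuousOn (hc u).continuousOn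
  have i3 := hu.1.continuousOn_mul (hc v).continuousOn
  have i4 : IntervalIntegrable (fun t => curvatureIntegral A σ v 1
      * ∑ μ, ext u t μ • curvatureDensity A σ μ t) volume 0 1 :=
    hu.1.continuousOn_mul continuousOn_const
  have e4 := (ContinuousLinearMap.mul ℝ R (curvatureIntegral A σ v 1)).intervalIntegral_comp_comm
    hu.1
  simp only [ContinuousLinearMap.mul_apply'] at e4
  rw [ContinuousMap.mul_apply, intervalIntegral.integral_add i2 i3] at hvu
  have e := intervalIntegral.integral_congr (μ := volume) (a := 0) (b := 1)
    fun t ht => integral_volterraKernel_inner A σ u v (by rwa [Set.uIcc_of_le zero_le_one] at ht)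
  rw [e]
  have eL := (ContinuousLinearMap.mul ℝ R (holonomy A σ)).intervalIntegral_comp_comm
    (i1.add (i4.sub i3))
  simp only [ContinuousLinearMap.mul_apply', ← sub_mul] at eL
  rw [eL, intervalIntegral.integral_add i1 i2]
  congr 1
  simp only [sub_mul]
  rw [intervalIntegral.integral_add i1 (i4.sub i3), intervalIntegral.integral_sub i4 i3, e4, ← hu1,
    hvu]
  abel

end LevyKernels

/-! ### The second derivative of the transport as an element of the Lévy space -/

section LevyRepresentation

variable {q : ℝ≥0∞} [hq : Fact (1 ≤ q)] {R : Type} [NormedRing R] [NormedAlgebra ℝ R]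

theorem extend_translate (A : Fin 4 → Spacetime → R) {f : Spacetime → R} (hf : Continuous f)
    (σ : Curve q) (t : ℝ) : extend (translate A f σ) t
      = extend (invTransport A σ) t * f (ext σ t) * extend (transportMap A σ) t := by
  rw [translate, extend_mul, extend_mul, extend_pull hf]

/-- Let `a` be the density of `W_u`. The product rule for `W_v W_u` gives `W_v a`, and subtracting
the commutator `[W_v, a]` turns it into `a W_v`. The result is symmetric in `u` and `v`, as the
Volterra part must be. -/
theorem isPrimitive_mul_sub_commutator [CompleteSpace R] (A : Fin 4 → Spacetime → R)
    (σ u v : Curve q) :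
    IsPrimitive (curvatureIntegral A σ v * curvatureIntegral A σ u + -∑ μ, ∑ ν, J ν σ
        (⁅curvatureIntegral A σ v, translate A (fieldStrength A μ ν) σ⁆ * coord μ u))
      (fun t => (∑ μ, ext v t μ • curvatureDensity A σ μ t) * extend (curvatureIntegral A σ u) t
        + (∑ μ, ext u t μ • curvatureDensity A σ μ t) * extend (curvatureIntegral A σ v) t) := by
  refine (((isPrimitive_curvatureIntegral' A σ v).mul (isPrimitive_curvatureIntegral' A σ u)).add
    (IsPrimitive.sum Finset.univ fun μ _ => IsPrimitive.sum Finset.univ fun ν _ =>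
    isPrimitive_J ν σ _).neg).congr fun t _ => ?_
  have h : ∑ μ, ∑ ν, velocity σ t ν • extend
        (⁅curvatureIntegral A σ v, translate A (fieldStrength A μ ν) σ⁆ * coord μ u) t
      = extend (curvatureIntegral A σ v) t * (∑ μ, ext u t μ • curvatureDensity A σ μ t)
        - (∑ μ, ext u t μ • curvatureDensity A σ μ t) * extend (curvatureIntegral A σ v) t := by
    simp only [Ring.lie_def, extend_mul, extend_sub, extend_coord, curvatureDensity,
      Finset.mul_sum, Finset.sum_mul, Finset.smul_sum, ← Finset.sum_sub_distrib, mul_smul_comm,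
      smul_mul_assoc, mul_one]
    refine Finset.sum_congr rfl fun μ _ => Finset.sum_congr rfl fun ν _ => ?_
    rw [smul_comm, smul_sub, smul_sub]
  simp only [Pi.add_apply, Pi.neg_apply, Finset.sum_apply, h]
  abel

theorem translate_fieldStrength_antisymm {A : Fin 4 → Spacetime → R}
    (hA : ∀ μ, ContDiff ℝ ∞ (A μ)) (σ : Curve q) (μ ν : Fin 4) (t : ℝ) :
    extend (translate A (fieldStrength A μ ν) σ) t
      = -extend (translate A (fieldStrength A ν μ) σ) t := by
  rw [extend_translate A (contDiff_fieldStrength hA μ ν).continuous,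
    extend_translate A (contDiff_fieldStrength hA ν μ).continuous, fieldStrength_antisymm A μ ν]
  simp

/-- Averaging the form over `(u, v)` and `(v, u)` symmetrises the coefficients `G` of the Lévy part.
In the part with velocities, exchanging the indices of the antisymmetric `g` flips the sign, which
absorbs the minus in front and leaves the singular form. -/
theorem levy_density_identity {ι : Type*} [Fintype ι] (h : R) (u v u' v' : ι → ℝ) (g G : ι → ι → R)
    (hg : ∀ μ ν, g μ ν = -g ν μ) :
    (-(1 / 2) : ℝ) • (h * ((∑ μ, ∑ ν, (u' ν * v μ) • g μ ν + ∑ lam, ∑ μ, (u lam * v μ) • G lam μ)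
      + (∑ μ, ∑ ν, (v' ν * u μ) • g μ ν + ∑ lam, ∑ μ, (v lam * u μ) • G lam μ)))
    = (∑ μ, ∑ ν, (u μ * v ν) • ((-(1 / 2) : ℝ) • (h * (G μ ν + G ν μ))))
      + (1 / 2 : ℝ) • ∑ μ, ∑ ν, (u' μ * v ν + v' μ * u ν) • (h * g μ ν) := by
  have h1 : ∀ u' v : ι → ℝ, ∑ μ, ∑ ν, (u' ν * v μ) • g μ ν = -∑ μ, ∑ ν, (u' μ * v ν) • g μ ν := by
    intro u' v
    rw [Finset.sum_comm, ← Finset.sum_neg_distrib]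
    refine Finset.sum_congr rfl fun μ _ => ?_
    rw [← Finset.sum_neg_distrib]
    refine Finset.sum_congr rfl fun ν _ => ?_
    rw [hg, smul_neg]
  have h2 : ∑ lam, ∑ μ, (v lam * u μ) • G lam μ = ∑ lam, ∑ μ, (u lam * v μ) • G μ lam := by
    rw [Finset.sum_comm]
    simp only [mul_comm]
  have h3 : ∑ μ, ∑ ν, (u μ * v ν) • ((-(1 / 2) : ℝ) • (h * (G μ ν + G ν μ)))
      = (-(1 / 2) : ℝ) • (h * (∑ lam, ∑ μ, (u lam * v μ) • G lam μ
        + ∑ lam, ∑ μ, (u lam * v μ) • G μ lam)) := by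
    simp only [← Finset.sum_add_distrib, Finset.mul_sum, Finset.smul_sum]
    refine Finset.sum_congr rfl fun μ _ => Finset.sum_congr rfl fun ν _ => ?_
    rw [smul_comm, ← smul_add, mul_smul_comm]
  have h4 : ∑ μ, ∑ ν, (u' μ * v ν + v' μ * u ν) • (h * g μ ν)
      = h * (∑ μ, ∑ ν, (u' μ * v ν) • g μ ν + ∑ μ, ∑ ν, (v' μ * u ν) • g μ ν) := by
    simp only [← Finset.sum_add_distrib, Finset.mul_sum]
    refine Finset.sum_congr rfl fun μ _ => Finset.sum_congr rfl fun ν _ => ?_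
    rw [← add_smul, mul_smul_comm]
  rw [h1, h1, h2, h3, h4, ← mul_smul_comm, ← mul_smul_comm, ← mul_smul_comm, ← mul_add]
  congr 1
  module

variable [CompleteSpace R]

theorem intervalIntegrable_levyKernel_sum (A : Fin 4 → Spacetime → R) (σ u v : Curve q) :
    IntervalIntegrable (fun t => ∑ μ, ∑ ν, (ext u t μ * ext v t ν) • levyKernel A σ μ ν t)
      volume 0 1 := by
  have h : ∀ μ ν, IntervalIntegrable (fun t => (ext u t μ * ext v t ν) • levyKernel A σ μ ν t)
      volume 0 1 := fun μ ν => by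
    have hl : IntervalIntegrable (levyKernel A σ μ ν) volume 0 1 :=
      (intervalIntegrable_iff_integrableOn_Icc_of_le zero_le_one).2
        (integrableOn_levyKernel A σ μ ν)
    refine hl.continuousOn_smul (f := fun t => ext u t μ * ext v t ν) (Continuous.continuousOn ?_)
    have hc : ∀ (w : Curve q) (κ : Fin 4), Continuous fun t => ext w t κ := fun w κ =>
      (EuclideanSpace.proj (𝕜 := ℝ) κ).continuous.comp (extend (toContinuousMap w)).continuous
    exact (hc u μ).mul (hc v ν)
  have h1 := IntervalIntegrable.sum Finset.univ fun μ _ =>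
    IntervalIntegrable.sum Finset.univ fun ν _ => h μ ν
  refine h1.congr fun t _ => ?_
  simp only [Finset.sum_apply]

theorem intervalIntegrable_singularKernel_sum (A : Fin 4 → Spacetime → R) (σ u v : Curve q) :
    IntervalIntegrable (fun t => ∑ μ, ∑ ν,
      (velocity u t μ * ext v t ν + velocity v t μ * ext u t ν) • singularKernel A σ μ ν t)
      volume 0 1 := by
  have hc : ∀ (w : Curve q) (κ : Fin 4), Continuous fun t => ext w t κ := fun w κ =>
      (EuclideanSpace.proj (𝕜 := ℝ) κ).continuous.comp (extend (toContinuousMap w)).continuous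
  have h : ∀ μ ν, IntervalIntegrable (fun t =>
      (velocity u t μ * ext v t ν + velocity v t μ * ext u t ν) • singularKernel A σ μ ν t)
      volume 0 1 := fun μ ν =>
    (((intervalIntegrable_velocity_apply u μ).mul_continuousOn (hc v ν).continuousOn).add
      ((intervalIntegrable_velocity_apply v μ).mul_continuousOn
        (hc u ν).continuousOn)).smul_continuousOn (Continuous.continuousOn
      (continuous_const.mul (extend (translate A (fieldStrength A μ ν) σ)).continuous))
  have h1 := IntervalIntegrable.sum Finset.univ fun μ _ =>
    IntervalIntegrable.sum Finset.univ fun ν _ => h μ ν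
  refine h1.congr fun t _ => ?_
  simp only [Finset.sum_apply]

variable {A : Fin 4 → Spacetime → R} (hA : ∀ μ, ContDiff ℝ ∞ (A μ))
  (hU : ∀ σ : Curve q, IsUnit (transportMap A σ))
include hA hU

theorem fderiv_fderiv_holonomy_eq (σ : Curve q) {u v : Curve q} (hu : u ∈ closedCurves q)
    (hv : v ∈ closedCurves q) :
    fderiv ℝ (fderiv ℝ (holonomy A)) σ v u = (holonomy A σ * ∫ t in (0 : ℝ)..1,
        ((∑ μ, ext v t μ • curvatureDensity A σ μ t) * extend (curvatureIntegral A σ u) t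
          + (∑ μ, ext u t μ • curvatureDensity A σ μ t) * extend (curvatureIntegral A σ v) t))
      - holonomy A σ * levyForm A σ v u 1 := by
  rw [← (isPrimitive_mul_sub_commutator A σ u v).apply_one
    (by simp [ContinuousMap.sum_apply, J_apply_zero, curvatureIntegral_apply_zero]),
    fderiv_fderiv_holonomy hA hU σ hu hv, ← mul_sub]
  congr 1
  simp only [ContinuousMap.sub_apply, ContinuousMap.add_apply, ContinuousMap.neg_apply]
  abel

theorem hasLevyKernels_holonomy (σ : Curve q) :
    HasLevyKernels (fderiv ℝ (fderiv ℝ (holonomy A)) σ) (volterraKernel A σ) (levyKernel A σ)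
      (singularKernel A σ) where
  integrable_volterra := integrableOn_volterraKernel A σ
  integrable_levy := integrableOn_levyKernel A σ
  memLp_singular := memLp_singularKernel A σ
  levy_symm := levyKernel_symm A σ
  singular_antisymm μ ν t := by
    rw [singularKernel, singularKernel, translate_fieldStrength_antisymm hA σ μ ν, mul_neg]
  eq_on u hu v hv := by
    -- By symmetry of second derivatives the form equals its own average over the two orders. The
    -- Volterra integral is already symmetric, so only `levyForm` is affected.
    have hsymm : fderiv ℝ (fderiv ℝ (holonomy A)) σ u v = fderiv ℝ (fderiv ℝ (holonomy A)) σ v u :=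
      (contDiff_holonomy hA 2).contDiffAt.isSymmSndFDerivAt (by simp) u v
    have h1 := fderiv_fderiv_holonomy_eq hA hU σ hv hu
    have h2 := fderiv_fderiv_holonomy_eq hA hU σ hu hv
    have hadd : ∀ a b : ℝ → R, (∫ t in (0 : ℝ)..1, (a t + b t)) = ∫ t in (0 : ℝ)..1, (b t + a t) :=
      fun a b => by simp only [add_comm]
    rw [hadd] at h2
    have hsum : fderiv ℝ (fderiv ℝ (holonomy A)) σ u v = (1 / 2 : ℝ) •
        (fderiv ℝ (fderiv ℝ (holonomy A)) σ u v + fderiv ℝ (fderiv ℝ (holonomy A)) σ v u) := by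
      rw [← hsymm]
      module
    have p1 := isPrimitive_levyForm A σ u v
    have p2 := isPrimitive_levyForm A σ v u
    have hL := ((-(1 / 2) : ℝ) • ContinuousLinearMap.mul ℝ R (holonomy A σ)).intervalIntegral_comp_comm
      (p1.1.add p2.1)
    rw [intervalIntegral.integral_add p1.1 p2.1, ← p1.apply_one (levyForm_apply_zero A σ u v),
      ← p2.apply_one (levyForm_apply_zero A σ v u)] at hL
    simp only [_root_.smul_apply, ContinuousLinearMap.mul_apply'] at hL
    have key : ∀ t, _ := fun t => levy_density_identity (holonomy A σ) (ext u t) (ext v t) (velocity u t)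
      (velocity v t) (fun μ ν => extend (translate A (fieldStrength A μ ν) σ) t)
      (fun lam μ => ∑ κ, velocity σ t κ •
        extend (translate A (covDeriv A lam (fieldStrength A μ κ)) σ) t)
      (fun μ ν => translate_fieldStrength_antisymm hA σ μ ν t)
    simp only [key] at hL
    simp only [← Finset.sum_add_distrib, ← smul_add] at hL
    have hL2 := (intervalIntegral.integral_add (intervalIntegrable_levyKernel_sum A σ u v)
      ((intervalIntegrable_singularKernel_sum A σ u v).smul (1 / 2 : ℝ))).symm.trans hL
    simp only [Pi.smul_apply] at hL2
    rw [intervalIntegral.integral_smul] at hL2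
    rw [integral_volterraKernel, hsum, h1, h2, add_assoc]
    refine Eq.trans ?_ (congrArg _ hL2.symm)
    rw [mul_add]
    module

end LevyRepresentation

/-! ### Smooth curves -/

section SmoothCurve

theorem isSobolevCurve_of_contDiff {q : ℝ≥0∞} {γ : ℝ → Spacetime} (hγ : ContDiff ℝ 1 γ)
    (h0 : γ 0 = 0) : IsSobolevCurve q fun t => γ t := by
  have he : ∀ t ∈ Set.Icc (0 : ℝ) 1, ext (fun t => γ t) t = γ t := fun t ht => by
    rw [ext, Set.IccExtend_of_mem _ _ ht]
  refine ⟨?_, h0, ?_⟩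
  · refine absolutelyContinuousOnInterval_of_dist_le (K := 1)
      (hγ.contDiffOn (s := Set.uIcc 0 1)).absolutelyContinuousOnInterval fun x hx y hy => ?_
    rw [Set.uIcc_of_le zero_le_one] at hx hy
    rw [he x hx, he y hy, one_mul]
  · have hd : deriv (ext fun t => γ t) =ᵐ[volume.restrict (Set.Ioo 0 1)] deriv γ := by
      filter_upwards [ae_restrict_mem measurableSet_Ioo] with t ht
      refine Filter.EventuallyEq.deriv_eq ?_
      filter_upwards [Ioo_mem_nhds ht.1 ht.2] with s hs
      exact he s (Set.Ioo_subset_Icc_self hs)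
    rw [memLp_congr_ae hd]
    have hc : Continuous (deriv γ) := hγ.continuous_deriv_one
    obtain ⟨C, hC⟩ := isCompact_Icc.exists_bound_of_continuousOn
      (hc.continuousOn (s := Set.Icc (0 : ℝ) 1))
    have := isProbabilityMeasure_Ioo
    refine MemLp.of_bound hc.aestronglyMeasurable C ?_
    filter_upwards [ae_restrict_mem measurableSet_Ioo] with t ht
    exact hC t (Set.Ioo_subset_Icc_self ht)

/-- A continuously differentiable curve as an element of `W^{1,q}_0`. -/
def smoothCurve {q : ℝ≥0∞} {γ : ℝ → Spacetime} (hγ : ContDiff ℝ 1 γ) (h0 : γ 0 = 0) : Curve q :=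
  ⟨fun t => γ t, isSobolevCurve_of_contDiff hγ h0⟩

variable {q : ℝ≥0∞} {γ : ℝ → Spacetime} (hγ : ContDiff ℝ 1 γ) (h0 : γ 0 = 0)

theorem smoothCurve_apply (t : unitInterval) : (smoothCurve hγ h0 : Curve q) t = γ t := rfl

theorem ext_smoothCurve {t : ℝ} (ht : t ∈ Set.Icc (0 : ℝ) 1) :
    ext (smoothCurve hγ h0 : Curve q) t = γ t := by
  rw [ext, Set.IccExtend_of_mem _ _ ht]
  rfl

theorem velocity_smoothCurve {t : ℝ} (ht : t ∈ Set.Ioo (0 : ℝ) 1) :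
    velocity (smoothCurve hγ h0 : Curve q) t = deriv γ t := by
  refine Filter.EventuallyEq.deriv_eq ?_
  filter_upwards [Ioo_mem_nhds ht.1 ht.2] with s hs
  exact ext_smoothCurve hγ h0 (Set.Ioo_subset_Icc_self hs)

end SmoothCurve

/-! ### Uniqueness of the Lévy trace -/

section RiemannLebesgue

variable {E : Type*} [NormedAddCommGroup E] [NormedSpace ℂ E]

/-- The Riemann–Lebesgue lemma on a measurable set. The Fourier character is `exp(-2πi t w)`, so the
frequency is `w = -(c / 2π) n`. -/
theorem tendsto_integral_exp_smul {f : ℝ → E} {m : Measure ℝ} {s : Set ℝ}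
    (hm : m = volume.restrict s) (hs : MeasurableSet s) {c : ℝ} (hc : c ≠ 0) :
    Filter.Tendsto (fun n : ℕ => ∫ t, Complex.exp (c * n * t * Complex.I) • f t ∂m)
      Filter.atTop (nhds 0) := by
  have h := Real.tendsto_integral_exp_smul_cocompact (s.indicator f)
  have hlim : Filter.Tendsto (fun n : ℕ => -(c / (2 * Real.pi)) * n) Filter.atTop
      (Filter.cocompact ℝ) := by
    refine tendsto_cocompact_of_tendsto_dist_comp_atTop 0 ?_
    have hpos : 0 < |c / (2 * Real.pi)| := by positivity
    refine (tendsto_natCast_atTop_atTop.const_mul_atTop hpos).congr fun n => ?_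
    rw [dist_zero_right, norm_mul, norm_neg, Real.norm_eq_abs, Real.norm_natCast]
  refine (h.comp hlim).congr fun n => ?_
  rw [hm, ← integral_indicator hs]
  refine integral_congr_ae (.of_forall fun t => ?_)
  have he : Real.fourierChar (-(t * (-(c / (2 * Real.pi)) * n))) • s.indicator f t
      = Complex.exp (c * n * t * Complex.I) • s.indicator f t := by
    rw [Circle.smul_def, Real.fourierChar_apply]
    congr 2
    push_cast
    have : (Real.pi : ℂ) ≠ 0 := by exact_mod_cast Real.pi_ne_zero
    field_simp
  simp only [he]
  by_cases ht : t ∈ s <;> simp [ht]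

theorem integrable_exp_smul {f : ℝ → E} {m : Measure ℝ} (hf : Integrable f m) (c : ℝ) (n : ℕ) :
    Integrable (fun t : ℝ => Complex.exp (c * n * t * Complex.I) • f t) m := by
  have hc : Continuous fun t : ℝ => Complex.exp (c * n * t * Complex.I) := by fun_prop
  refine hf.bdd_smul 1 hc.aestronglyMeasurable (.of_forall fun t => ?_)
  have := Complex.norm_exp_ofReal_mul_I (c * n * t)
  push_cast at this
  exact this.le

theorem tendsto_integral_cos_smul {f : ℝ → E} {s : Set ℝ} (hf : IntegrableOn f s)
    (hs : MeasurableSet s) {c : ℝ} (hc : c ≠ 0) :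
    Filter.Tendsto (fun n : ℕ => ∫ t in s, Real.cos (c * n * t) • f t) Filter.atTop (nhds 0) := by
  have h1 := tendsto_integral_exp_smul (f := f) rfl hs hc
  have h2 := tendsto_integral_exp_smul (f := f) rfl hs (neg_ne_zero.2 hc)
  have h := (h1.add h2).const_smul (1 / 2 : ℂ)
  rw [add_zero, smul_zero] at h
  refine h.congr fun n => ?_
  have hi := fun c : ℝ => integrable_exp_smul hf c n
  rw [← integral_add (hi c) (hi (-c)), ← integral_smul]
  refine integral_congr_ae (.of_forall fun t => ?_)
  simp only
  rw [← add_smul, smul_smul, ← Complex.coe_smul (Real.cos _), Complex.ofReal_cos, Complex.cos]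
  congr 1
  push_cast
  ring_nf

theorem tendsto_integral_sin_smul {f : ℝ → E} {s : Set ℝ} (hf : IntegrableOn f s)
    (hs : MeasurableSet s) {c : ℝ} (hc : c ≠ 0) :
    Filter.Tendsto (fun n : ℕ => ∫ t in s, Real.sin (c * n * t) • f t) Filter.atTop (nhds 0) := by
  have h1 := tendsto_integral_exp_smul (f := f) rfl hs hc
  have h2 := tendsto_integral_exp_smul (f := f) rfl hs (neg_ne_zero.2 hc)
  have h := (h2.sub h1).const_smul (Complex.I / 2 : ℂ)
  rw [sub_zero, smul_zero] at h
  refine h.congr fun n => ?_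
  have hi := fun c : ℝ => integrable_exp_smul hf c n
  rw [← integral_sub (hi (-c)) (hi c), ← integral_smul]
  refine integral_congr_ae (.of_forall fun t => ?_)
  simp only
  rw [← sub_smul, smul_smul, ← Complex.coe_smul (Real.sin _), Complex.ofReal_sin, Complex.sin]
  congr 1
  push_cast
  ring_nf

/-- For almost every `x` the inner integral tends to `0` by the one-dimensional statement; `∫ ‖f(x,
y)‖ dy` dominates it. -/
theorem tendsto_integral_integral_sin_smul {f : ℝ × ℝ → E} {s : Set ℝ}
    (hf : IntegrableOn f (s ×ˢ s)) (hs : MeasurableSet s) {c : ℝ} (hc : c ≠ 0) :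
    Filter.Tendsto (fun n : ℕ => ∫ x in s, ∫ y in s,
      (Real.sin (c * n * x) * Real.sin (c * n * y)) • f (x, y)) Filter.atTop (nhds 0) := by
  rw [IntegrableOn, Measure.volume_eq_prod, ← Measure.prod_restrict] at hf
  rw [← integral_zero ℝ E (μ := volume.restrict s)]
  refine tendsto_integral_of_dominated_convergence (fun x => ∫ y in s, ‖f (x, y)‖) ?_
    hf.integral_norm_prod_left ?_ ?_
  · intro n
    refine AEStronglyMeasurable.integral_prod_right'
      (f := fun z : ℝ × ℝ => (Real.sin (c * n * z.1) * Real.sin (c * n * z.2)) • f z) ?_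
    have hs : Continuous fun z : ℝ × ℝ => Real.sin (c * n * z.1) * Real.sin (c * n * z.2) := by
      fun_prop
    exact hs.aestronglyMeasurable.smul hf.1
  · intro n
    filter_upwards [hf.prod_right_ae] with x hx
    refine norm_integral_le_of_norm_le hx.norm (.of_forall fun y => ?_)
    rw [norm_smul, norm_mul]
    refine mul_le_of_le_one_left (norm_nonneg _) (mul_le_one₀ ?_ (norm_nonneg _) ?_)
    · exact Real.abs_sin_le_one _
    · exact Real.abs_sin_le_one _
  · filter_upwards [hf.prod_right_ae] with x hx
    refine squeeze_zero_norm (fun n => ?_) 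
      (by simpa using (tendsto_integral_sin_smul hx hs hc).norm)
    simp only [mul_smul]
    rw [integral_smul, norm_smul]
    exact mul_le_of_le_one_left (norm_nonneg _) (Real.abs_sin_le_one _)

end RiemannLebesgue

/-! ### Sine curves recover the Lévy trace -/

section LevyTrace

variable {q : ℝ≥0∞}

theorem contDiff_sine (μ : Fin 4) (n : ℕ) :
    ContDiff ℝ 1 fun t : ℝ => Real.sin (Real.pi * n * t) • p μ := by
  have h : ContDiff ℝ 1 fun t : ℝ => Real.pi * n * t := by fun_prop
  exact h.sin.smul contDiff_const

/-- The closed curve `t ↦ sin(nπt) p_μ`. -/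
def sineCurve (q : ℝ≥0∞) (μ : Fin 4) (n : ℕ) : Curve q :=
  smoothCurve (contDiff_sine μ n) (by simp)

theorem sineCurve_mem_closedCurves (μ : Fin 4) (n : ℕ) : sineCurve q μ n ∈ closedCurves q := by
  change Real.sin (Real.pi * n * ((1 : unitInterval) : ℝ)) • p μ = 0
  rw [Set.Icc.coe_one, mul_one, mul_comm, Real.sin_nat_mul_pi, zero_smul]

theorem p_apply (μ ν : Fin 4) : p μ ν = if ν = μ then 1 else 0 := by
  simp [p]

theorem ext_sineCurve_apply (μ ν : Fin 4) (n : ℕ) {t : ℝ} (ht : t ∈ Set.Icc (0 : ℝ) 1) :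
    ext (sineCurve q μ n) t ν = if ν = μ then Real.sin (Real.pi * n * t) else 0 := by
  rw [sineCurve, ext_smoothCurve _ _ ht, PiLp.smul_apply, p_apply]
  simp

theorem velocity_sineCurve_apply {μ ν : Fin 4} (n : ℕ) {t : ℝ} (ht : t ∈ Set.Ioo (0 : ℝ) 1)
    (hν : ν ≠ μ) : velocity (sineCurve q μ n) t ν = 0 := by
  rw [sineCurve, velocity_smoothCurve _ _ ht, deriv_smul_const (by fun_prop), PiLp.smul_apply,
    p_apply, if_neg hν, smul_zero]

variable [hq : Fact (1 ≤ q)] {V : Type} [NormedAddCommGroup V] [NormedSpace ℂ V]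

/-- On `sin(nπt) p_μ` the Volterra part tends to `0` by Riemann–Lebesgue. The Lévy part has the
factor `sin² = (1 - cos(2nπt))/2`, whose mean `1/2` survives. The singular part only sees `QS μ μ`,
which vanishes by antisymmetry. -/
theorem HasLevyKernels.tendsto_sineCurve {Q : Curve q →L[ℝ] Curve q →L[ℝ] V}
    {QV : Fin 4 → Fin 4 → ℝ × ℝ → V} {QL QS : Fin 4 → Fin 4 → ℝ → V}
    (h : HasLevyKernels Q QV QL QS) (μ : Fin 4) :
    Filter.Tendsto (fun n => Q (sineCurve q μ n) (sineCurve q μ n)) Filter.atTop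
      (nhds ((1 / 2 : ℝ) • ∫ t in (0 : ℝ)..1, QL μ μ t)) := by
  have hpi := Real.pi_ne_zero
  have h1 := tendsto_integral_integral_sin_smul (h.integrable_volterra μ μ) measurableSet_Icc hpi
  have h2 := (tendsto_integral_cos_smul (h.integrable_levy μ μ) measurableSet_Icc
    (mul_ne_zero two_ne_zero hpi)).const_smul (1 / 2 : ℝ)
  rw [smul_zero] at h2
  have h3 := h1.add ((tendsto_const_nhds (x := (1 / 2 : ℝ) • ∫ t in Set.Icc (0 : ℝ) 1,
    QL μ μ t)).sub h2)
  have hI : ∀ f : ℝ → V, (∫ t in (0 : ℝ)..1, f t) = ∫ t in Set.Icc (0 : ℝ) 1, f t := fun f => by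
    rw [intervalIntegral.integral_of_le zero_le_one, integral_Icc_eq_integral_Ioc]
  rw [zero_add, sub_zero] at h3
  rw [hI]
  refine h3.congr fun n => ?_
  have hmem := sineCurve_mem_closedCurves (q := q) μ n
  rw [h.eq_on _ hmem _ hmem]
  have e1 : (∫ t in (0 : ℝ)..1, ∫ s in (0 : ℝ)..1, ∑ κ, ∑ ν,
      (ext (sineCurve q μ n) t κ * ext (sineCurve q μ n) s ν) • QV κ ν (t, s))
      = ∫ x in Set.Icc (0 : ℝ) 1, ∫ y in Set.Icc (0 : ℝ) 1,
        (Real.sin (Real.pi * n * x) * Real.sin (Real.pi * n * y)) • QV μ μ (x, y) := by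
    rw [hI]
    refine setIntegral_congr_fun measurableSet_Icc fun t ht => ?_
    simp only
    rw [hI]
    refine setIntegral_congr_fun measurableSet_Icc fun s hs => ?_
    simp [ext_sineCurve_apply _ _ _ ht, ext_sineCurve_apply _ _ _ hs]
  have e2 : (∫ t in (0 : ℝ)..1, ∑ κ, ∑ ν,
      (ext (sineCurve q μ n) t κ * ext (sineCurve q μ n) t ν) • QL κ ν t)
      = (1 / 2 : ℝ) • (∫ t in Set.Icc (0 : ℝ) 1, QL μ μ t)
        - (1 / 2 : ℝ) • ∫ t in Set.Icc (0 : ℝ) 1, Real.cos (2 * Real.pi * n * t) • QL μ μ t := by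
    have hL : Integrable (QL μ μ) (volume.restrict (Set.Icc (0 : ℝ) 1)) := h.integrable_levy μ μ
    have hcos : Integrable (fun t => Real.cos (2 * Real.pi * n * t) • QL μ μ t)
        (volume.restrict (Set.Icc (0 : ℝ) 1)) := by
      have hc : Continuous fun t : ℝ => Real.cos (2 * Real.pi * n * t) := by fun_prop
      exact (h.integrable_levy μ μ).continuousOn_smul hc.continuousOn isCompact_Icc
    rw [← smul_sub, ← integral_sub hL hcos, ← integral_smul, hI]
    refine setIntegral_congr_fun measurableSet_Icc fun t ht => ?_
    have hsin : Real.sin (Real.pi * n * t) * Real.sin (Real.pi * n * t)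
        = (1 / 2) * (1 - Real.cos (2 * Real.pi * n * t)) := by
      have : 2 * Real.pi * n * t = 2 * (Real.pi * n * t) := by ring
      rw [this, Real.cos_two_mul, Real.cos_sq']
      ring
    simp only [ext_sineCurve_apply _ _ _ ht, mul_ite, ite_mul, zero_mul, mul_zero, ite_smul,
      zero_smul, Finset.sum_ite_eq', Finset.mem_univ, if_true, hsin, mul_smul, sub_smul, one_smul]
  have e3 : (∫ t in (0 : ℝ)..1, ∑ κ, ∑ ν,
      (velocity (sineCurve q μ n) t κ * ext (sineCurve q μ n) t ν
        + velocity (sineCurve q μ n) t κ * ext (sineCurve q μ n) t ν) • QS κ ν t) = 0 := by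
    rw [← intervalIntegral.integral_zero (a := 0) (b := 1) (μ := volume) (E := V)]
    refine intervalIntegral_congr_Ioo (.of_forall fun t ht => ?_) ⟨zero_le_one, le_rfl⟩
    refine Finset.sum_eq_zero fun κ _ => Finset.sum_eq_zero fun ν _ => ?_
    by_cases hκ : κ = μ
    · by_cases hν : ν = μ
      · subst hκ hν
        have h0 : (2 : ℝ) • QS ν ν t = 0 := by
          rw [two_smul]
          nth_rewrite 1 [h.singular_antisymm ν ν t]
          exact neg_add_cancel _
        rw [(smul_eq_zero_iff_right two_ne_zero).1 h0, smul_zero]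
      · simp [ext_sineCurve_apply _ _ _ (Set.Ioo_subset_Icc_self ht), hν]
    · simp [velocity_sineCurve_apply n ht hκ]
  rw [e1, e2, e3, smul_zero, add_zero]

theorem sum_η_smul {V : Type*} [AddCommGroup V] [Module ℝ V] (f : Fin 4 → Fin 4 → V) :
    ∑ μ, ∑ ν, η μ ν • f μ ν = ∑ μ, η μ μ • f μ μ := by
  refine Finset.sum_congr rfl fun μ _ => Finset.sum_eq_single μ (fun ν _ hν => ?_) (by simp)
  rw [η, Matrix.diagonal_apply_ne _ hν.symm, zero_smul]

/-- The Lévy trace does not depend on the kernels. -/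
theorem HasLevyKernels.levyTrace_eq {Q : Curve q →L[ℝ] Curve q →L[ℝ] V}
    {QV : Fin 4 → Fin 4 → ℝ × ℝ → V} {QL QS : Fin 4 → Fin 4 → ℝ → V}
    (h : HasLevyKernels Q QV QL QS) :
    levyTrace Q = ∫ t in (0 : ℝ)..1, ∑ μ, ∑ ν, η μ ν • QL μ ν t := by
  have hmem : MemLevySpace Q := ⟨QL, QV, QS, h⟩
  -- As `η` is diagonal, the trace needs only the integrals of `QL μ μ`, which are the quantities
  -- determined by sine curves.
  have key : ∀ {QV : Fin 4 → Fin 4 → ℝ × ℝ → V} {QL QS : Fin 4 → Fin 4 → ℝ → V},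
      HasLevyKernels Q QV QL QS → (∫ t in (0 : ℝ)..1, ∑ μ, ∑ ν, η μ ν • QL μ ν t)
        = ∑ μ, η μ μ • ∫ t in (0 : ℝ)..1, QL μ μ t := by
    intro QV QL QS h
    simp only [sum_η_smul]
    rw [intervalIntegral.integral_finsetSum]
    · simp only [intervalIntegral.integral_smul]
    · intro μ _
      exact ((intervalIntegrable_iff_integrableOn_Icc_of_le zero_le_one).2
        (h.integrable_levy μ μ)).smul _
  obtain ⟨QV', QS', h'⟩ := hmem.choose_spec
  rw [levyTrace, dif_pos hmem, key h, key h']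
  refine Finset.sum_congr rfl fun μ _ => ?_
  congr 1
  have := tendsto_nhds_unique (h'.tendsto_sineCurve μ) (h.tendsto_sineCurve μ)
  exact smul_right_injective V (by norm_num : (1 / 2 : ℝ) ≠ 0) this

end LevyTrace

/-! ### Vector measures on the unit interval and uniqueness of the endpoint atom -/

section Endpoint

variable {V : Type} [NormedAddCommGroup V] [NormedSpace ℝ V] [CompleteSpace V]

section VectorMeasure

variable {X : Type*} [MeasurableSpace X]

theorem isFiniteMeasure_variation_withDensity {ρ : Measure X} {d : X → V} (hd : Integrable d ρ) :
    IsFiniteMeasure (ρ.withDensityᵥ d).variation := by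
  rw [Measure.variation_withDensityᵥ hd]
  exact isFiniteMeasure_withDensity hd.2.ne

theorem vectorMeasure_integral_indicator (ρ : VectorMeasure X V) [IsFiniteMeasure ρ.variation]
    {s : Set X} (hs : MeasurableSet s) (c : ℝ) :
    ρ.integral (s.indicator fun _ => c) (ContinuousLinearMap.lsmul ℝ ℝ) = c • ρ s := by
  rw [VectorMeasure.integral_eq_setToFun, setToFun_indicator_const _ hs (measure_ne_top _ _)]
  rfl

theorem integral_withDensity_simpleFunc {ρ : Measure X} {d : X → V} (hd : Integrable d ρ)
    (f : SimpleFunc X ℝ) :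
    (ρ.withDensityᵥ d).integral f (ContinuousLinearMap.lsmul ℝ ℝ) = ∫ x, f x • d x ∂ρ := by
  have hfin := isFiniteMeasure_variation_withDensity hd
  classical
  induction f using SimpleFunc.induction with
  | const c hs =>
    rw [SimpleFunc.coe_piecewise, SimpleFunc.coe_const, SimpleFunc.coe_const,
      Function.const_zero, Set.piecewise_eq_indicator]
    refine (vectorMeasure_integral_indicator _ hs c).trans ?_
    rw [withDensityᵥ_apply hd hs, ← integral_smul, ← integral_indicator hs]
    refine integral_congr_ae (Filter.Eventually.of_forall fun x => ?_)
    simp only [Set.indicator_apply, ite_smul, zero_smul, Function.const_apply]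
  | add hfg hf hg =>
    rename_i f g
    have hint : ∀ h : SimpleFunc X ℝ, Integrable (fun x => h x • d x) ρ := fun h => by
      obtain ⟨C, hC⟩ := h.exists_forall_norm_le
      exact hd.bdd_smul C h.aestronglyMeasurable (Filter.Eventually.of_forall hC)
    rw [SimpleFunc.coe_add]
    refine (VectorMeasure.integral_fun_add (f.integrable_of_isFiniteMeasure)
      (g.integrable_of_isFiniteMeasure)).trans ?_
    rw [hf, hg, ← integral_add (hint f) (hint g)]
    simp only [Pi.add_apply, add_smul]

/-- Bounded approximation by simple functions; dominated convergence on both sides, with dominating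
functions `C` for the variation and `C ‖d‖` for `ρ`. -/
theorem integral_withDensity {ρ : Measure X} {d : X → V} (hd : Integrable d ρ) {f : X → ℝ}
    (hf : StronglyMeasurable f) {C : ℝ} (hC : ∀ x, ‖f x‖ ≤ C) :
    (ρ.withDensityᵥ d).integral f (ContinuousLinearMap.lsmul ℝ ℝ) = ∫ x, f x • d x ∂ρ := by
  have hfin := isFiniteMeasure_variation_withDensity hd
  rcases isEmpty_or_nonempty X with hX | ⟨⟨x₀⟩⟩
  · rw [VectorMeasure.integral_of_isEmpty, integral_of_isEmpty]
  have hC0 : 0 ≤ C := (norm_nonneg _).trans (hC x₀)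
  have h1 : Filter.Tendsto (fun n => (ρ.withDensityᵥ d).integral (hf.approxBounded C n)
      (ContinuousLinearMap.lsmul ℝ ℝ)) Filter.atTop
      (nhds ((ρ.withDensityᵥ d).integral f (ContinuousLinearMap.lsmul ℝ ℝ))) :=
    VectorMeasure.tendsto_integral_of_dominated_convergence (fun _ => C)
      (fun n => (hf.approxBounded C n).aestronglyMeasurable) (integrable_const _)
      (fun n => Filter.Eventually.of_forall (hf.norm_approxBounded_le hC0 n))
      (Filter.Eventually.of_forall fun x => hf.tendsto_approxBounded_of_norm_le (hC x))
  have h2 : Filter.Tendsto (fun n => ∫ x, hf.approxBounded C n x • d x ∂ρ) Filter.atTop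
      (nhds (∫ x, f x • d x ∂ρ)) := by
    refine tendsto_integral_of_dominated_convergence (fun x => C * ‖d x‖)
      (fun n => (hf.approxBounded C n).aestronglyMeasurable.smul hd.aestronglyMeasurable)
      (hd.norm.const_mul C) (fun n => Filter.Eventually.of_forall fun x => ?_)
      (Filter.Eventually.of_forall fun x =>
        (hf.tendsto_approxBounded_of_norm_le (hC x)).smul_const _)
    rw [norm_smul]
    exact mul_le_mul_of_nonneg_right (hf.norm_approxBounded_le hC0 n x) (norm_nonneg _)
  simp only [integral_withDensity_simpleFunc hd] at h1
  exact tendsto_nhds_unique h1 h2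

end VectorMeasure

variable {q : ℝ≥0∞}

omit [NormedSpace ℝ V] [CompleteSpace V] in
theorem integrable_unitInterval {d : ℝ → V} (hd : IntervalIntegrable d volume 0 1) :
    Integrable (fun t : unitInterval => d t) := by
  have h := (intervalIntegrable_iff_integrableOn_Icc_of_le zero_le_one).1 hd
  exact (integrableOn_iff_comap_subtypeVal measurableSet_Icc).1 h

omit [CompleteSpace V] in
theorem integral_unitInterval (d : ℝ → V) :
    ∫ t : unitInterval, d t = ∫ t in (0 : ℝ)..1, d t := by
  rw [intervalIntegral.integral_of_le zero_le_one, ← integral_Icc_eq_integral_Ioc]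
  exact integral_subtype_comap measurableSet_Icc d

/-- The measure with an atom of mass `c` at `1` and with density `d`. -/
def atomDensity (c : V) (d : ℝ → V) : VectorMeasure unitInterval V :=
  VectorMeasure.dirac 1 c + volume.withDensityᵥ fun t : unitInterval => d t

omit [CompleteSpace V] in
theorem atomDensity_singleton (c : V) {d : ℝ → V} (hd : IntervalIntegrable d volume 0 1) :
    atomDensity c d {1} = c := by
  rw [atomDensity, _root_.add_apply, VectorMeasure.dirac_apply_of_mem (measurableSet_singleton _)
    (Set.mem_singleton _), withDensityᵥ_apply (integrable_unitInterval hd)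
    (measurableSet_singleton _), Measure.restrict_zero_set (measure_singleton _),
    integral_zero_measure, add_zero]

theorem isFiniteMeasure_variation_atomDensity (c : V) {d : ℝ → V}
    (hd : IntervalIntegrable d volume 0 1) : IsFiniteMeasure (atomDensity c d).variation := by
  have := isFiniteMeasure_variation_withDensity (integrable_unitInterval hd)
  exact isFiniteMeasure_of_le _ VectorMeasure.variation_add_le

theorem integral_atomDensity (c : V) {d : ℝ → V} (hd : IntervalIntegrable d volume 0 1)
    (f : C(unitInterval, ℝ)) :
    (atomDensity c d).integral f (ContinuousLinearMap.lsmul ℝ ℝ) =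
      f 1 • c + ∫ t in (0 : ℝ)..1, extend f t • d t := by
  have hd' := integrable_unitInterval hd
  have := isFiniteMeasure_variation_withDensity hd'
  have hfm : StronglyMeasurable f := f.continuous.stronglyMeasurable
  have hint : ∀ (ρ : Measure unitInterval) [IsFiniteMeasure ρ], Integrable f ρ := fun ρ _ =>
    (memLp_top_of_bound hfm.aestronglyMeasurable ‖f‖
      (Filter.Eventually.of_forall f.norm_coe_le_norm)).integrable le_top
  rw [atomDensity]
  refine (VectorMeasure.integral_add_vectorMeasure (hint _) (hint _)).trans ?_
  rw [VectorMeasure.integral_dirac, integral_withDensity hd' hfm f.norm_coe_le_norm,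
    ← integral_unitInterval]
  simp only [extend_coe]
  rfl

variable [hq : Fact (1 ≤ q)]

/-- A component of a curve as a continuous function. -/
def component (u : Curve q) (μ : Fin 4) : C(unitInterval, ℝ) :=
  ⟨fun t => u t μ, (EuclideanSpace.proj μ).continuous.comp (continuous_curve u)⟩

theorem isRepresentedBy_atomDensity {T : Curve q →L[ℝ] V} {c : Fin 4 → V} {d : Fin 4 → ℝ → V}
    (hd : ∀ μ, IntervalIntegrable (d μ) volume 0 1)
    (hT : ∀ u : Curve q, T u = ∑ μ, u 1 μ • c μ + ∫ t in (0 : ℝ)..1, ∑ μ, ext u t μ • d μ t) :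
    IsRepresentedBy T fun μ => atomDensity (c μ) (d μ) := by
  refine ⟨fun μ => isFiniteMeasure_variation_atomDensity _ (hd μ), fun u => ?_⟩
  have h : ∀ μ, (atomDensity (c μ) (d μ)).integral (fun t => u t μ)
      (ContinuousLinearMap.lsmul ℝ ℝ) = u 1 μ • c μ + ∫ t in (0 : ℝ)..1, ext u t μ • d μ t :=
    fun μ => integral_atomDensity (c μ) (hd μ) (component u μ)
  simp only [h]
  rw [hT, Finset.sum_add_distrib, intervalIntegral.integral_finsetSum]
  intro μ _
  exact (hd μ).continuousOn_smul (extend (component u μ)).continuous.continuousOn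

theorem contDiff_monomial (μ : Fin 4) (n : ℕ) : ContDiff ℝ 1 fun t : ℝ => t ^ (n + 1) • p μ := by
  have h : ContDiff ℝ 1 fun t : ℝ => t ^ (n + 1) := by fun_prop
  exact h.smul contDiff_const

/-- The curve `t ↦ t ^ (n + 1) p_μ`. -/
def monomialCurve (q : ℝ≥0∞) (μ : Fin 4) (n : ℕ) : Curve q :=
  smoothCurve (contDiff_monomial μ n) (by simp)

omit hq in
theorem monomialCurve_apply (μ ν : Fin 4) (n : ℕ) (t : unitInterval) :
    monomialCurve q μ n t ν = if ν = μ then (t : ℝ) ^ (n + 1) else 0 := by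
  rw [monomialCurve, smoothCurve_apply, PiLp.smul_apply, p_apply]
  simp

/-- On `[0,1]` the functions `t^(n+1)` decrease to the indicator of `{1}`, so dominated convergence
reads off the atom from `T` alone. The exponent `n + 1` ensures that the curve starts at `0`. -/
theorem IsRepresentedBy.tendsto_monomialCurve {T : Curve q →L[ℝ] V}
    {ρ : Fin 4 → VectorMeasure unitInterval V} (h : IsRepresentedBy T ρ) (μ : Fin 4) :
    Filter.Tendsto (fun n => T (monomialCurve q μ n)) Filter.atTop (nhds (ρ μ {1})) := by
  have hfin := h.1 μ
  have h1 : ∀ n, T (monomialCurve q μ n) =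
      (ρ μ).integral (fun t : unitInterval => (t : ℝ) ^ (n + 1))
        (ContinuousLinearMap.lsmul ℝ ℝ) := by
    intro n
    rw [h.2, Finset.sum_eq_single μ]
    · simp only [monomialCurve_apply, if_true]
    · intro ν _ hν
      simp only [monomialCurve_apply, if_neg hν]
      exact VectorMeasure.integral_zero
    · simp
  simp only [h1]
  rw [← one_smul ℝ (ρ μ {1}),
    ← vectorMeasure_integral_indicator (ρ μ) (measurableSet_singleton _) 1]
  refine VectorMeasure.tendsto_integral_of_dominated_convergence (fun _ => 1)
    (fun n => ?_) (integrable_const _) (fun n => Filter.Eventually.of_forall fun t => ?_)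
    (Filter.Eventually.of_forall fun t => ?_)
  · exact Continuous.aestronglyMeasurable (by fun_prop)
  · rw [norm_pow, Real.norm_of_nonneg t.2.1]
    exact pow_le_one₀ t.2.1 t.2.2
  · by_cases ht : t = 1
    · subst ht; simp
    · rw [Set.indicator_of_notMem (by simpa using ht)]
      refine (tendsto_pow_atTop_nhds_zero_of_lt_one t.2.1 ?_).comp (Filter.tendsto_add_atTop_nat 1)
      exact lt_of_le_of_ne t.2.2 fun h => ht (Subtype.ext h)

theorem IsRepresentedBy.endpointFunctional_eq {T : Curve q →L[ℝ] V}
    {ρ : Fin 4 → VectorMeasure unitInterval V} (h : IsRepresentedBy T ρ) (μ : Fin 4) :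
    endpointFunctional (p μ) T = ρ μ {1} := by
  have hT : ∃ ρ, IsRepresentedBy T ρ := ⟨ρ, h⟩
  rw [endpointFunctional, dif_pos hT, Finset.sum_eq_single μ]
  · rw [p_apply, if_pos rfl, one_smul]
    exact tendsto_nhds_unique (hT.choose_spec.tendsto_monomialCurve μ) (h.tendsto_monomialCurve μ)
  · intro ν _ hν
    rw [p_apply, if_neg hν, zero_smul]
  · simp

end Endpoint

/-! ### Endpoint derivatives of parallel translates -/

section EndpointTranslate

variable {q : ℝ≥0∞} [hq : Fact (1 ≤ q)] {R : Type} [NormedRing R] [NormedAlgebra ℝ R]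
  [CompleteSpace R] {A : Fin 4 → Spacetime → R}

theorem fderiv_translate_apply_one (hA : ∀ μ, ContDiff ℝ ∞ (A μ))
    (hU : ∀ σ : Curve q, IsUnit (transportMap A σ)) {f : Spacetime → R} (hf : ContDiff ℝ ∞ f)
    (σ u : Curve q) :
    fderiv ℝ (fun σ : Curve q => translate A f σ 1) σ u =
      ∑ μ, u 1 μ • translate A (covDeriv A μ f) σ 1 +
        ∫ t in (0 : ℝ)..1, ∑ μ, ext u t μ • ⁅curvatureDensity A σ μ t, translate A f σ 1⁆ := by
  have hd := ((contDiff_translate hA hU hf 1).differentiable (by simp)) σ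
  have hd' : fderiv ℝ (fun σ : Curve q => translate A f σ 1) σ = _ :=
    (hasFDerivAt_apply_one hd.hasFDerivAt).fderiv
  let L : R →L[ℝ] R := (ContinuousLinearMap.mul ℝ R).flip (translate A f σ 1) -
    ContinuousLinearMap.mul ℝ R (translate A f σ 1)
  have hL : ∀ a, L a = ⁅a, translate A f σ 1⁆ := fun a => rfl
  have hprim := isPrimitive_curvatureIntegral' A σ u
  have hint : ⁅curvatureIntegral A σ u 1, translate A f σ 1⁆ =
      ∫ t in (0 : ℝ)..1, ∑ μ, ext u t μ • ⁅curvatureDensity A σ μ t, translate A f σ 1⁆ := by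
    rw [← hL, hprim.apply_one (curvatureIntegral_apply_zero A σ u),
      ← L.intervalIntegral_comp_comm hprim.intervalIntegrable]
    simp only [← hL, map_sum, map_smul]
  rw [hd', ContinuousLinearMap.comp_apply, fderiv_translate hA hU hf, evalOne_apply,
    ContinuousMap.add_apply, ContinuousMap.sum_apply, ← hint]
  simp only [ContinuousMap.mul_apply, coord_apply, mul_smul_comm, mul_one]
  rfl

theorem isRepresentedBy_translate (hA : ∀ μ, ContDiff ℝ ∞ (A μ))
    (hU : ∀ σ : Curve q, IsUnit (transportMap A σ)) {f : Spacetime → R} (hf : ContDiff ℝ ∞ f)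
    (σ : Curve q) :
    IsRepresentedBy (fderiv ℝ (fun σ : Curve q => translate A f σ 1) σ) fun μ =>
      atomDensity (translate A (covDeriv A μ f) σ 1)
        fun t => ⁅curvatureDensity A σ μ t, translate A f σ 1⁆ := by
  refine isRepresentedBy_atomDensity (fun μ => ?_) (fderiv_translate_apply_one hA hU hf σ)
  exact ((intervalIntegrable_curvatureDensity A σ μ).mul_const _).sub
    ((intervalIntegrable_curvatureDensity A σ μ).const_mul _)

theorem memDomEndpoint_translate (hA : ∀ μ, ContDiff ℝ ∞ (A μ))
    (hU : ∀ σ : Curve q, IsUnit (transportMap A σ)) {f : Spacetime → R} (hf : ContDiff ℝ ∞ f) :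
    MemDomEndpoint fun σ : Curve q => translate A f σ 1 :=
  ⟨contDiff_apply_one (contDiff_translate hA hU hf 1),
    fun σ => ⟨_, isRepresentedBy_translate hA hU hf σ⟩⟩

/-- The representing measure has its atom from the covariant derivative term; the commutator with
the curvature integral is absolutely continuous and does not charge `{1}`. -/
theorem D_translate (hA : ∀ μ, ContDiff ℝ ∞ (A μ))
    (hU : ∀ σ : Curve q, IsUnit (transportMap A σ)) {f : Spacetime → R} (hf : ContDiff ℝ ∞ f)
    (μ : Fin 4) :
    D μ (fun σ : Curve q => translate A f σ 1) = fun σ => translate A (covDeriv A μ f) σ 1 := by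
  funext σ
  refine ((isRepresentedBy_translate hA hU hf σ).endpointFunctional_eq μ).trans
    (atomDensity_singleton _ ?_)
  exact ((intervalIntegrable_curvatureDensity A σ μ).mul_const _).sub
    ((intervalIntegrable_curvatureDensity A σ μ).const_mul _)

end EndpointTranslate

/-! ### Unitarity, and agreement with the transport of the theorem -/

section ParallelTransport

variable {q : ℝ≥0∞} [hq : Fact (1 ≤ q)] {N : ℕ} {A : Fin 4 → Spacetime → Mat N}

theorem connectionAlong_mul_extend (hA : ∀ μ, Continuous (A μ)) (σ : Curve q)
    (g : C(unitInterval, Mat N)) (t : ℝ) :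
    ∑ μ, velocity σ t μ • (extend (pull (A μ) σ) t * extend g t) =
      connectionAlong A σ t * extend g t := by
  rw [connectionAlong, Finset.sum_mul]
  refine Finset.sum_congr rfl fun μ _ => ?_
  rw [extend_pull (hA μ), smul_mul_assoc]

theorem isPrimitive_transportMap' (hA : ∀ μ, Continuous (A μ)) (σ : Curve q) :
    IsPrimitive (transportMap A σ)
      (fun s => -(connectionAlong A σ s * extend (transportMap A σ) s)) :=
  (isPrimitive_transportMap A σ).congr fun t _ => by
    rw [connectionAlong_mul_extend hA]

omit hq in
theorem star_connectionAlong (hA' : ∀ μ x, star (A μ x) = -A μ x) (σ : Curve q) (t : ℝ) :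
    star (connectionAlong A σ t) = -connectionAlong A σ t := by
  simp only [connectionAlong, star_sum, star_smul, star_trivial, hA', smul_neg,
    Finset.sum_neg_distrib]

theorem isPrimitive_star_transportMap (hA : ∀ μ, Continuous (A μ))
    (hA' : ∀ μ x, star (A μ x) = -A μ x) (σ : Curve q) :
    IsPrimitive (star (transportMap A σ))
      (fun s => extend (star (transportMap A σ)) s * connectionAlong A σ s) := by
  refine ((isPrimitive_transportMap' hA σ).map ((starL' ℝ : Mat N ≃L[ℝ] Mat N) : Mat N →L[ℝ] Mat N)
    (g := star (transportMap A σ)) fun t => rfl).congr fun t _ => ?_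
  change star (-(connectionAlong A σ t * extend (transportMap A σ) t)) = _
  rw [star_neg, star_mul, star_connectionAlong hA', mul_neg, neg_neg]
  rfl

/-- Since `A` is anti-Hermitian, the derivative of `U* U` is `U* A U - U* A U = 0`, and the initial
value is `1`. -/
theorem star_transportMap_mul_self (hA : ∀ μ, Continuous (A μ))
    (hA' : ∀ μ x, star (A μ x) = -A μ x) (σ : Curve q) :
    star (transportMap A σ) * transportMap A σ = 1 := by
  have h := ((isPrimitive_star_transportMap hA hA' σ).mul
    (isPrimitive_transportMap' hA σ)).congr (b := 0) fun t _ => by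
      rw [mul_neg, mul_assoc, add_neg_cancel]; rfl
  ext1 t
  rw [h.eq_add, ContinuousMap.mul_apply, ContinuousMap.star_apply, transportMap_apply_zero]
  simp

/-- At each time, a left inverse of a square matrix is also a right inverse. -/
theorem transportMap_mul_star_self (hA : ∀ μ, Continuous (A μ))
    (hA' : ∀ μ x, star (A μ x) = -A μ x) (σ : Curve q) :
    transportMap A σ * star (transportMap A σ) = 1 := by
  ext1 t
  have h := congrArg (fun f : C(unitInterval, Mat N) => f t) (star_transportMap_mul_self hA hA' σ)
  exact mul_eq_one_comm.1 h

theorem isUnit_transportMap (hA : ∀ μ, Continuous (A μ))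
    (hA' : ∀ μ x, star (A μ x) = -A μ x) (σ : Curve q) : IsUnit (transportMap A σ) :=
  ⟨⟨_, _, transportMap_mul_star_self hA hA' σ, star_transportMap_mul_self hA hA' σ⟩, rfl⟩

theorem invTransport_eq_star (hA : ∀ μ, Continuous (A μ))
    (hA' : ∀ μ x, star (A μ x) = -A μ x) (σ : Curve q) :
    invTransport A σ = star (transportMap A σ) :=
  Ring.inverse_unit ⟨_, _, transportMap_mul_star_self hA hA' σ, star_transportMap_mul_self hA hA' σ⟩

omit hq in
theorem IsPrimitive.integral_eq_sub {f : C(unitInterval, Mat N)} {a : ℝ → Mat N}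
    (h : IsPrimitive f a) {s t : ℝ} (hs : s ∈ Set.Icc (0 : ℝ) 1) (ht : t ∈ Set.Icc (0 : ℝ) 1) :
    ∫ τ in s..t, a τ = extend f t - extend f s := by
  have hint : ∀ r ∈ Set.Icc (0 : ℝ) 1, IntervalIntegrable a volume 0 r := fun r hr =>
    h.intervalIntegrable.mono_set (Set.uIcc_subset_uIcc Set.left_mem_uIcc
      (by rwa [Set.uIcc_of_le zero_le_one]))
  rw [← intervalIntegral.integral_interval_sub_left (hint t ht) (hint s hs),
    extend_of_mem f ht, extend_of_mem f hs, h.eq_add ⟨t, ht⟩, h.eq_add ⟨s, hs⟩]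
  abel

/-- The two-parameter transport is `U_t U_s*`, as `U_s* = U_s⁻¹`. It shows that the system in the
definition of `transport` is solvable, so the default branch is never taken. -/
theorem isParallelTransport (hA : ∀ μ, Continuous (A μ))
    (hA' : ∀ μ x, star (A μ x) = -A μ x) (σ : Curve q) :
    IsParallelTransport A σ fun t s =>
      extend (transportMap A σ) t * extend (star (transportMap A σ)) s where
  continuousOn_left s _ :=
    ((extend (transportMap A σ)).continuous.mul continuous_const).continuousOn
  continuousOn_right t _ :=
    (continuous_const.mul (extend (star (transportMap A σ))).continuous).continuousOn
  left_eq s t h0 hst h1 := by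
    have h := (isPrimitive_transportMap' hA σ)
    have hi := h.integral_eq_sub (s := s) (t := t) ⟨h0, hst.trans h1⟩ ⟨h0.trans hst, h1⟩
    have hu : extend (transportMap A σ) s * extend (star (transportMap A σ)) s = 1 :=
      congrArg (fun f => extend f s) (transportMap_mul_star_self hA hA' σ)
    have hint : IntervalIntegrable
        (fun s => -(connectionAlong A σ s * extend (transportMap A σ) s)) volume s t :=
      h.intervalIntegrable.mono_set (by
        rw [Set.uIcc_of_le hst, Set.uIcc_of_le zero_le_one]; exact Set.Icc_subset_Icc h0 h1)
    have hm := ((ContinuousLinearMap.mul ℝ (Mat N)).flip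
      (extend (star (transportMap A σ)) s)).intervalIntegral_comp_comm hint
    simp only [ContinuousLinearMap.flip_apply, ContinuousLinearMap.mul_apply', neg_mul,
      intervalIntegral.integral_neg, mul_assoc] at hm
    rw [sub_eq_add_neg, hm, ← neg_mul, ← intervalIntegral.integral_neg, hi, sub_mul, hu]
    abel
  right_eq s t h0 hst h1 := by
    have h := (isPrimitive_star_transportMap hA hA' σ)
    have hi := h.integral_eq_sub (s := s) (t := t) ⟨h0, hst.trans h1⟩ ⟨h0.trans hst, h1⟩
    have hu : extend (transportMap A σ) t * extend (star (transportMap A σ)) t = 1 :=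
      congrArg (fun f => extend f t) (transportMap_mul_star_self hA hA' σ)
    have hint : IntervalIntegrable
        (fun s => extend (star (transportMap A σ)) s * connectionAlong A σ s) volume s t :=
      h.intervalIntegrable.mono_set (by
        rw [Set.uIcc_of_le hst, Set.uIcc_of_le zero_le_one]; exact Set.Icc_subset_Icc h0 h1)
    have hm := (ContinuousLinearMap.mul ℝ (Mat N)
      (extend (transportMap A σ) t)).intervalIntegral_comp_comm hint
    simp only [ContinuousLinearMap.mul_apply', ← mul_assoc] at hm
    rw [hm, hi, mul_sub, hu]
    abel

/-- The equation in `t` with `s = 0` is the Volterra equation and already determines the solution,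
so the choice made in `transport` does not affect `U_{1,0}`. -/
theorem IsParallelTransport.eq_transportMap (hA : ∀ μ, Continuous (A μ)) {σ : Curve q}
    {U : ℝ → ℝ → Mat N} (h : IsParallelTransport A σ U) : U 1 0 = transportMap A σ 1 := by
  let g : C(unitInterval, Mat N) := ⟨fun t => U t 0,
    continuousOn_iff_continuous_domRestrict.1 (h.continuousOn_left 0 ⟨le_rfl, zero_le_one⟩)⟩
  have hg : g + volterra (fun ν => pull (A ν) σ) σ g = 1 := by
    ext1 t
    rw [ContinuousMap.add_apply, (isPrimitive_volterra _ σ g).eq_add, volterra_apply_zero, zero_add]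
    change U t 0 + _ = 1
    rw [h.left_eq 0 t le_rfl t.2.1 t.2.2]
    have e : ∫ τ in (0 : ℝ)..t, connectionAlong A σ τ * U τ 0 =
        ∫ s in (0 : ℝ)..t, ∑ ν, velocity σ s ν • (extend (pull (A ν) σ) s * extend g s) := by
      refine intervalIntegral.integral_congr fun s hs => ?_
      rw [Set.uIcc_of_le t.2.1] at hs
      rw [connectionAlong_mul_extend hA, extend_of_mem g ⟨hs.1, hs.2.trans t.2.2⟩]
      rfl
    rw [e, sub_add_cancel]
  have := eq_of_add_volterra_eq (hg.trans (transportMap_add_volterra A σ).symm)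
  exact congrArg (fun f : C(unitInterval, Mat N) => f 1) this

theorem U10_eq (hA : ∀ μ, Continuous (A μ)) (hA' : ∀ μ x, star (A μ x) = -A μ x) :
    U10 (q := q) A = holonomy A := by
  funext σ
  have h : ∃ U, IsParallelTransport A σ U := ⟨_, isParallelTransport hA hA' σ⟩
  rw [U10, transport, dif_pos h]
  exact h.choose_spec.eq_transportMap hA

theorem star_holonomy_mul_self (hA : ∀ μ, Continuous (A μ))
    (hA' : ∀ μ x, star (A μ x) = -A μ x) (σ : Curve q) :
    star (holonomy A σ) * holonomy A σ = 1 :=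
  congrArg (fun f : C(unitInterval, Mat N) => f 1) (star_transportMap_mul_self hA hA' σ)

theorem translate_apply_one (hA : ∀ μ, Continuous (A μ))
    (hA' : ∀ μ x, star (A μ x) = -A μ x) {f : Spacetime → Mat N} (hf : Continuous f)
    (σ : Curve q) : translate A f σ 1 = star (holonomy A σ) * f (σ 1) * holonomy A σ := by
  rw [translate, invTransport_eq_star hA hA', ContinuousMap.mul_apply, ContinuousMap.mul_apply,
    pull_apply hf]
  rfl

theorem Φ_eq (hA : ∀ μ, Continuous (A μ)) (hA' : ∀ μ x, star (A μ x) = -A μ x)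
    {f : Spacetime → Mat N} (hf : Continuous f) :
    Φ (q := q) A f = fun σ => translate A f σ 1 := by
  funext σ
  rw [translate_apply_one hA hA' hf, Φ, U01, U10_eq hA hA',
    Matrix.inv_eq_left_inv (star_holonomy_mul_self hA hA' σ)]

theorem trace_conj_unitary {u : Mat N} (hu : star u * u = 1) (M : Mat N) :
    (star u * M * u).trace = M.trace := by
  rw [Matrix.trace_mul_cycle, mul_eq_one_comm.1 hu, one_mul]

theorem conj_unitary_mul {u : Mat N} (hu : star u * u = 1) (M M' : Mat N) :
    star u * M * u * (star u * M' * u) = star u * (M * M') * u := by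
  have h := mul_eq_one_comm.1 hu
  calc _ = star u * M * (u * star u) * M' * u := by noncomm_ring
    _ = _ := by rw [h]; noncomm_ring

theorem conj_unitary_eq_zero {u : Mat N} (hu : star u * u = 1) {M : Mat N}
    (h : star u * M * u = 0) : M = 0 := by
  have h' := mul_eq_one_comm.1 hu
  calc M = u * star u * M * (u * star u) := by rw [h', one_mul, mul_one]
    _ = u * (star u * M * u) * star u := by noncomm_ring
    _ = 0 := by rw [h, mul_zero, zero_mul]

theorem conj_unitary_mem_su {u : Mat N} (hu : star u * u = 1) {M : Mat N} (hM : M ∈ su N) :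
    star u * M * u ∈ su N := by
  refine ⟨?_, (trace_conj_unitary hu M).trans hM.2⟩
  rw [← Matrix.star_eq_conjTranspose, star_mul, star_mul, star_star, Matrix.star_eq_conjTranspose M,
    hM.1]
  noncomm_ring

theorem trace_conjTranspose_conj_unitary {u : Mat N} (hu : star u * u = 1) (M : Mat N) :
    ((star u * M * u)ᴴ * (star u * M * u)).trace = (Mᴴ * M).trace := by
  have h : (star u * M * u)ᴴ = star u * Mᴴ * u := by
    rw [← Matrix.star_eq_conjTranspose, star_mul, star_mul, star_star,
      Matrix.star_eq_conjTranspose M, mul_assoc]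
  rw [h, conj_unitary_mul hu, trace_conj_unitary hu]

end ParallelTransport

/-! ### Compatibility of the transport with the rescaled curves `σ^r` -/

section Rescale

variable {q : ℝ≥0∞}

theorem mul_mem_Icc (r : unitInterval) {t : ℝ} (ht : t ∈ Set.Icc (0 : ℝ) 1) :
    (r : ℝ) * t ∈ Set.Icc (0 : ℝ) 1 :=
  (r * ⟨t, ht⟩ : unitInterval).2

theorem ext_rescale (σ : Curve q) (r : unitInterval) {t : ℝ} (ht : t ∈ Set.Icc (0 : ℝ) 1) :
    ext (rescale σ r) t = ext σ (r * t) := by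
  rw [ext, ext, Set.IccExtend_of_mem _ _ ht, Set.IccExtend_of_mem _ _ (mul_mem_Icc r ht)]
  rfl

theorem velocity_rescale (σ : Curve q) (r : unitInterval) {t : ℝ} (ht : t ∈ Set.Ioo (0 : ℝ) 1) :
    velocity (rescale σ r) t = (r : ℝ) • velocity σ (r * t) := by
  have h : ext (rescale σ r) =ᶠ[nhds t] fun t => ext σ (r * t) := by
    filter_upwards [Ioo_mem_nhds ht.1 ht.2] with s hs
    exact ext_rescale σ r (Set.Ioo_subset_Icc_self hs)
  rw [velocity, h.deriv_eq]
  exact deriv_comp_mul_left (r : ℝ) (ext σ) t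

/-- The function `t ↦ f(rt)`. -/
def dilate {V : Type*} [TopologicalSpace V] (r : unitInterval) (f : C(unitInterval, V)) :
    C(unitInterval, V) :=
  ⟨fun t => f (r * t), f.continuous.comp (continuous_const.mul continuous_id)⟩

theorem extend_dilate {V : Type*} [TopologicalSpace V] (r : unitInterval)
    (f : C(unitInterval, V)) {t : ℝ} (ht : t ∈ Set.Icc (0 : ℝ) 1) :
    extend (dilate r f) t = extend f (r * t) := by
  rw [extend_of_mem _ ht, extend_of_mem _ (mul_mem_Icc r ht)]
  rfl

variable [hq : Fact (1 ≤ q)]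

theorem J_rescale {V : Type} [NormedAddCommGroup V] [NormedSpace ℝ V] (μ : Fin 4) (σ : Curve q)
    (r : unitInterval) (g : C(unitInterval, V)) :
    J μ (rescale σ r) (dilate r g) = dilate r (J μ σ g) := by
  ext1 t
  rw [J_apply_apply, intervalIntegral_congr_Ioo (g := fun s => (r : ℝ) •
    (velocity σ (r * s) μ • extend g (r * s))) (Filter.Eventually.of_forall fun s hs => ?_) t.2,
    intervalIntegral.integral_smul,
    intervalIntegral.smul_integral_comp_mul_left fun s => velocity σ s μ • extend g s, mul_zero]
  · rfl
  · rw [velocity_rescale σ r hs, extend_dilate r g (Set.Ioo_subset_Icc_self hs), smul_smul]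
    rfl

variable {R : Type} [NormedRing R] [NormedAlgebra ℝ R] [CompleteSpace R]

theorem pull_rescale {f : Spacetime → R} (hf : Continuous f) (σ : Curve q) (r : unitInterval) :
    pull f (rescale σ r) = dilate r (pull f σ) := by
  ext1 t
  rw [pull_apply hf]
  exact (pull_apply hf σ (r * t)).symm

/-- By the substitution `s ↦ rs` the dilated transport solves the Volterra equation of `σ^r`;
uniqueness does the rest. -/
theorem transportMap_rescale {A : Fin 4 → Spacetime → R} (hA : ∀ μ, Continuous (A μ))
    (σ : Curve q) (r : unitInterval) :
    transportMap A (rescale σ r) = dilate r (transportMap A σ) := by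
  refine eq_of_add_volterra_eq ((transportMap_add_volterra A (rescale σ r)).trans ?_)
  have h : volterra (fun ν => pull (A ν) (rescale σ r)) (rescale σ r)
      (dilate r (transportMap A σ)) =
      dilate r (volterra (fun ν => pull (A ν) σ) σ (transportMap A σ)) := by
    have e : ∀ ν, J ν (rescale σ r) (pull (A ν) (rescale σ r) * dilate r (transportMap A σ)) =
        dilate r (J ν σ (pull (A ν) σ * transportMap A σ)) := fun ν => by
      rw [pull_rescale (hA ν), ← J_rescale]
      rfl
    rw [volterra_apply, volterra_apply]
    simp only [e]
    ext1 t
    rw [ContinuousMap.sum_apply]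
    change _ = (∑ ν, J ν σ (pull (A ν) σ * transportMap A σ)) (r * t)
    rw [ContinuousMap.sum_apply]
    rfl
  rw [h]
  exact (congrArg (dilate r) (transportMap_add_volterra A σ)).symm

end Rescale

/-! ### The Lévy d'Alembertian and the Yang–Mills current -/

section Current

variable {q : ℝ≥0∞} [hq : Fact (1 ≤ q)] {N : ℕ} {A : Fin 4 → Spacetime → Mat N}

/-- The left-hand side of the Yang–Mills equation. -/
def yangMillsCurrent (A : Fin 4 → Spacetime → Mat N) (φ : Spacetime → Mat N) (ν : Fin 4)
    (x : Spacetime) : Mat N :=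
  ∑ lam, ∑ μ, η lam μ • covDeriv A lam (fieldStrength A μ ν) x - ⁅φ x, covDeriv A ν φ x⁆

theorem contDiff_yangMillsCurrent (hA : ∀ μ, ContDiff ℝ ∞ (A μ)) {φ : Spacetime → Mat N}
    (hφ : ContDiff ℝ ∞ φ) (ν : Fin 4) : ContDiff ℝ ∞ (yangMillsCurrent A φ ν) := by
  refine ContDiff.sub ?_ (contDiff_lie hφ (contDiff_covDeriv hA hφ ν))
  exact ContDiff.sum fun lam _ => ContDiff.sum fun μ _ =>
    (contDiff_covDeriv hA (contDiff_fieldStrength hA μ ν) lam).const_smul (η lam μ)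

theorem extend_translate' (hA : ∀ μ, Continuous (A μ)) (hA' : ∀ μ x, star (A μ x) = -A μ x)
    {f : Spacetime → Mat N} (hf : Continuous f) (σ : Curve q) (t : ℝ) :
    extend (translate A f σ) t =
      star (extend (transportMap A σ) t) * f (ext σ t) * extend (transportMap A σ) t := by
  rw [extend_translate A hf, invTransport_eq_star hA hA']
  rfl

theorem star_extend_transportMap_mul_self (hA : ∀ μ, Continuous (A μ))
    (hA' : ∀ μ x, star (A μ x) = -A μ x) (σ : Curve q) (t : ℝ) :
    star (extend (transportMap A σ) t) * extend (transportMap A σ) t = 1 :=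
  congrArg (fun f => extend f t) (star_transportMap_mul_self hA hA' σ)

theorem translate_rescale (hA : ∀ μ, Continuous (A μ)) (hA' : ∀ μ x, star (A μ x) = -A μ x)
    {f : Spacetime → Mat N} (hf : Continuous f) (σ : Curve q) (r : unitInterval) :
    translate A f (rescale σ r) = dilate r (translate A f σ) := by
  rw [translate, translate, invTransport_eq_star hA hA', invTransport_eq_star hA hA',
    transportMap_rescale hA, pull_rescale hf]
  rfl

theorem lie_conj_unitary {u : Mat N} (hu : star u * u = 1) (M M' : Mat N) :
    ⁅star u * M * u, star u * M' * u⁆ = star u * ⁅M, M'⁆ * u := by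
  rw [Ring.lie_def, Ring.lie_def, conj_unitary_mul hu, conj_unitary_mul hu, mul_sub, sub_mul]

/-- The translate along `σ^r` at its end is the translate along `σ` at time `r`, and conjugation by
a unitary matrix preserves commutators. -/
theorem currentIntegrand_eq (hA : ∀ μ, ContDiff ℝ ∞ (A μ))
    (hA' : ∀ μ x, star (A μ x) = -A μ x) {φ : Spacetime → Mat N} (hφ : ContDiff ℝ ∞ φ)
    (σ : Curve q) :
    currentIntegrand (Φ A φ) σ = fun t => ∑ ν, velocity σ t ν •
      extend (translate A (fun x => ⁅φ x, covDeriv A ν φ x⁆) σ) t := by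
  have hAc := fun μ => (hA μ).continuous
  have hU := fun σ : Curve q => isUnit_transportMap hAc hA' σ
  funext t
  refine Finset.sum_congr rfl fun ν _ => ?_
  have h1 : ∀ {f : Spacetime → Mat N}, ContDiff ℝ ∞ f → ∀ r : unitInterval,
      translate A f (rescale σ r) 1 = translate A f σ r := fun {f} hf r => by
    rw [translate_rescale hAc hA' hf.continuous]
    change translate A f σ (r * 1) = _
    rw [mul_one]
  have hc := contDiff_covDeriv hA hφ ν
  rw [Φ_eq hAc hA' hφ.continuous, D_translate hA hU hφ ν]
  simp only [h1 hφ, h1 hc, ← extend_apply]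
  rw [extend_translate' hAc hA' hφ.continuous, extend_translate' hAc hA' hc.continuous,
    extend_translate' hAc hA' (contDiff_lie hφ hc).continuous,
    lie_conj_unitary (star_extend_transportMap_mul_self hAc hA' σ t)]

theorem intervalIntegrable_sum_velocity_smul {V : Type} [NormedAddCommGroup V] [NormedSpace ℝ V]
    (σ : Curve q) (g : Fin 4 → C(unitInterval, V)) :
    IntervalIntegrable (fun t => ∑ ν, velocity σ t ν • extend (g ν) t) volume 0 1 := by
  have h := IntervalIntegrable.sum (f := fun ν s => velocity σ s ν • extend (g ν) s)
    Finset.univ fun ν _ => intervalIntegrable_velocity_smul σ ν _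
  have e : (fun t => ∑ ν, velocity σ t ν • extend (g ν) t)
      = ∑ ν, fun s => velocity σ s ν • extend (g ν) s := by
    funext t
    rw [Finset.sum_apply]
  rwa [e]

/-- The Lévy trace contributes `-∇^μ F_{μν}` and the current `+[φ, ∇_ν φ]`, both translated back to
the start of the curve and contracted with `σ̇^ν`. -/
theorem levyBox_add_mul_integral (hA : ∀ μ, ContDiff ℝ ∞ (A μ))
    (hA' : ∀ μ x, star (A μ x) = -A μ x) {φ : Spacetime → Mat N} (hφ : ContDiff ℝ ∞ φ)
    (σ : Curve q) :
    levyBox (holonomy A) σ + holonomy A σ * (∫ r in (0 : ℝ)..1, currentIntegrand (Φ A φ) σ r) =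
      -(holonomy A σ * ∑ ν, J ν σ (translate A (yangMillsCurrent A φ ν) σ) 1) := by
  have hAc := fun μ => (hA μ).continuous
  have hU := fun σ : Curve q => isUnit_transportMap hAc hA' σ
  have hYM := fun ν => (contDiff_yangMillsCurrent hA hφ ν).continuous
  have hlie := fun ν => (contDiff_lie hφ (contDiff_covDeriv hA hφ ν)).continuous
  have hcF := fun μ ν =>
    (contDiff_covDeriv hA (contDiff_fieldStrength hA μ ν) μ).continuous
  have hcur : IntervalIntegrable (currentIntegrand (Φ A φ) σ) volume 0 1 := by
    rw [currentIntegrand_eq hA hA' hφ]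
    exact intervalIntegrable_sum_velocity_smul σ _
  have hlevy : IntervalIntegrable (fun t => ∑ μ, ∑ ν, η μ ν • levyKernel A σ μ ν t) volume 0 1 := by
    rw [intervalIntegrable_iff_integrableOn_Icc_of_le zero_le_one]
    exact integrable_finsetSum _ fun μ _ => integrable_finsetSum _ fun ν _ =>
      (integrableOn_levyKernel A σ μ ν).smul (η μ ν)
  let L := ContinuousLinearMap.mul ℝ (Mat N) (holonomy A σ)
  have hL : ∀ M, L M = holonomy A σ * M := fun M => rfl
  have hlb : levyBox (holonomy A) σ = _ := (hasLevyKernels_holonomy hA hU σ).levyTrace_eq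
  rw [hlb, ← hL, ← L.intervalIntegral_comp_comm hcur,
    ← intervalIntegral.integral_add hlevy ⟨L.integrable_comp hcur.1, L.integrable_comp hcur.2⟩]
  have hJ : ∑ ν, J ν σ (translate A (yangMillsCurrent A φ ν) σ) 1 =
      ∫ t in (0 : ℝ)..1, ∑ ν, velocity σ t ν • extend (translate A (yangMillsCurrent A φ ν) σ) t := by
    rw [intervalIntegral.integral_finsetSum fun ν _ => intervalIntegrable_velocity_smul σ ν _]
    rfl
  rw [hJ, ← hL, ← L.intervalIntegral_comp_comm (intervalIntegrable_sum_velocity_smul σ _),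
    ← intervalIntegral.integral_neg]
  refine intervalIntegral.integral_congr fun t _ => ?_
  simp only [hL]
  rw [sum_η_smul, currentIntegrand_eq hA hA' hφ]
  -- On the diagonal the two symmetrised terms coincide, so the factor `-1/2` becomes `-1`.
  have hdiag : ∀ μ, levyKernel A σ μ μ t = -(holonomy A σ * ∑ κ, velocity σ t κ •
      extend (translate A (covDeriv A μ (fieldStrength A μ κ)) σ) t) := fun μ => by
    have h2 : ∀ M : Mat N, (-(1 / 2) : ℝ) • (M + M) = -M := fun M => by
      rw [← two_smul ℝ M, smul_smul]; norm_num
    rw [levyKernel]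
    simp only [smul_add, Finset.sum_add_distrib, mul_add]
    rw [← smul_add, h2]
  simp only [hdiag, extend_translate' hAc hA' (hYM _), extend_translate' hAc hA' (hlie _),
    extend_translate' hAc hA' (hcF _ _), yangMillsCurrent, sum_η_smul]
  simp only [Finset.smul_sum, smul_neg, Finset.sum_neg_distrib, mul_sub, sub_mul, smul_sub,
    Finset.sum_sub_distrib, Finset.mul_sum, Finset.sum_mul, mul_smul_comm, smul_mul_assoc]
  rw [Finset.sum_comm]
  simp only [smul_comm (η _ _)]
  abel

end Current

/-! ### From functional equations to pointwise field equations -/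

section Equations

variable {q : ℝ≥0∞} [hq : Fact (1 ≤ q)] {N : ℕ} {A : Fin 4 → Spacetime → Mat N}

/-- The factor `t (t - 1)` vanishes at both ends and has slope `1` at `t = 1`: the endpoints of the
segment `t x` are kept and the final velocity is corrected from `x` to `w`. -/
theorem contDiff_quadratic (x w : Spacetime) :
    ContDiff ℝ 1 fun t : ℝ => t • x + (t * (t - 1)) • (w - x) := by
  fun_prop

theorem hasDerivAt_quadratic (x w : Spacetime) (t : ℝ) :
    HasDerivAt (fun t : ℝ => t • x + (t * (t - 1)) • (w - x)) (x + (2 * t - 1) • (w - x)) t := by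
  have h1 := (hasDerivAt_id t).smul_const x
  have h2 := ((hasDerivAt_id t).mul ((hasDerivAt_id t).sub_const 1)).smul_const (w - x)
  have h := h1.add h2
  simp only [id_eq, one_mul, one_smul, mul_one] at h
  convert! h using 3
  ring

/-- A curve ending at `x` with final velocity `w`. -/
def curveTo (q : ℝ≥0∞) (x w : Spacetime) : Curve q :=
  smoothCurve (contDiff_quadratic x w) (by simp)

omit hq in
theorem curveTo_apply_one (x w : Spacetime) : curveTo q x w 1 = x := by
  change (1 : ℝ) • x + ((1 : ℝ) * (1 - 1)) • (w - x) = x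
  simp

/-- The hypothesis for `σ^r` is the vanishing of the integral along `σ` up to time `r`. -/
theorem sum_J_eq_zero (hA : ∀ μ, ContDiff ℝ ∞ (A μ)) (hA' : ∀ μ x, star (A μ x) = -A μ x)
    {f : Fin 4 → Spacetime → Mat N} (hf : ∀ ν, Continuous (f ν))
    (h : ∀ σ : Curve q, ∑ ν, J ν σ (translate A (f ν) σ) 1 = 0) (σ : Curve q) :
    ∑ ν, J ν σ (translate A (f ν) σ) = 0 := by
  ext1 r
  have h1 := h (rescale σ r)
  simp only [translate_rescale (fun μ => (hA μ).continuous) hA' (hf _), J_rescale] at h1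
  rw [ContinuousMap.sum_apply, ContinuousMap.zero_apply, ← h1]
  refine Finset.sum_congr rfl fun ν _ => ?_
  change _ = J ν σ (translate A (f ν) σ) (r * 1)
  rw [mul_one]

/-- If all partial integrals vanish, so does the integrand. On a quadratic curve ending at `x` with
final velocity `p_ν`, its value at time `1` is `f_ν(x)` conjugated by a unitary matrix. -/
theorem eq_zero_of_sum_J_eq_zero (hA : ∀ μ, ContDiff ℝ ∞ (A μ))
    (hA' : ∀ μ x, star (A μ x) = -A μ x) {f : Fin 4 → Spacetime → Mat N}
    (hf : ∀ ν, Continuous (f ν))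
    (h : ∀ σ : Curve q, ∑ ν, J ν σ (translate A (f ν) σ) 1 = 0) (ν : Fin 4) (x : Spacetime) :
    f ν x = 0 := by
  have hAc := fun μ => (hA μ).continuous
  let σ : Curve q := curveTo q x (p ν)
  let a : ℝ → Mat N := fun t => ∑ κ, (x + (2 * t - 1) • (p ν - x)) κ •
    extend (translate A (f κ) σ) t
  have ha : Continuous a := by
    refine continuous_finsetSum _ fun κ _ => ?_
    have hw : Continuous fun t : ℝ => x + (2 * t - 1) • (p ν - x) := by fun_prop
    have hv : Continuous fun t : ℝ => (x + (2 * t - 1) • (p ν - x)) κ :=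
      (EuclideanSpace.proj κ).continuous.comp hw
    exact hv.smul (extend (translate A (f κ) σ)).continuous
  have hprim : IsPrimitive (0 : C(unitInterval, Mat N)) a := by
    rw [← sum_J_eq_zero hA hA' hf h σ]
    refine (IsPrimitive.sum Finset.univ fun κ _ =>
      isPrimitive_J κ σ (translate A (f κ) σ)).congr fun t ht => ?_
    rw [Finset.sum_apply]
    refine Finset.sum_congr rfl fun κ _ => ?_
    have hv : velocity σ t = x + (2 * t - 1) • (p ν - x) :=
      (velocity_smoothCurve _ _ ht).trans (hasDerivAt_quadratic x (p ν) t).deriv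
    rw [hv]
  have hae : a =ᵐ[volume.restrict (Set.Icc (0 : ℝ) 1)] 0 := by
    rw [← restrict_Ioo_eq_restrict_Icc, Filter.EventuallyEq, ae_restrict_iff' measurableSet_Ioo]
    filter_upwards [hprim.ae_hasDerivAt] with t ht hmem
    exact (ht hmem).unique (hasDerivAt_const t (0 : Mat N))
  -- The integrand vanishes only almost everywhere at first; continuity of the explicit velocity
  -- extends this to the endpoint `1`.
  have ha1 : a 1 = 0 := Measure.eqOn_Icc_of_ae_eq volume zero_ne_one hae ha.continuousOn
    continuousOn_const (Set.right_mem_Icc.2 zero_le_one)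
  have hx : ext σ 1 = x := by
    rw [ext, Set.IccExtend_right]
    exact curveTo_apply_one x (p ν)
  have hval : a 1 = extend (translate A (f ν) σ) 1 := by
    have hw : x + (2 * (1 : ℝ) - 1) • (p ν - x) = p ν := by norm_num
    change ∑ κ, (x + (2 * (1 : ℝ) - 1) • (p ν - x)) κ • extend (translate A (f κ) σ) 1 = _
    rw [hw, Finset.sum_eq_single ν]
    · rw [p_apply, if_pos rfl, one_smul]
    · intro κ _ hκ
      rw [p_apply, if_neg hκ, zero_smul]
    · simp
  rw [hval, extend_translate' hAc hA' (hf ν), hx] at ha1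
  exact conj_unitary_eq_zero (star_extend_transportMap_mul_self hAc hA' σ 1) ha1

theorem levyBox_equation_iff (hA : ∀ μ, ContDiff ℝ ∞ (A μ))
    (hA' : ∀ μ x, star (A μ x) = -A μ x) {φ : Spacetime → Mat N} (hφ : ContDiff ℝ ∞ φ) :
    (∀ σ : Curve q, levyBox (U10 A) σ
      + U10 A σ * (∫ r in (0 : ℝ)..1, currentIntegrand (Φ A φ) σ r) = 0) ↔
    ∀ ν x, yangMillsCurrent A φ ν x = 0 := by
  have hAc := fun μ => (hA μ).continuous
  have hYM := fun ν => (contDiff_yangMillsCurrent hA hφ ν).continuous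
  rw [U10_eq hAc hA']
  simp only [levyBox_add_mul_integral hA hA' hφ]
  constructor
  · intro h
    refine eq_zero_of_sum_J_eq_zero (q := q) hA hA' hYM fun σ => ?_
    have h1 := congrArg (fun M => star (holonomy A σ) * M) (neg_eq_zero.1 (h σ))
    simpa only [← mul_assoc, star_holonomy_mul_self hAc hA', one_mul, mul_zero] using h1
  · intro h σ
    have h0 : ∀ ν, translate A (yangMillsCurrent A φ ν) σ = 0 := fun ν => by
      ext1 t
      rw [← extend_coe, extend_translate' hAc hA' (hYM ν), h, mul_zero, zero_mul]
      rfl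
    simp only [h0, map_zero, ContinuousMap.zero_apply, Finset.sum_const_zero, mul_zero, neg_zero]

/-- All terms are covariant under conjugation and the trace is invariant, so the functional equation
at `σ` is the field equation at `σ(1)` conjugated by the holonomy. -/
theorem endpoint_equation_iff (m l : ℝ) (hA : ∀ μ, ContDiff ℝ ∞ (A μ))
    (hA' : ∀ μ x, star (A μ x) = -A μ x) {φ : Spacetime → Mat N} (hφ : ContDiff ℝ ∞ φ) :
    (∀ σ : Curve q, ∑ μ, ∑ ν, η μ ν • D μ (D ν (Φ A φ)) σ
      - ((m : ℂ) ^ 2 - (l : ℂ) * ((Φ A φ σ)ᴴ * Φ A φ σ).trace) • Φ A φ σ = 0) ↔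
    ∀ x, ∑ μ, ∑ ν, η μ ν • covDeriv A μ (covDeriv A ν φ) x
      - ((m : ℂ) ^ 2 - (l : ℂ) * ((φ x)ᴴ * φ x).trace) • φ x = 0 := by
  have hAc := fun μ => (hA μ).continuous
  have hU := fun σ : Curve q => isUnit_transportMap hAc hA' σ
  have hc := fun ν => contDiff_covDeriv hA hφ ν
  have hcc := fun μ ν => contDiff_covDeriv hA (hc ν) μ
  have key : ∀ σ : Curve q, ∑ μ, ∑ ν, η μ ν • D μ (D ν (Φ A φ)) σ
      - ((m : ℂ) ^ 2 - (l : ℂ) * ((Φ A φ σ)ᴴ * Φ A φ σ).trace) • Φ A φ σ =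
      star (holonomy A σ) * (∑ μ, ∑ ν, η μ ν • covDeriv A μ (covDeriv A ν φ) (σ 1)
        - ((m : ℂ) ^ 2 - (l : ℂ) * ((φ (σ 1))ᴴ * φ (σ 1)).trace) • φ (σ 1)) * holonomy A σ := by
    intro σ
    have hu := star_holonomy_mul_self hAc hA' σ
    rw [Φ_eq hAc hA' hφ.continuous]
    simp only [D_translate hA hU hφ, D_translate hA hU (hc _)]
    simp only [translate_apply_one hAc hA' hφ.continuous, translate_apply_one hAc hA' (hcc _ _).continuous,
      trace_conjTranspose_conj_unitary hu, mul_sub, sub_mul, Finset.mul_sum, Finset.sum_mul,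
      mul_smul_comm, smul_mul_assoc]
  simp only [key]
  constructor
  · intro h x
    have h1 := conj_unitary_eq_zero (star_holonomy_mul_self hAc hA' _) (h (curveTo q x 0))
    rwa [curveTo_apply_one] at h1
  · intro h σ
    rw [h, mul_zero, zero_mul]

end Equations

end YMH

end

/-! ### The equivalence theorem -/

theorem mainTheorem4 (q : ℝ≥0∞) [Fact (1 ≤ q)] (hq : q = 1 ∨ q = 2) (N : ℕ)
    (m l : ℝ) (hm : 0 ≤ m) (hl : 0 ≤ l)
    (A : Fin 4 → Spacetime → Mat N) (hA : ∀ μ, IsSmoothSuField (A μ))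
    (φ : Spacetime → Mat N) (hφ : IsSmoothSuField φ) :
    -- the objects in the equations below are well defined
    ((∀ σ : Curve q, Φ A φ σ ∈ su N) ∧
      MemDomBox (fun σ : Curve q => U10 A σ) ∧
      MemDomEndpoint (fun σ : Curve q => Φ A φ σ) ∧
      (∀ ν, MemDomEndpoint (D ν (fun σ : Curve q => Φ A φ σ))) ∧
      (∀ σ : Curve q, IntervalIntegrable (currentIntegrand (Φ A φ) σ) volume 0 1)) ∧
    -- the equivalence
    (SolvesYangMillsHiggs m l A φ ↔
      (∀ σ : Curve q,
        ∑ μ, ∑ ν, η μ ν • D μ (D ν (Φ A φ)) σ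
          - ((m : ℂ) ^ 2 - (l : ℂ) * ((Φ A φ σ)ᴴ * Φ A φ σ).trace) • Φ A φ σ = 0) ∧
      (∀ σ : Curve q,
        levyBox (U10 A) σ
          + U10 A σ * (∫ r in (0 : ℝ)..1, currentIntegrand (Φ A φ) σ r) = 0)) := by
  have hA1 : ∀ μ, ContDiff ℝ ∞ (A μ) := fun μ => (hA μ).1
  have hAc : ∀ μ, Continuous (A μ) := fun μ => (hA1 μ).continuous
  have hA' : ∀ μ x, star (A μ x) = -A μ x := fun μ x => ((hA μ).2 x).1
  have hU : ∀ σ : Curve q, IsUnit (transportMap A σ) := fun σ => isUnit_transportMap hAc hA' σ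
  have hΦ : Φ (q := q) A φ = fun σ => translate A φ σ 1 := Φ_eq hAc hA' hφ.1.continuous
  refine ⟨⟨fun σ => ?_, ⟨?_, fun σ => ?_⟩, ?_, fun ν => ?_, fun σ => ?_⟩, ?_⟩
  · have h : Φ A φ σ = _ :=
      (congrFun hΦ σ).trans (translate_apply_one hAc hA' hφ.1.continuous σ)
    rw [h]
    exact conj_unitary_mem_su (star_holonomy_mul_self hAc hA' σ) (hφ.2 _)
  · have h := contDiff_holonomy (q := q) hA1 2
    rw [← U10_eq hAc hA'] at h
    exact h
  · have h := (U10_eq (q := q) hAc hA').symm ▸ hasLevyKernels_holonomy hA1 hU σ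
    exact ⟨_, _, _, h⟩
  · exact hΦ.symm ▸ memDomEndpoint_translate hA1 hU hφ.1
  · have h : D ν (fun σ : Curve q => Φ A φ σ) = _ :=
      (congrArg (D ν) hΦ).trans (D_translate hA1 hU hφ.1 ν)
    exact h.symm ▸ memDomEndpoint_translate hA1 hU (contDiff_covDeriv hA1 hφ.1 ν)
  · rw [currentIntegrand_eq hA1 hA' hφ.1]
    exact intervalIntegrable_sum_velocity_smul σ _
  -- The fields in `SolvesYangMillsHiggs` agree by unfolding with those written in terms of
  -- `covDeriv` and `fieldStrength`.
  · exact and_congr (endpoint_equation_iff m l hA1 hA' hφ.1).symm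
      (levyBox_equation_iff hA1 hA' hφ.1).symm
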